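/- Let $\phi_1,\phi_2,\phi_3\in\mathbb{C}^2$ be three complex Higgs doublets, let $\phi_a^\dagger\phi_b=\sum_{i=1}^2\overline{\phi_{a,i}}\,\phi_{b,i}$, and consider all potentials $$V(\phi)=\sum_{a,b}Y_{ab}(\phi_a^\dagger\phi_b)+\sum_{a,b,c,d}Z_{abcd}(\phi_a^\dagger\phi_b)(\phi_c^\dagger\phi_d)$$ with complex coefficients satisfying $\overline{Y_{ab}}=Y_{ba}$, $Z_{abcd}=Z_{cdab}$, $\overline{Z_{abcd}}=Z_{badc}$. Let $G_u=PSU(3)=SU(3)/Z(SU(3))$ act by $\phi_a\mapsto\sum_b U_{ab}\phi_b$ (up to an overall phase, which does not affect $V$), and let $G=PSU(3)\rtimes\mathbb{Z}_2$, where the generator $J$ of $\mathbb{Z}_2$ acts on doublets by componentwise complex conjugation and on $PSU(3)$ by $JUJ=U^*$; the elements of $G\setminus G_u$ are called antiunitary. A subgroup $A_u\le G_u$ (resp. $A\le G$) is called realizable in $G_u$ (resp. in $G$) if it equals the group of all $g\in G_u$ (resp. all $g\in G$) with $V(g\phi)=V(\phi)$ for all $\phi$, for some such potential $V$. Let $T\le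 PSU(3)$ be the maximal torus, i.e. the image of the diagonal matrices of $SU(3)$. 1. Up to isomorphism of topological groups, the nontrivial subgroups of $T$ that are realizable in $G_u$ are exactly $\mathbb{Z}_2$, $\mathbb{Z}_3$, $\mathbb{Z}_4$, $\mathbb{Z}_2\times\mathbb{Z}_2$, $U(1)$, $U(1)\times\mathbb{Z}_2$ and $U(1)\times U(1)$: every such subgroup is isomorphic to one of these, and each of these occurs. 2. Up to isomorphisms that preserve the distinction between unitary and antiunitary elements, the abelian subgroups of $G$ that are realizable in $G$ and contain an antiunitary element are exactly $\mathbb{Z}_2^*$, $\mathbb{Z}_2\times\mathbb{Z}_2^*$, $\mathbb{Z}_2\times\mathbb{Z}_2\times\mathbb{Z}_2^*$ and $\mathbb{Z}_4^*$, where $\mathbb{Z}_q^*$ denotes a cyclic factor of order $q$ whose generator is antiunitary, the generators of the factors without an asterisk being unitary; each of these occurs. 3. No subgroup isomorphic to $\mathbb{Z}_3\times\mathbb{Z}_3$ of $G_u$ is realizable in $G_u$, and none of $G$ is realizable in $G$. -/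

import Mathlib

noncomputable section

namespace NHDM

/-- The group `SU(N)`. -/
abbrev SU (N : ℕ) : Type := Matrix.specialUnitaryGroup (Fin N) ℂ

/-- The projective special unitary group `PSU(N) = SU(N) / Z(SU(N))`, with the quotient topology. -/
abbrev PSU (N : ℕ) : Type := SU N ⧸ Subgroup.center (SU N)

/-- The cyclic group `ℤ_n`, written multiplicatively (with the discrete topology). -/
abbrev Cyc (n : ℕ) : Type := Multiplicative (ZMod n)

theorem map_star_mem {N : ℕ} (u : SU N) :
    (u : Matrix (Fin N) (Fin N) ℂ).map (starRingEnd ℂ) ∈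
      Matrix.specialUnitaryGroup (Fin N) ℂ := by
  obtain ⟨u, hu⟩ := u
  rw [Matrix.mem_specialUnitaryGroup_iff, Matrix.mem_unitaryGroup_iff] at hu ⊢
  refine ⟨?_, ?_⟩
  · have h := congrArg (fun M => M.map (starRingEnd ℂ)) hu.1
    simp only [Matrix.map_mul] at h
    rw [Matrix.map_one _ (map_zero _) (map_one _)] at h
    rw [← h]
    congr 1
  · have h := RingHom.map_det (starRingEnd ℂ) u
    rw [hu.2, map_one] at h
    exact h.symm

/-- Entrywise complex conjugation `u ↦ J u J = u^*` as an automorphism of `SU(N)`. -/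
def conjSU (N : ℕ) : MulAut (SU N) where
  toFun u := ⟨(u : Matrix (Fin N) (Fin N) ℂ).map (starRingEnd ℂ), map_star_mem u⟩
  invFun u := ⟨(u : Matrix (Fin N) (Fin N) ℂ).map (starRingEnd ℂ), map_star_mem u⟩
  left_inv u := by ext; simp
  right_inv u := by ext; simp
  map_mul' u v := by
    apply Subtype.ext
    simp [Matrix.map_mul]

theorem conjSU_conjSU (N : ℕ) (u : SU N) : conjSU N (conjSU N u) = u :=
  (conjSU N).left_inv u

/-- The automorphism of `PSU(N)` induced by complex conjugation. -/
def conjPSU (N : ℕ) : MulAut (PSU N) :=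
  QuotientGroup.congr _ _ (conjSU N)
    (Subgroup.characteristic_iff_map_eq.mp inferInstance (conjSU N))

theorem conjPSU_mk {N : ℕ} (u : SU N) :
    conjPSU N (QuotientGroup.mk u) = QuotientGroup.mk (conjSU N u) := rfl

theorem conjPSU_mul_self (N : ℕ) : conjPSU N * conjPSU N = 1 := by
  ext x
  induction x using QuotientGroup.induction_on with
  | H u => simp [conjPSU_mk, conjSU_conjSU]

/-- The action of `ℤ₂ = ⟨J⟩` on `PSU(N)`: the generator acts by complex conjugation. -/
def conjAction (N : ℕ) : Cyc 2 →* MulAut (PSU N) where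
  toFun ε := if ε = 1 then 1 else conjPSU N
  map_one' := by simp
  map_mul' a b := by
    have key : ∀ a b : Cyc 2, a ≠ 1 → b ≠ 1 → a * b = 1 := by decide
    by_cases ha : a = 1
    · simp [ha]
    · by_cases hb : b = 1
      · simp [hb]
      · simp [ha, hb, key a b ha hb, conjPSU_mul_self]

/-- The group `G = PSU(N) ⋊ ℤ₂` of reparametrization transformations. The element `(u, ε)` is
the unitary transformation `u` if `ε = 1` and the antiunitary transformation `u ∘ J` otherwise. -/
abbrev Repar (N : ℕ) : Type := PSU N ⋊[conjAction N] Cyc 2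

/-- Antiunitary elements of `G` (generalized `CP`-transformations). -/
def IsAntiunitary {N : ℕ} (g : Repar N) : Prop := g.right ≠ 1

/-- Configurations of `N` complex doublets: row `a` is the doublet `φ_a`. -/
abbrev Doublets (N : ℕ) : Type := Matrix (Fin N) (Fin 2) ℂ

/-- The gauge-invariant bilinear `φ_a† φ_b`. -/
def bilin {N : ℕ} (φ : Doublets N) (a b : Fin N) : ℂ :=
  ∑ i, starRingEnd ℂ (φ a i) * φ b i

/-- Coefficient tensors of a renormalizable Higgs potential with `N` doublets. -/
structure Potential (N : ℕ) where
  Y : Fin N → Fin N → ℂ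
  Z : Fin N → Fin N → Fin N → Fin N → ℂ
  Y_herm : ∀ a b, starRingEnd ℂ (Y a b) = Y b a
  Z_symm : ∀ a b c d, Z a b c d = Z c d a b
  Z_herm : ∀ a b c d, starRingEnd ℂ (Z a b c d) = Z b a d c

/-- `V(φ) = Y_{ab} (φ_a† φ_b) + Z_{abcd} (φ_a† φ_b)(φ_c† φ_d)`; the value is always real. -/
def Potential.eval {N : ℕ} (V : Potential N) (φ : Doublets N) : ℂ :=
  (∑ a, ∑ b, V.Y a b * bilin φ a b) +
    ∑ a, ∑ b, ∑ c, ∑ d, V.Z a b c d * (bilin φ a b * bilin φ c d)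

/-- `J^ε`: for `ε ≠ 1`, complex conjugation of all the fields. -/
def conjPow {N : ℕ} (ε : Cyc 2) (φ : Doublets N) : Doublets N :=
  if ε = 1 then φ else φ.map (starRingEnd ℂ)

/-- The transformation `u ∘ J^ε` of the doublets: `φ_a ↦ u_{ab} φ_b` for `ε = 1`,
and `φ_a ↦ u_{ab} φ_b^*` otherwise. -/
def transform {N : ℕ} (u : SU N) (ε : Cyc 2) (φ : Doublets N) : Doublets N :=
  (u : Matrix (Fin N) (Fin N) ℂ) * conjPow ε φ

/-- The conjugate `J^ε u J^ε`. -/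
def twist {N : ℕ} (ε : Cyc 2) (u : SU N) : SU N := if ε = 1 then u else conjSU N u

theorem mk_twist {N : ℕ} (ε : Cyc 2) (u : SU N) :
    (QuotientGroup.mk (twist ε u) : PSU N) = conjAction N ε (QuotientGroup.mk u) := by
  by_cases h : ε = 1
  · simp [twist, h]
  · simp [twist, conjAction, h, conjPSU_mk]

theorem transform_mul {N : ℕ} (u v : SU N) (ε δ : Cyc 2) (φ : Doublets N) :
    transform (u * twist ε v) (ε * δ) φ = transform u ε (transform v δ φ) := by
  have key : ∀ a b : Cyc 2, a ≠ 1 → b ≠ 1 → a * b = 1 := by decide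
  unfold transform
  rw [Submonoid.coe_mul, Matrix.mul_assoc]
  congr 1
  by_cases hε : ε = 1
  · simp [hε, twist, conjPow]
  · by_cases hδ : δ = 1
    · simp [hδ, hε, twist, conjPow, conjSU, Matrix.map_mul]
    · simp only [twist, conjPow, conjSU, key ε δ hε hδ, if_true, if_false, hε, hδ, Matrix.map_mul]
      congr 1
      ext
      simp

theorem transform_one {N : ℕ} (φ : Doublets N) : transform 1 1 φ = φ := by
  simp [transform, conjPow]

/-- `g ∈ G` is a symmetry of `V` if `V(g φ) = V(φ)` for all `φ`. The elements of the centre of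
`SU(N)` are overall phase factors, which do not affect `V`, so the choice of the
representative `u` of the class `g.left` is immaterial. -/
def Potential.IsSymmetry {N : ℕ} (V : Potential N) (g : Repar N) : Prop :=
  ∃ u : SU N, QuotientGroup.mk u = g.left ∧ ∀ φ, V.eval (transform u g.right φ) = V.eval φ

/-- The full symmetry group `Aut(V) ∩ G` of the potential in `G = PSU(N) ⋊ ℤ₂`. -/
def Potential.aut {N : ℕ} (V : Potential N) : Subgroup (Repar N) where
  carrier := {g | V.IsSymmetry g}
  one_mem' := ⟨1, rfl, fun φ => by
    rw [SemidirectProduct.one_right, transform_one]⟩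
  mul_mem' := by
    rintro g h ⟨u, hu, hV⟩ ⟨v, hv, hW⟩
    refine ⟨u * twist g.right v, ?_, fun φ => ?_⟩
    · rw [QuotientGroup.mk_mul, mk_twist, hu, hv, SemidirectProduct.mul_left]
    · rw [SemidirectProduct.mul_right, transform_mul, hV, hW]
  inv_mem' := by
    rintro g ⟨u, hu, hV⟩
    have key : ∀ a : Cyc 2, a⁻¹ = a := by decide
    have key2 : ∀ a : Cyc 2, a * a = 1 := by decide
    have htt : ∀ (ε : Cyc 2) (w : SU N), twist ε (twist ε w) = w := by
      intro ε w
      by_cases h : ε = 1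
      · simp [twist, h]
      · simp [twist, h, conjSU_conjSU]
    refine ⟨twist g.right u⁻¹, ?_, fun φ => ?_⟩
    · rw [mk_twist, QuotientGroup.mk_inv, hu, SemidirectProduct.inv_left, key]
    · rw [SemidirectProduct.inv_right, key, ← hV, ← transform_mul, htt, key2, mul_inv_cancel,
        transform_one]

/-- The unitary symmetry group `Aut(V) ∩ G_u` of the potential in `G_u = PSU(N)`. -/
def Potential.autUnitary {N : ℕ} (V : Potential N) : Subgroup (PSU N) :=
  V.aut.comap SemidirectProduct.inl

/-- A subgroup of `G_u = PSU(N)` is realizable if it equals `Aut(V) ∩ G_u` for some `V`. -/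
def RealizableUnitary {N : ℕ} (A : Subgroup (PSU N)) : Prop :=
  ∃ V : Potential N, A = V.autUnitary

/-- A subgroup of `G = PSU(N) ⋊ ℤ₂` is realizable if it equals `Aut(V) ∩ G` for some `V`. -/
def Realizable {N : ℕ} (A : Subgroup (Repar N)) : Prop :=
  ∃ V : Potential N, A = V.aut

/-- The diagonal matrices in `SU(N)`. -/
def diagSU (N : ℕ) : Subgroup (SU N) where
  carrier := {u | (u : Matrix (Fin N) (Fin N) ℂ).IsDiag}
  one_mem' := by simp
  mul_mem' := by
    intro u v hu hv
    have hd := ((Matrix.isDiag_iff_diagonal_diag _).mp hu).symm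
    have he := ((Matrix.isDiag_iff_diagonal_diag _).mp hv).symm
    change ((u : Matrix (Fin N) (Fin N) ℂ) * (v : Matrix (Fin N) (Fin N) ℂ)).IsDiag
    rw [hd, he, Matrix.diagonal_mul_diagonal]
    exact Matrix.isDiag_diagonal _
  inv_mem' := by
    intro u hu
    exact Matrix.IsDiag.conjTranspose hu

/-- The maximal torus `T` of `PSU(N)`: the image of the diagonal matrices of `SU(N)`. -/
def torus (N : ℕ) : Subgroup (PSU N) :=
  (diagSU N).map (QuotientGroup.mk' (Subgroup.center (SU N)))

/-- Some realizable subgroup of the maximal torus is isomorphic to `H` as a topological group. -/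
def TorusRealizes (N : ℕ) (H : Type) [Group H] [TopologicalSpace H] : Prop :=
  ∃ A : Subgroup (PSU N), A ≤ torus N ∧ RealizableUnitary A ∧ Nonempty (A ≃ₜ* H)

/-- `A` is isomorphic to `H`, the antiunitary elements of `A` corresponding to the elements of
`H` on which `p` is nontrivial. -/
def HasType {N : ℕ} (A : Subgroup (Repar N)) {H : Type} [Group H] (p : H →* Cyc 2) : Prop :=
  ∃ e : A ≃* H, ∀ a : A, p (e a) = (a : Repar N).right

/-- `A` is an abelian realizable group that contains an antiunitary transformation. -/
def IsAbelianRealizableCP {N : ℕ} (A : Subgroup (Repar N)) : Prop :=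
  (∀ a ∈ A, ∀ b ∈ A, a * b = b * a) ∧ Realizable A ∧ ∃ a ∈ A, IsAntiunitary a

/-- `ℤ₂*`: the generator is antiunitary. -/
def typeZ2 : Cyc 2 →* Cyc 2 := MonoidHom.id _

/-- `ℤ₂ × ℤ₂*`: the generator of the last factor is antiunitary. -/
def typeZ2Z2 : Cyc 2 × Cyc 2 →* Cyc 2 := MonoidHom.snd _ _

/-- `ℤ₂ × ℤ₂ × ℤ₂*`: the generator of the last factor is antiunitary. -/
def typeZ2Z2Z2 : Cyc 2 × Cyc 2 × Cyc 2 →* Cyc 2 :=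
  (MonoidHom.snd (Cyc 2) (Cyc 2)).comp (MonoidHom.snd (Cyc 2) (Cyc 2 × Cyc 2))

/-- `ℤ₄*`: the generator is antiunitary (reduction modulo 2). -/
def typeZ4 : Cyc 4 →* Cyc 2 :=
  AddMonoidHom.toMultiplicative
    (ZMod.castHom (show 2 ∣ 4 by norm_num) (ZMod 2)).toAddMonoidHom

end NHDM

end

noncomputable section

namespace NHDM

open ComplexConjugate

/-! ### Coefficients of potentials -/

/-! A potential, as a function of doublets with two components, determines its coefficients
(`polyEval_inj`). Invariance is therefore a system of equations for `Y` and `Z`, and a change of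
basis replaces the symmetry group by a conjugate one (`inv_pull_iff`, `mem_aut_pull`). Phases do not
matter, so elements of PSU(3) are represented by arbitrary matrices of U(3).

Torus. A diagonal transformation multiplies every monomial by a character, so the torus symmetries
of a potential are the common kernel of the characters that occur in it. Only 19 weights are
possible, in a lattice of rank two. If the occurring weights have rank 0, the kernel is the whole
torus. In rank 1 it is a circle or a circle times ℤ₂, since no weight is more than twice a primitive
vector. In rank 2 it has at most four elements, since two possible weights have determinant at most
4 in absolute value. This is `torus_subgroup_classification`. For the converse, `monoPot` has three
distinct masses, which forces unitary symmetries to be diagonal, and its quartic monomials can be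
prescribed.

Antiunitary elements. Suppose that the realizable group is abelian and contains an antiunitary
element. If all antiunitary elements square to 1, so do all elements. The unitary ones lift to
commuting involutions of determinant one, and a trace estimate shows that no three of these are
independent (`commuting_involutions`). Otherwise some Θ has Θ² ≠ 1. In a suitable basis Θ exchanges
the first two doublets and Θ² = diag(x, x⁻¹, 1) (`antiunitary_normal_form`). If x² ≠ 1, so few
monomials survive that a diagonal antiunitary transformation can be adjusted to their phases
(`exists_diag_conj_symmetry`); it would be a symmetry that does not commute with Θ². Hence x = -1.
Every further unitary symmetry lies in SU(2) ⊕ 1 and is diagonalized by a rotation compatible with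
Θ, so the same argument makes it ±1 on the first two doublets. The group is then generated by Θ.

ℤ₃ × ℤ₃. If all lifts to U(3) commute, they are simultaneously diagonal and the torus bound gives at
most four elements. Otherwise two of them become the clock and shift matrices up to phases
(`exists_clock_shift_basis`). A quartic potential with these symmetries also has the permutation x ↦
-x as a symmetry (`inv_neg_of_clock_shift`), an involution that a group of exponent three cannot
contain. -/

theorem sesq_eq_zero {N : ℕ} (M : Fin N → Fin N → ℂ)
    (h : ∀ p : Fin N → ℂ, ∑ a, ∑ b, M a b * (conj (p a) * p b) = 0) (a b : Fin N) :
    M a b = 0 := by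
  let B : (Fin N → ℂ) → (Fin N → ℂ) → ℂ := fun p q => ∑ a, ∑ b, M a b * (conj (p a) * q b)
  have hB : ∀ p q, B p q = 0 := by
    intro p q
    -- Polarization: `p + q` controls the sum of `B p q` and `B q p`, and `p + I • q` their
    -- difference.
    have h1 : B (p + q) (p + q) = B p p + B p q + B q p + B q q := by
      simp only [B, ← Finset.sum_add_distrib]
      refine Finset.sum_congr rfl fun a _ => Finset.sum_congr rfl fun b _ => ?_
      simp only [Pi.add_apply, map_add]
      ring
    have h2 : B (p + Complex.I • q) (p + Complex.I • q)
        = B p p + Complex.I * B p q - Complex.I * B q p + B q q := by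
      simp only [B, ← Finset.sum_add_distrib, ← Finset.sum_sub_distrib, Finset.mul_sum]
      refine Finset.sum_congr rfl fun a _ => Finset.sum_congr rfl fun b _ => ?_
      simp only [Pi.add_apply, map_add, Pi.smul_apply, smul_eq_mul, map_mul, Complex.conj_I]
      linear_combination (-M a b * conj (q a) * q b) * Complex.I_sq
    have e : ∀ p, B p p = 0 := h
    rw [e, e, e] at h1 h2
    have h3 : Complex.I * (B p q - B q p) = 0 := by linear_combination -h2
    have h4 : B p q - B q p = 0 := (mul_eq_zero.mp h3).resolve_left Complex.I_ne_zero
    linear_combination (-1/2 : ℂ) * h1 + (1/2 : ℂ) * h4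
  have := hB (Pi.single a 1) (Pi.single b 1)
  simpa [B, Pi.single_apply, apply_ite] using this

/-- The polynomial with coefficients `Y`, `Z` evaluated at the bilinears of `φ`. -/
def polyEval {N : ℕ} (Y : Fin N → Fin N → ℂ) (Z : Fin N → Fin N → Fin N → Fin N → ℂ)
    (φ : Doublets N) : ℂ :=
  (∑ a, ∑ b, Y a b * bilin φ a b) +
    ∑ a, ∑ b, ∑ c, ∑ d, Z a b c d * (bilin φ a b * bilin φ c d)

/-- The two components of the doublets are independent vectors `p` and `q`, and the quartic part
contains the mixed term `z p q + z q p`. The symmetry `hZ` makes its two summands equal, so each can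
be isolated and polarized in `p` and `q` separately. -/
theorem polyEval_coeff {N : ℕ} (Y : Fin N → Fin N → ℂ)
    (Z : Fin N → Fin N → Fin N → Fin N → ℂ) (hZ : ∀ a b c d, Z a b c d = Z c d a b)
    (h : ∀ φ, polyEval Y Z φ = 0) :
    (∀ a b, Y a b = 0) ∧ ∀ a b c d, Z a b c d = 0 := by
  let y : (Fin N → ℂ) → ℂ := fun p => ∑ a, ∑ b, Y a b * (conj (p a) * p b)
  let z : (Fin N → ℂ) → (Fin N → ℂ) → ℂ := fun p q =>
    ∑ a, ∑ b, ∑ c, ∑ d, Z a b c d * (conj (p a) * p b * (conj (q c) * q d))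
  have hsym : ∀ p q, z p q = z q p := by
    intro p q
    simp only [z]
    calc _ = ∑ a, ∑ b, ∑ c, ∑ d, Z c d a b * (conj (p a) * p b * (conj (q c) * q d)) := by
          simp only [← hZ]
      _ = ∑ x : Fin N × Fin N, ∑ w : Fin N × Fin N,
            Z w.1 w.2 x.1 x.2 * (conj (p x.1) * p x.2 * (conj (q w.1) * q w.2)) := by
          simp only [Fintype.sum_prod_type]
      _ = ∑ w : Fin N × Fin N, ∑ x : Fin N × Fin N,
            Z w.1 w.2 x.1 x.2 * (conj (p x.1) * p x.2 * (conj (q w.1) * q w.2)) :=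
          Finset.sum_comm
      _ = _ := by
          simp only [Fintype.sum_prod_type]
          refine Finset.sum_congr rfl fun a _ => Finset.sum_congr rfl fun b _ =>
            Finset.sum_congr rfl fun c _ => Finset.sum_congr rfl fun d _ => ?_
          ring
  have key : ∀ p q, y p + y q + (z p p + z p q + z q p + z q q) = 0 := by
    intro p q
    have := h (Matrix.of fun a i => if i = 0 then p a else q a)
    rw [← this]
    simp only [y, z, polyEval, bilin, Fin.sum_univ_two, Matrix.of_apply]
    simp only [if_true, one_ne_zero, if_false]
    congr 1
    · simp only [← Finset.sum_add_distrib]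
      refine Finset.sum_congr rfl fun a _ => Finset.sum_congr rfl fun b _ => ?_
      ring
    · simp only [← Finset.sum_add_distrib]
      refine Finset.sum_congr rfl fun a _ => Finset.sum_congr rfl fun b _ =>
            Finset.sum_congr rfl fun c _ => Finset.sum_congr rfl fun d _ => ?_
      ring
  -- Scaling by 2 separates the quadratic from the quartic part.
  have y2 : ∀ p, y ((2 : ℂ) • p) = 4 * y p := by
    intro p
    simp only [y, Finset.mul_sum]
    refine Finset.sum_congr rfl fun a _ => Finset.sum_congr rfl fun b _ => ?_
    simp only [Pi.smul_apply, smul_eq_mul, map_mul, map_ofNat]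
    ring
  have z2 : ∀ p, z ((2 : ℂ) • p) ((2 : ℂ) • p) = 16 * z p p := by
    intro p
    simp only [z, Finset.mul_sum]
    refine Finset.sum_congr rfl fun a _ => Finset.sum_congr rfl fun b _ =>
            Finset.sum_congr rfl fun c _ => Finset.sum_congr rfl fun d _ => ?_
    simp only [Pi.smul_apply, smul_eq_mul, map_mul, map_ofNat]
    ring
  have y0 : y 0 = 0 := by simp [y]
  have z0 : ∀ p, z p 0 = 0 := fun p => by simp [z]
  have hpp : ∀ p, y p = 0 ∧ z p p = 0 := by
    intro p
    have h1 := key p 0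
    have h2 := key ((2 : ℂ) • p) 0
    rw [y0, hsym 0, z0, z0] at h1 h2
    rw [y2, z2] at h2
    constructor
    · linear_combination (4/3 : ℂ) * h1 - (1/12 : ℂ) * h2
    · linear_combination (-1/3 : ℂ) * h1 + (1/12 : ℂ) * h2
  have hpq : ∀ p q, z p q = 0 := by
    intro p q
    have h1 := key p q
    rw [(hpp p).1, (hpp q).1, (hpp p).2, (hpp q).2, hsym q p] at h1
    linear_combination (1/2 : ℂ) * h1
  refine ⟨sesq_eq_zero Y fun p => (hpp p).1, fun a b c d => ?_⟩
  refine sesq_eq_zero (fun c d => Z a b c d) (fun q => ?_) c d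
  refine sesq_eq_zero (fun a b => ∑ c, ∑ d, Z a b c d * (conj (q c) * q d)) (fun p => ?_) a b
  rw [← hpq p q]
  simp only [z, Finset.sum_mul]
  refine Finset.sum_congr rfl fun a _ => Finset.sum_congr rfl fun b _ =>
            Finset.sum_congr rfl fun c _ => Finset.sum_congr rfl fun d _ => ?_
  ring

theorem polyEval_sub {N : ℕ} (Y Y' : Fin N → Fin N → ℂ)
    (Z Z' : Fin N → Fin N → Fin N → Fin N → ℂ) (φ : Doublets N) :
    polyEval (Y - Y') (Z - Z') φ = polyEval Y Z φ - polyEval Y' Z' φ := by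
  simp only [polyEval, Pi.sub_apply, sub_mul, Finset.sum_sub_distrib]
  ring

theorem polyEval_inj {N : ℕ} {Y Y' : Fin N → Fin N → ℂ}
    {Z Z' : Fin N → Fin N → Fin N → Fin N → ℂ} (hZ : ∀ a b c d, Z a b c d = Z c d a b)
    (hZ' : ∀ a b c d, Z' a b c d = Z' c d a b)
    (h : ∀ φ, polyEval Y Z φ = polyEval Y' Z' φ) :
    (∀ a b, Y a b = Y' a b) ∧ ∀ a b c d, Z a b c d = Z' a b c d := by
  have := polyEval_coeff (Y - Y') (Z - Z')
    (fun a b c d => by simp only [Pi.sub_apply]; rw [hZ, hZ'])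
    (fun φ => by rw [polyEval_sub, h, sub_self])
  simpa [sub_eq_zero] using this

theorem Potential.eval_eq {N : ℕ} (V : Potential N) (φ : Doublets N) :
    V.eval φ = polyEval V.Y V.Z φ := rfl

/-! ### Symmetries given by matrices -/

/-- Invariance of `V` under `φ ↦ M J^ε φ`. -/
def Potential.Inv {N : ℕ} (V : Potential N) (M : Matrix (Fin N) (Fin N) ℂ) (ε : Cyc 2) : Prop :=
  ∀ φ, V.eval (M * conjPow ε φ) = V.eval φ

theorem bilin_map_conj {N : ℕ} (φ : Doublets N) (a b : Fin N) :
    bilin (φ.map (starRingEnd ℂ)) a b = bilin φ b a := by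
  simp [bilin, mul_comm]

theorem bilin_smul {N : ℕ} {c : ℂ} (hc : conj c * c = 1) (φ : Doublets N) (a b : Fin N) :
    bilin (c • φ) a b = bilin φ a b := by
  simp only [bilin, Matrix.smul_apply, smul_eq_mul, map_mul]
  refine Finset.sum_congr rfl fun i _ => ?_
  linear_combination (conj (φ a i) * φ b i) * hc

theorem eval_smul {N : ℕ} (V : Potential N) {c : ℂ} (hc : conj c * c = 1) (φ : Doublets N) :
    V.eval (c • φ) = V.eval φ := by
  simp only [Potential.eval, bilin_smul hc]

theorem inv_smul_iff {N : ℕ} (V : Potential N) {c : ℂ} (hc : conj c * c = 1)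
    (M : Matrix (Fin N) (Fin N) ℂ) (ε : Cyc 2) : V.Inv (c • M) ε ↔ V.Inv M ε := by
  simp only [Potential.Inv, Matrix.smul_mul, eval_smul V hc]

theorem bilin_mul {N : ℕ} (s : Matrix (Fin N) (Fin N) ℂ) (φ : Doublets N) (a b : Fin N) :
    bilin (s * φ) a b = ∑ i, ∑ j, conj (s a i) * s b j * bilin φ i j := by
  simp only [bilin, Matrix.mul_apply, map_sum, map_mul, Finset.sum_mul_sum]
  rw [Finset.sum_comm]
  refine Finset.sum_congr rfl fun i _ => ?_
  rw [Finset.sum_comm]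
  refine Finset.sum_congr rfl fun j _ => ?_
  rw [Finset.mul_sum]
  refine Finset.sum_congr rfl fun k _ => ?_
  ring

/-- The potential `φ ↦ V(s φ)`. -/
def Potential.pull {N : ℕ} (V : Potential N) (s : Matrix (Fin N) (Fin N) ℂ) : Potential N where
  Y i j := ∑ x : Fin N × Fin N, conj (s x.1 i) * s x.2 j * V.Y x.1 x.2
  Z i j k l := ∑ x : Fin N × Fin N, ∑ y : Fin N × Fin N,
    conj (s x.1 i) * s x.2 j * (conj (s y.1 k) * s y.2 l) * V.Z x.1 x.2 y.1 y.2
  Y_herm i j := by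
    rw [map_sum, ← (Equiv.prodComm (Fin N) (Fin N)).sum_comp]
    refine Finset.sum_congr rfl fun x _ => ?_
    simp only [map_mul, Complex.conj_conj, V.Y_herm, Equiv.prodComm_apply, Prod.fst_swap,
      Prod.snd_swap]
    ring
  Z_symm i j k l := by
    rw [Finset.sum_comm]
    refine Finset.sum_congr rfl fun x _ => Finset.sum_congr rfl fun y _ => ?_
    rw [V.Z_symm]
    ring
  Z_herm i j k l := by
    rw [map_sum, ← (Equiv.prodComm (Fin N) (Fin N)).sum_comp]
    refine Finset.sum_congr rfl fun x _ => ?_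
    rw [map_sum, ← (Equiv.prodComm (Fin N) (Fin N)).sum_comp]
    refine Finset.sum_congr rfl fun y _ => ?_
    simp only [map_mul, Complex.conj_conj, V.Z_herm, Equiv.prodComm_apply, Prod.fst_swap,
      Prod.snd_swap]
    ring

theorem eval_pull {N : ℕ} (V : Potential N) (s : Matrix (Fin N) (Fin N) ℂ) (φ : Doublets N) :
    (V.pull s).eval φ = V.eval (s * φ) := by
  have hb : ∀ x : Fin N × Fin N, bilin (s * φ) x.1 x.2 =
      ∑ i : Fin N × Fin N, conj (s x.1 i.1) * s x.2 i.2 * bilin φ i.1 i.2 := by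
    intro x
    rw [bilin_mul, Fintype.sum_prod_type]
  have e : ∀ (W : Potential N) (ψ : Doublets N), W.eval ψ =
      (∑ x : Fin N × Fin N, W.Y x.1 x.2 * bilin ψ x.1 x.2) +
      ∑ x : Fin N × Fin N, ∑ y : Fin N × Fin N,
        W.Z x.1 x.2 y.1 y.2 * (bilin ψ x.1 x.2 * bilin ψ y.1 y.2) := by
    intro W ψ
    simp only [Potential.eval, Fintype.sum_prod_type]
  rw [e, e]
  simp only [hb, Potential.pull]
  congr 1
  · simp only [Finset.mul_sum, Finset.sum_mul]
    rw [Finset.sum_comm]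
    refine Finset.sum_congr rfl fun x _ => Finset.sum_congr rfl fun y _ => ?_
    ring
  · calc _ = ∑ i : Fin N × Fin N, ∑ j : Fin N × Fin N, ∑ x : Fin N × Fin N, ∑ y : Fin N × Fin N,
            V.Z x.1 x.2 y.1 y.2 * (conj (s x.1 i.1) * s x.2 i.2 * bilin φ i.1 i.2 *
              (conj (s y.1 j.1) * s y.2 j.2 * bilin φ j.1 j.2)) := by
          simp only [Finset.sum_mul]
          refine Finset.sum_congr rfl fun i _ => Finset.sum_congr rfl fun j _ =>
            Finset.sum_congr rfl fun x _ => Finset.sum_congr rfl fun y _ => ?_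
          ring
      _ = ∑ x : Fin N × Fin N, ∑ y : Fin N × Fin N, ∑ i : Fin N × Fin N, ∑ j : Fin N × Fin N,
            V.Z x.1 x.2 y.1 y.2 * (conj (s x.1 i.1) * s x.2 i.2 * bilin φ i.1 i.2 *
              (conj (s y.1 j.1) * s y.2 j.2 * bilin φ j.1 j.2)) := by
          simp only [← Fintype.sum_prod_type' (f := fun (i j : Fin N × Fin N) => _)]
          rw [Finset.sum_comm]
      _ = _ := by
          refine Finset.sum_congr rfl fun x _ => Finset.sum_congr rfl fun y _ => ?_
          rw [Finset.sum_mul_sum, Finset.mul_sum]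
          refine Finset.sum_congr rfl fun i _ => ?_
          rw [Finset.mul_sum]

/-- The matrix of `φ_a ↦ m_a φ_{σ a}`. -/
def monoMat {N : ℕ} (m : Fin N → ℂ) (σ : Equiv.Perm (Fin N)) : Matrix (Fin N) (Fin N) ℂ :=
  Matrix.of fun a i => if i = σ a then m a else 0

theorem monoMat_mul_apply {N : ℕ} {κ : Type*} (m : Fin N → ℂ) (σ : Equiv.Perm (Fin N))
    (φ : Matrix (Fin N) κ ℂ) (a : Fin N) (i : κ) : (monoMat m σ * φ) a i = m a * φ (σ a) i := by
  simp [monoMat, Matrix.mul_apply]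

theorem bilin_monoMat {N : ℕ} (m : Fin N → ℂ) (σ : Equiv.Perm (Fin N)) (φ : Doublets N)
    (a b : Fin N) :
    bilin (monoMat m σ * φ) a b = conj (m a) * m b * bilin φ (σ a) (σ b) := by
  simp only [bilin, monoMat_mul_apply, map_mul, Finset.mul_sum]
  refine Finset.sum_congr rfl fun i _ => ?_
  ring

theorem polyEval_reindex {N : ℕ} (Y : Fin N → Fin N → ℂ)
    (Z : Fin N → Fin N → Fin N → Fin N → ℂ) (σ : Equiv.Perm (Fin N)) (φ : Doublets N) :
    polyEval Y Z φ = polyEval (fun a b => Y (σ a) (σ b))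
      (fun a b c d => Z (σ a) (σ b) (σ c) (σ d)) (φ.submatrix σ id) := by
  have hb : ∀ a b, bilin (φ.submatrix σ id) a b = bilin φ (σ a) (σ b) := fun a b => by
    simp [bilin]
  simp only [polyEval, hb]
  congr 1
  · rw [← Equiv.sum_comp σ]
    refine Finset.sum_congr rfl fun a _ => ?_
    rw [← Equiv.sum_comp σ]
  · rw [← Equiv.sum_comp σ]
    refine Finset.sum_congr rfl fun a _ => ?_
    rw [← Equiv.sum_comp σ]
    refine Finset.sum_congr rfl fun a _ => ?_
    rw [← Equiv.sum_comp σ]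
    refine Finset.sum_congr rfl fun a _ => ?_
    rw [← Equiv.sum_comp σ]

theorem polyEval_map_conj {N : ℕ} (Y : Fin N → Fin N → ℂ)
    (Z : Fin N → Fin N → Fin N → Fin N → ℂ) (φ : Doublets N) :
    polyEval Y Z (φ.map (starRingEnd ℂ)) =
      polyEval (fun a b => Y b a) (fun a b c d => Z b a d c) φ := by
  simp only [polyEval, bilin_map_conj]
  congr 1
  · exact Finset.sum_comm
  · rw [Finset.sum_comm]
    refine Finset.sum_congr rfl fun a _ => Finset.sum_congr rfl fun b _ => ?_
    exact Finset.sum_comm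

theorem polyEval_monoMat {N : ℕ} (Y : Fin N → Fin N → ℂ)
    (Z : Fin N → Fin N → Fin N → Fin N → ℂ) (m : Fin N → ℂ) (σ : Equiv.Perm (Fin N))
    (φ : Doublets N) :
    polyEval Y Z (monoMat m σ * φ) = polyEval (fun a b => conj (m a) * m b * Y a b)
      (fun a b c d => conj (m a) * m b * (conj (m c) * m d) * Z a b c d)
      (φ.submatrix σ id) := by
  have hb : ∀ a b, bilin (φ.submatrix σ id) a b = bilin φ (σ a) (σ b) := fun a b => by
    simp [bilin]
  simp only [polyEval, hb, bilin_monoMat]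
  congr 1
  · refine Finset.sum_congr rfl fun a _ => Finset.sum_congr rfl fun b _ => ?_
    ring
  · refine Finset.sum_congr rfl fun a _ => Finset.sum_congr rfl fun b _ =>
      Finset.sum_congr rfl fun c _ => Finset.sum_congr rfl fun d _ => ?_
    ring

/-- A monomial matrix sends each bilinear to a multiple of a single bilinear, so uniqueness of
coefficients can be applied entry by entry. -/
theorem inv_monoMat_iff {N : ℕ} (V : Potential N) (m : Fin N → ℂ) (σ : Equiv.Perm (Fin N)) :
    V.Inv (monoMat m σ) 1 ↔
      (∀ a b, conj (m a) * m b * V.Y a b = V.Y (σ a) (σ b)) ∧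
      ∀ a b c d, conj (m a) * m b * (conj (m c) * m d) * V.Z a b c d
        = V.Z (σ a) (σ b) (σ c) (σ d) := by
  have step : ∀ φ, (V.eval (monoMat m σ * conjPow 1 φ) = V.eval φ) ↔
      polyEval (fun a b => conj (m a) * m b * V.Y a b)
      (fun a b c d => conj (m a) * m b * (conj (m c) * m d) * V.Z a b c d)
      (φ.submatrix σ id) = polyEval (fun a b => V.Y (σ a) (σ b))
      (fun a b c d => V.Z (σ a) (σ b) (σ c) (σ d)) (φ.submatrix σ id) := by
    intro φ
    rw [← polyEval_monoMat, ← polyEval_reindex]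
    simp [conjPow, Potential.eval_eq]
  constructor
  · intro h
    apply polyEval_inj
    · intro a b c d; rw [V.Z_symm]; ring
    · intro a b c d; rw [V.Z_symm]
    · intro φ
      have := (step (φ.submatrix σ.symm id)).1 (h _)
      simpa using this
  · rintro ⟨h1, h2⟩ φ
    rw [step]
    simp only [h1, h2]

/-- Conjugating the fields exchanges the two indices of every bilinear; this accounts for the
swapped index pairs. -/
theorem inv_monoMat_conj_iff {N : ℕ} (V : Potential N) (m : Fin N → ℂ) (σ : Equiv.Perm (Fin N))
    {ε : Cyc 2} (hε : ε ≠ 1) :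
    V.Inv (monoMat m σ) ε ↔
      (∀ a b, conj (m a) * m b * V.Y a b = V.Y (σ b) (σ a)) ∧
      ∀ a b c d, conj (m a) * m b * (conj (m c) * m d) * V.Z a b c d
        = V.Z (σ b) (σ a) (σ d) (σ c) := by
  -- Substituting the conjugate field makes the two conjugations on the left cancel.
  have step : ∀ φ : Doublets N, (V.eval (monoMat m σ * conjPow ε (φ.map (starRingEnd ℂ)))
        = V.eval (φ.map (starRingEnd ℂ))) ↔
      polyEval (fun a b => conj (m a) * m b * V.Y a b)
      (fun a b c d => conj (m a) * m b * (conj (m c) * m d) * V.Z a b c d)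
      (φ.submatrix σ id) = polyEval (fun a b => V.Y (σ b) (σ a))
      (fun a b c d => V.Z (σ b) (σ a) (σ d) (σ c)) (φ.submatrix σ id) := by
    intro φ
    have e : (φ.map (starRingEnd ℂ)).map (starRingEnd ℂ) = φ := by ext; simp
    rw [← polyEval_monoMat,
      ← polyEval_reindex (fun a b => V.Y b a) (fun a b c d => V.Z b a d c), ← polyEval_map_conj V.Y V.Z]
    simp only [conjPow, hε, if_false, Potential.eval_eq, e]
  constructor
  · intro h
    apply polyEval_inj
    · intro a b c d; rw [V.Z_symm]; ring
    · intro a b c d; rw [V.Z_symm]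
    · intro φ
      have := (step (φ.submatrix σ.symm id)).1 (h _)
      simpa using this
  · rintro ⟨h1, h2⟩ φ
    have e : (φ.map (starRingEnd ℂ)).map (starRingEnd ℂ) = φ := by ext; simp
    have := (step (φ.map (starRingEnd ℂ))).2 (by simp only [h1, h2])
    rwa [e] at this

/-! ### `PSU(3)` as a quotient of `U(3)` -/

/-- The group `U(3)`. -/
abbrev U3 : Type := Matrix.unitaryGroup (Fin 3) ℂ

theorem inv_coeff {N : ℕ} {V : Potential N} {M : Matrix (Fin N) (Fin N) ℂ} (h : V.Inv M 1) :
    (∀ i j, (V.pull M).Y i j = V.Y i j) ∧ ∀ i j k l, (V.pull M).Z i j k l = V.Z i j k l := by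
  apply polyEval_inj (V.pull M).Z_symm V.Z_symm
  intro φ
  rw [← Potential.eval_eq, ← Potential.eval_eq, eval_pull, ← h φ]
  simp [conjPow]

theorem conj_mul_self_eq_one {c : ℂ} : conj c * c = 1 ↔ ‖c‖ = 1 := by
  rw [← Complex.normSq_eq_conj_mul_self, Complex.normSq_eq_norm_sq]
  norm_cast
  exact pow_eq_one_iff_of_nonneg (norm_nonneg c) two_ne_zero

theorem exists_pow_eq_unit {n : ℕ} (hn : n ≠ 0) {z : ℂ} (hz : ‖z‖ = 1) :
    ∃ c : ℂ, ‖c‖ = 1 ∧ c ^ n = z := by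
  obtain ⟨c, hc⟩ := IsAlgClosed.exists_pow_nat_eq z (Nat.pos_of_ne_zero hn)
  refine ⟨c, ?_, hc⟩
  have : ‖c‖ ^ n = 1 := by rw [← norm_pow, hc, hz]
  exact (pow_eq_one_iff_of_nonneg (norm_nonneg c) hn).1 this

theorem norm_det_unitary (M : U3) : ‖(M : Matrix (Fin 3) (Fin 3) ℂ).det‖ = 1 := by
  have := Matrix.det_of_mem_unitary M.2
  rw [Unitary.mem_iff] at this
  exact conj_mul_self_eq_one.1 this.1

theorem smul_mem_unitary {c : ℂ} (hc : ‖c‖ = 1) (M : U3) :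
    c • (M : Matrix (Fin 3) (Fin 3) ℂ) ∈ Matrix.unitaryGroup (Fin 3) ℂ := by
  have hM := Matrix.mem_unitaryGroup_iff'.1 M.2
  rw [Matrix.mem_unitaryGroup_iff', star_smul, Matrix.smul_mul, Matrix.mul_smul, smul_smul, hM]
  have := conj_mul_self_eq_one.2 hc
  rw [show star c * c = 1 from this, one_smul]

/-- Rescaling by a cube root of the inverse determinant suffices. Normal forms can thus be taken in
U(3), where one entry may be normalized to 1. -/
theorem exists_specialUnitary (M : U3) : ∃ u : SU 3, ∃ c : ℂ, ‖c‖ = 1 ∧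
    (u : Matrix (Fin 3) (Fin 3) ℂ) = c • (M : Matrix (Fin 3) (Fin 3) ℂ) := by
  obtain ⟨c, hc, hc3⟩ := exists_pow_eq_unit (n := 3) (by norm_num)
    (z := (M : Matrix (Fin 3) (Fin 3) ℂ).det⁻¹) (by rw [norm_inv, norm_det_unitary, inv_one])
  refine ⟨⟨c • (M : Matrix (Fin 3) (Fin 3) ℂ), ?_⟩, c, hc, rfl⟩
  rw [Matrix.mem_specialUnitaryGroup_iff]
  refine ⟨smul_mem_unitary hc M, ?_⟩
  rw [Matrix.det_smul, Fintype.card_fin, hc3, inv_mul_cancel₀]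
  intro h
  have := norm_det_unitary M
  rw [h] at this
  simp at this

/-- Two diagonal sign matrices kill the off-diagonal entries, and the cyclic permutation equates the
diagonal ones. -/
theorem scalar_of_commute_SU {A : Matrix (Fin 3) (Fin 3) ℂ}
    (h : ∀ u : SU 3, (u : Matrix (Fin 3) (Fin 3) ℂ) * A = A * u) : ∃ c : ℂ, A = c • 1 := by
  have mk : ∀ B : Matrix (Fin 3) (Fin 3) ℂ, star B * B = 1 → B.det = 1 → B * A = A * B :=
    fun B h1 h2 => h ⟨B, Matrix.mem_specialUnitaryGroup_iff.2
      ⟨Matrix.mem_unitaryGroup_iff'.2 h1, h2⟩⟩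
  have h1 := mk !![-1,0,0;0,-1,0;0,0,1]
    (by ext i j; fin_cases i <;> fin_cases j <;>
      simp [Matrix.mul_apply, Fin.sum_univ_three, Matrix.star_apply])
    (by simp [Matrix.det_fin_three])
  have h2 := mk !![1,0,0;0,-1,0;0,0,-1]
    (by ext i j; fin_cases i <;> fin_cases j <;>
      simp [Matrix.mul_apply, Fin.sum_univ_three, Matrix.star_apply])
    (by simp [Matrix.det_fin_three])
  have h3 := mk !![0,1,0;0,0,1;1,0,0]
    (by ext i j; fin_cases i <;> fin_cases j <;>
      simp [Matrix.mul_apply, Fin.sum_univ_three, Matrix.star_apply])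
    (by simp [Matrix.det_fin_three])
  have e1 := fun i j => congrFun (congrFun h1 i) j
  have e2 := fun i j => congrFun (congrFun h2 i) j
  have e3 := fun i j => congrFun (congrFun h3 i) j
  simp only [Matrix.mul_apply, Fin.sum_univ_three] at e1 e2 e3
  have a02 := e1 0 2
  have a12 := e1 1 2
  have a20 := e1 2 0
  have a21 := e1 2 1
  have a01 := e2 0 1
  have a10 := e2 1 0
  have d01 := e3 0 1
  have d12 := e3 1 2
  simp at a02 a12 a20 a21 a01 a10 d01 d12
  refine ⟨A 0 0, ?_⟩
  have b02 : A 0 2 = 0 := by linear_combination (-1/2 : ℂ) * a02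
  have b12 : A 1 2 = 0 := by linear_combination (-1/2 : ℂ) * a12
  have b20 : A 2 0 = 0 := by linear_combination (1/2 : ℂ) * a20
  have b21 : A 2 1 = 0 := by linear_combination (1/2 : ℂ) * a21
  have b01 : A 0 1 = 0 := by linear_combination (1/2 : ℂ) * a01
  have b10 : A 1 0 = 0 := by linear_combination (-1/2 : ℂ) * a10
  ext i j
  fin_cases i <;> fin_cases j <;> simp [b02, b12, b20, b21, b01, b10, d01, d12]

theorem mem_center_SU_iff (u : SU 3) :
    u ∈ Subgroup.center (SU 3) ↔ ∃ c : ℂ, (u : Matrix (Fin 3) (Fin 3) ℂ) = c • 1 := by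
  rw [Subgroup.mem_center_iff]
  constructor
  · intro h
    exact scalar_of_commute_SU fun v => congrArg Subtype.val (h v)
  · rintro ⟨c, hc⟩ v
    apply Subtype.ext
    change (v : Matrix (Fin 3) (Fin 3) ℂ) * u = u * v
    rw [hc]; simp

theorem SU_mk_eq_iff (u v : SU 3) : (QuotientGroup.mk u : PSU 3) = QuotientGroup.mk v ↔
    ∃ c : ℂ, (v : Matrix (Fin 3) (Fin 3) ℂ) = c • (u : Matrix (Fin 3) (Fin 3) ℂ) := by
  rw [QuotientGroup.eq, mem_center_SU_iff]
  refine exists_congr fun c => ?_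
  constructor
  · intro h
    have : (v : Matrix (Fin 3) (Fin 3) ℂ) = u * ((u⁻¹ * v : SU 3) : Matrix (Fin 3) (Fin 3) ℂ) := by
      rw [← Submonoid.coe_mul, mul_inv_cancel_left]
    rw [this, h]; simp
  · intro h
    rw [Submonoid.coe_mul, h, Matrix.mul_smul, ← Submonoid.coe_mul, inv_mul_cancel]
    rfl

theorem unit_of_smul {M N : U3} {c : ℂ}
    (h : (N : Matrix (Fin 3) (Fin 3) ℂ) = c • (M : Matrix (Fin 3) (Fin 3) ℂ)) : ‖c‖ = 1 := by
  have := congrArg (fun A => ‖A.det‖) h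
  simp only [Matrix.det_smul, norm_mul, norm_det_unitary, Fintype.card_fin, norm_pow,
    mul_one] at this
  exact (pow_eq_one_iff_of_nonneg (norm_nonneg c) (n := 3) (by norm_num)).1 this.symm

/-- A representative in `SU(3)` of a unitary matrix up to a phase factor. -/
def suRep (M : U3) : SU 3 := (exists_specialUnitary M).choose

theorem suRep_spec (M : U3) : ∃ c : ℂ, ‖c‖ = 1 ∧
    (suRep M : Matrix (Fin 3) (Fin 3) ℂ) = c • (M : Matrix (Fin 3) (Fin 3) ℂ) :=
  (exists_specialUnitary M).choose_spec

/-- The projection `U(3) → PSU(3)`. -/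
def proj : U3 →* PSU 3 where
  toFun M := QuotientGroup.mk (suRep M)
  map_one' := by
    obtain ⟨c, hc, h⟩ := suRep_spec 1
    rw [← QuotientGroup.mk_one, eq_comm, SU_mk_eq_iff]
    exact ⟨c, h⟩
  map_mul' M N := by
    obtain ⟨c, hc, h⟩ := suRep_spec M
    obtain ⟨d, hd, h'⟩ := suRep_spec N
    obtain ⟨e, he, h''⟩ := suRep_spec (M * N)
    rw [← QuotientGroup.mk_mul, eq_comm, SU_mk_eq_iff]
    refine ⟨e * (c * d)⁻¹, ?_⟩
    have hcd : c * d ≠ 0 := by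
      rw [← norm_ne_zero_iff, norm_mul, hc, hd]; norm_num
    rw [h'', Submonoid.coe_mul, Submonoid.coe_mul, h, h', Matrix.smul_mul, Matrix.mul_smul,
      smul_smul, smul_smul, mul_assoc, mul_assoc, inv_mul_cancel₀ hcd, mul_one]

theorem proj_apply (M : U3) : proj M = QuotientGroup.mk (suRep M) := rfl

theorem proj_eq_mk_iff (M : U3) (u : SU 3) : proj M = QuotientGroup.mk u ↔
    ∃ c : ℂ, (u : Matrix (Fin 3) (Fin 3) ℂ) = c • (M : Matrix (Fin 3) (Fin 3) ℂ) := by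
  obtain ⟨c, hc, h⟩ := suRep_spec M
  have hc0 : c ≠ 0 := by rw [← norm_ne_zero_iff, hc]; norm_num
  rw [proj_apply, SU_mk_eq_iff, h]
  constructor
  · rintro ⟨d, hd⟩
    exact ⟨d * c, by rw [hd, smul_smul]⟩
  · rintro ⟨d, hd⟩
    exact ⟨d * c⁻¹, by rw [hd, smul_smul, mul_assoc, inv_mul_cancel₀ hc0, mul_one]⟩

theorem proj_eq_iff (M N : U3) : proj M = proj N ↔
    ∃ c : ℂ, (N : Matrix (Fin 3) (Fin 3) ℂ) = c • (M : Matrix (Fin 3) (Fin 3) ℂ) := by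
  obtain ⟨c, hc, h⟩ := suRep_spec N
  have hc0 : c ≠ 0 := by rw [← norm_ne_zero_iff, hc]; norm_num
  rw [proj_apply N, proj_eq_mk_iff, h]
  constructor
  · rintro ⟨d, hd⟩
    refine ⟨c⁻¹ * d, ?_⟩
    rw [mul_smul, ← hd, smul_smul, inv_mul_cancel₀ hc0, one_smul]
  · rintro ⟨d, hd⟩
    exact ⟨c * d, by rw [hd, smul_smul]⟩

/-- The inclusion of `SU(3)` into `U(3)`. -/
def suIncl (u : SU 3) : U3 := ⟨u, (Matrix.mem_specialUnitaryGroup_iff.1 u.2).1⟩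

theorem proj_suIncl (u : SU 3) : proj (suIncl u) = QuotientGroup.mk u :=
  (proj_eq_mk_iff _ _).2 ⟨1, by rw [one_smul]; rfl⟩

theorem proj_surjective : Function.Surjective proj := by
  intro x
  induction x using QuotientGroup.induction_on with
  | H u => exact ⟨suIncl u, proj_suIncl u⟩

/-- Entrywise conjugation of unitary matrices. -/
def conjU (M : U3) : U3 := ⟨(M : Matrix (Fin 3) (Fin 3) ℂ).map (starRingEnd ℂ), by
  have h := Matrix.mem_unitaryGroup_iff.1 M.2
  rw [Matrix.mem_unitaryGroup_iff]
  have h := congrArg (fun A => A.map (starRingEnd ℂ)) h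
  simp only [Matrix.map_mul] at h
  rw [Matrix.map_one _ (map_zero _) (map_one _)] at h
  rw [← h]
  congr 1⟩

/-- `J^ε M J^ε`. -/
def twistU (ε : Cyc 2) (M : U3) : U3 := if ε = 1 then M else conjU M

theorem conjAction_proj (ε : Cyc 2) (M : U3) : conjAction 3 ε (proj M) = proj (twistU ε M) := by
  obtain ⟨c, hc, h⟩ := suRep_spec M
  rw [proj_apply, ← mk_twist, eq_comm, proj_eq_mk_iff]
  by_cases hε : ε = 1
  · simp only [twist, twistU, hε, if_true]
    exact ⟨c, h⟩
  · simp only [twist, twistU, hε, if_false]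
    refine ⟨conj c, ?_⟩
    ext i j
    have := congrArg conj (congrFun (congrFun h i) j)
    simpa [conjSU, conjU] using this

/-- The element of `G` given by a unitary matrix and a power of `J`. -/
def rep (M : U3) (ε : Cyc 2) : Repar 3 := ⟨proj M, ε⟩

@[simp] theorem rep_right (M : U3) (ε : Cyc 2) : (rep M ε).right = ε := rfl

theorem rep_mul (M N : U3) (ε δ : Cyc 2) :
    rep M ε * rep N δ = rep (M * twistU ε N) (ε * δ) := by
  apply SemidirectProduct.ext
  · simp only [rep, SemidirectProduct.mul_left, map_mul, conjAction_proj]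
  · rfl

theorem rep_one : rep 1 1 = 1 := by
  apply SemidirectProduct.ext
  · simp [rep]
  · rfl

theorem rep_eq_iff (M N : U3) (ε δ : Cyc 2) : rep M ε = rep N δ ↔
    ε = δ ∧ ∃ c : ℂ, (N : Matrix (Fin 3) (Fin 3) ℂ) = c • (M : Matrix (Fin 3) (Fin 3) ℂ) := by
  rw [SemidirectProduct.ext_iff, ← proj_eq_iff]
  simp only [rep]
  tauto

theorem exists_rep (g : Repar 3) : ∃ M : U3, rep M g.right = g := by
  obtain ⟨M, hM⟩ := proj_surjective g.left
  exact ⟨M, SemidirectProduct.ext hM rfl⟩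

theorem rep_mem_aut (V : Potential 3) (M : U3) (ε : Cyc 2) :
    rep M ε ∈ V.aut ↔ V.Inv M ε := by
  change V.IsSymmetry (rep M ε) ↔ _
  constructor
  · rintro ⟨u, hu, h⟩
    obtain ⟨c, hc⟩ := (proj_eq_mk_iff M u).1 hu.symm
    have hc1 := unit_of_smul (M := M) (N := suIncl u) hc
    rw [← inv_smul_iff V (conj_mul_self_eq_one.2 hc1), ← hc]
    exact h
  · intro h
    obtain ⟨c, hc, hM⟩ := suRep_spec M
    refine ⟨suRep M, rfl, ?_⟩
    have := (inv_smul_iff V (conj_mul_self_eq_one.2 hc) _ _).2 h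
    rw [← hM] at this
    exact this

theorem proj_mem_autUnitary (V : Potential 3) (M : U3) :
    proj M ∈ V.autUnitary ↔ V.Inv M 1 := rep_mem_aut V M 1

theorem conjPow_mul {N : ℕ} (ε : Cyc 2) (s : Matrix (Fin N) (Fin N) ℂ) (φ : Doublets N) :
    conjPow ε (s * φ) =
      (if ε = 1 then s else s.map (starRingEnd ℂ)) * conjPow ε φ := by
  by_cases hε : ε = 1 <;> simp [conjPow, hε, Matrix.map_mul]

theorem coe_twistU (ε : Cyc 2) (M : U3) : (twistU ε M : Matrix (Fin 3) (Fin 3) ℂ) =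
    if ε = 1 then (M : Matrix (Fin 3) (Fin 3) ℂ)
      else (M : Matrix (Fin 3) (Fin 3) ℂ).map (starRingEnd ℂ) := by
  by_cases hε : ε = 1 <;> simp [twistU, hε, conjU]

theorem conjU_conjU (M : U3) : conjU (conjU M) = M := by
  apply Subtype.ext; ext; simp [conjU]

theorem conjU_mul (M N : U3) : conjU (M * N) = conjU M * conjU N := by
  apply Subtype.ext; simp [conjU, Matrix.map_mul]

theorem twistU_mul (ε : Cyc 2) (M N : U3) : twistU ε (M * N) = twistU ε M * twistU ε N := by
  by_cases hε : ε = 1 <;> simp [twistU, hε, conjU_mul]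

theorem twistU_one (ε : Cyc 2) : twistU ε 1 = 1 := by
  by_cases hε : ε = 1
  · simp [twistU, hε]
  · have := twistU_mul ε 1 1
    rw [mul_one] at this
    exact (left_eq_mul.1 this)

/-- Substituting `s * φ` conjugates the symmetry by `s`. Moving `s⁻¹` past the antiunitary part
conjugates its entries, hence the twist. -/
theorem inv_pull_iff (V : Potential 3) (s M : U3) (ε : Cyc 2) :
    (V.pull s).Inv M ε ↔ V.Inv (s * M * twistU ε s⁻¹ : U3) ε := by
  have e : twistU ε s⁻¹ * twistU ε s = 1 := by
    rw [← twistU_mul, inv_mul_cancel, twistU_one]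
  have e' := congrArg (Subtype.val) e
  simp only [Submonoid.coe_mul] at e'
  simp only [Potential.Inv, eval_pull]
  have key : ∀ φ : Doublets 3, ((s * M * twistU ε s⁻¹ : U3) : Matrix (Fin 3) (Fin 3) ℂ) *
      conjPow ε ((s : Matrix (Fin 3) (Fin 3) ℂ) * φ) =
      (s : Matrix (Fin 3) (Fin 3) ℂ) * ((M : Matrix (Fin 3) (Fin 3) ℂ) * conjPow ε φ) := by
    intro φ
    rw [conjPow_mul, ← coe_twistU]
    simp only [Submonoid.coe_mul, Matrix.mul_assoc]
    rw [← Matrix.mul_assoc (twistU ε s⁻¹ : Matrix (Fin 3) (Fin 3) ℂ), e']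
    simp
  constructor
  · intro h φ
    have := h (((s⁻¹ : U3) : Matrix (Fin 3) (Fin 3) ℂ) * φ)
    rw [← key, ← Matrix.mul_assoc, ← Submonoid.coe_mul, mul_inv_cancel] at this
    simpa using this
  · intro h φ
    rw [← key, h]

/-! ### Groups of small order -/

theorem card_cyc (n : ℕ) : Nat.card (Cyc n) = n := by
  rw [Nat.card_congr Multiplicative.toAdd, Nat.card_zmod]

theorem cyc_two_cases (a : Cyc 2) : a = 1 ∨ a = Multiplicative.ofAdd 1 := by
  revert a; decide

instance isKleinFour_cyc : IsKleinFour (Cyc 2 × Cyc 2) where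
  card_four := by rw [Nat.card_prod, card_cyc]
  exponent_two := by
    refine Nat.dvd_antisymm (Monoid.exponent_dvd_of_forall_pow_eq_one (by decide)) ?_
    have h : orderOf ((Multiplicative.ofAdd 1, 1) : Cyc 2 × Cyc 2) = 2 :=
      orderOf_eq_prime (by decide) (by decide)
    have h' := Monoid.order_dvd_exponent ((Multiplicative.ofAdd 1, 1) : Cyc 2 × Cyc 2)
    rwa [h] at h'

theorem isKleinFour_of_card {A : Type*} [Group A] (h : Nat.card A = 4) (h2 : ∀ a : A, a ^ 2 = 1) :
    IsKleinFour A where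
  card_four := h
  exponent_two := by
    have hd : Monoid.exponent A ∣ 2 := Monoid.exponent_dvd_of_forall_pow_eq_one h2
    rcases (Nat.dvd_prime Nat.prime_two).1 hd with h1 | h1
    · rw [Monoid.exp_eq_one_iff] at h1
      have : Nat.card A = 1 := Nat.card_of_subsingleton 1
      omega
    · exact h1

theorem equiv_of_card_four {A : Type*} [Group A] (h : Nat.card A = 4) :
    Nonempty (A ≃* Cyc 4) ∨ Nonempty (A ≃* (Cyc 2 × Cyc 2)) := by
  by_cases hc : IsCyclic A
  · left
    exact ⟨mulEquivOfCyclicCardEq (by rw [h, card_cyc])⟩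
  · right
    have : IsKleinFour A := ⟨h, (not_isCyclic_iff_exponent_eq_prime Nat.prime_two
      (by rw [h]; norm_num)).1 hc⟩
    exact IsKleinFour.nonempty_mulEquiv

theorem equiv_of_card_prime {A : Type*} [Group A] {p : ℕ} (hp : p.Prime) (h : Nat.card A = p) :
    Nonempty (A ≃* Cyc p) := by
  have : Fact p.Prime := ⟨hp⟩
  exact ⟨mulEquivOfPrimeCardEq h (card_cyc p)⟩

/-- An isomorphism of discrete groups is an isomorphism of topological groups. -/
def discreteEquiv {A B : Type*} [Group A] [Group B] [TopologicalSpace A] [TopologicalSpace B]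
    [DiscreteTopology A] [DiscreteTopology B] (e : A ≃* B) : A ≃ₜ* B where
  __ := e
  continuous_toFun := continuous_of_discreteTopology
  continuous_invFun := continuous_of_discreteTopology

/-! ### Subgroups of the two-dimensional torus -/

/-- The `n`-th roots of unity in the circle. -/
def circlePow (n : ℕ) : Subgroup Circle := (powMonoidHom n).ker

theorem mem_circlePow {n : ℕ} {z : Circle} : z ∈ circlePow n ↔ z ^ n = 1 := Iff.rfl

/-- The roots of unity in the circle as complex roots of unity. -/
def circlePowEquiv (n : ℕ) [NeZero n] : circlePow n ≃* rootsOfUnity n ℂ :=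
  MulEquiv.trans (N := rootsOfUnity n Circle)
    { toFun := fun z => ⟨toUnits (z : Circle), by
        rw [mem_rootsOfUnity, ← map_pow, mem_circlePow.1 z.2, map_one]⟩
      invFun := fun u => ⟨((u : Circleˣ) : Circle), by
        rw [mem_circlePow, ← Units.val_pow_eq_pow_val, (mem_rootsOfUnity _ _).1 u.2, Units.val_one]⟩
      left_inv := fun z => rfl
      right_inv := fun u => by ext; rfl
      map_mul' := fun z w => by ext; rfl } (rootsOfUnityCircleEquiv n)

instance finite_circlePow (n : ℕ) [NeZero n] : Finite (circlePow n) :=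
  Finite.of_equiv _ (circlePowEquiv n).symm.toEquiv

theorem card_circlePow (n : ℕ) [NeZero n] : Nat.card (circlePow n) = n := by
  rw [Nat.card_congr (circlePowEquiv n).toEquiv, Complex.card_rootsOfUnity]

theorem circlePow_equiv_cyc (n : ℕ) [NeZero n] : Nonempty (circlePow n ≃* Cyc n) := by
  have : IsCyclic (circlePow n) := isCyclic_of_surjective (circlePowEquiv n).symm
    (circlePowEquiv n).symm.surjective
  exact ⟨mulEquivOfCyclicCardEq (by rw [card_circlePow, card_cyc])⟩

/-- The character of the torus with weight `v`. -/
def chi (v : ℤ × ℤ) : Circle × Circle →* Circle where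
  toFun x := x.1 ^ v.1 * x.2 ^ v.2
  map_one' := by simp
  map_mul' x y := by simp only [Prod.fst_mul, Prod.snd_mul, mul_zpow]; exact mul_mul_mul_comm _ _ _ _

theorem chi_apply (v : ℤ × ℤ) (x : Circle × Circle) : chi v x = x.1 ^ v.1 * x.2 ^ v.2 := rfl

theorem continuous_chi (v : ℤ × ℤ) : Continuous (chi v) := by
  change Continuous fun x : Circle × Circle => x.1 ^ v.1 * x.2 ^ v.2
  fun_prop

theorem chi_add (v w : ℤ × ℤ) (x : Circle × Circle) : chi (v + w) x = chi v x * chi w x := by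
  simp only [chi_apply, Prod.fst_add, Prod.snd_add, zpow_add]
  exact mul_mul_mul_comm _ _ _ _

theorem chi_smul (k : ℤ) (v : ℤ × ℤ) (x : Circle × Circle) : chi (k • v) x = chi v x ^ k := by
  simp only [chi_apply, Prod.smul_fst, Prod.smul_snd, smul_eq_mul, mul_zpow]
  rw [mul_comm k, mul_comm k, zpow_mul, zpow_mul]

/-- The determinant of two weights. -/
def wdet (p q : ℤ × ℤ) : ℤ := p.1 * q.2 - p.2 * q.1

/-- Cramer's rule in a unimodular basis. -/
theorem weight_decomp {p q : ℤ × ℤ} (h : wdet p q = 1) (v : ℤ × ℤ) :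
    v = wdet v q • p + wdet p v • q := by
  unfold wdet at *
  ext
  · simp only [Prod.fst_add, Prod.smul_fst, smul_eq_mul]
    linear_combination (-v.1) * h
  · simp only [Prod.snd_add, Prod.smul_snd, smul_eq_mul]
    linear_combination (-v.2) * h

/-- The coordinates on the torus given by a basis of its weight lattice. -/
def torusCoord (p q : ℤ × ℤ) (h : wdet p q = 1) : Circle × Circle ≃ₜ* Circle × Circle where
  toFun x := (chi p x, chi q x)
  -- The exponents form the inverse of the unimodular matrix with rows `p` and `q`.
  invFun y := (chi (q.2, -p.2) y, chi (-q.1, p.1) y)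
  left_inv x := by
    have h1 := weight_decomp h (1, 0)
    have h2 := weight_decomp h (0, 1)
    have e1 : chi (1, 0) x = x.1 := by simp [chi_apply]
    have e2 : chi (0, 1) x = x.2 := by simp [chi_apply]
    rw [h1, chi_add, chi_smul, chi_smul] at e1
    rw [h2, chi_add, chi_smul, chi_smul] at e2
    ext1
    · refine Eq.trans ?_ e1
      simp [chi_apply (q.2, -p.2), wdet]
    · refine Eq.trans ?_ e2
      simp [chi_apply (-q.1, p.1), wdet]
  right_inv y := by
    have hd : wdet (q.2, -p.2) (-q.1, p.1) = 1 := by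
      unfold wdet at *; linarith
    have h1 := weight_decomp hd (1, 0)
    have h2 := weight_decomp hd (0, 1)
    have e1 : chi (1, 0) y = y.1 := by simp [chi_apply]
    have e2 : chi (0, 1) y = y.2 := by simp [chi_apply]
    rw [h1, chi_add, chi_smul, chi_smul] at e1
    rw [h2, chi_add, chi_smul, chi_smul] at e2
    ext1
    · refine Eq.trans ?_ e1
      simp [chi_apply p, wdet]
    · refine Eq.trans ?_ e2
      simp [chi_apply q, wdet]
  map_mul' x y := by simp [map_mul]
  continuous_toFun := (continuous_chi p).prodMk (continuous_chi q)
  continuous_invFun := (continuous_chi _).prodMk (continuous_chi _)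

theorem chi_torusCoord_symm {p q : ℤ × ℤ} (h : wdet p q = 1) (y : Circle × Circle) :
    chi p ((torusCoord p q h).symm y) = y.1 ∧ chi q ((torusCoord p q h).symm y) = y.2 := by
  have := (torusCoord p q h).apply_symm_apply y
  exact ⟨congrArg Prod.fst this, congrArg Prod.snd this⟩

theorem torusCoord_symm_chi {p q : ℤ × ℤ} (h : wdet p q = 1) (x : Circle × Circle) :
    (torusCoord p q h).symm (chi p x, chi q x) = x :=
  (torusCoord p q h).symm_apply_apply x

/-- In the coordinates `chi p`, `chi q` the subgroup is the locus where the first coordinate is 1,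
and `chi q` parametrizes it. -/
theorem equiv_circle_of_mem_iff {B : Subgroup (Circle × Circle)} {p q : ℤ × ℤ}
    (h : wdet p q = 1) (hB : ∀ x, x ∈ B ↔ chi p x = 1) : Nonempty (B ≃ₜ* Circle) := by
  refine ⟨{ toFun := fun x => chi q x
            invFun := fun t => ⟨(torusCoord p q h).symm (1, t), ?_⟩
            left_inv := ?_
            right_inv := ?_
            map_mul' := fun x y => map_mul _ _ _
            continuous_toFun := (continuous_chi q).comp continuous_subtype_val
            continuous_invFun := ?_ }⟩
  · rw [hB, (chi_torusCoord_symm h _).1]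
  · rintro ⟨x, hx⟩
    apply Subtype.ext
    change (torusCoord p q h).symm (1, chi q x) = x
    rw [← (hB x).1 hx, torusCoord_symm_chi]
  · intro t
    exact (chi_torusCoord_symm h _).2
  · apply Continuous.subtype_mk
    exact (torusCoord p q h).symm.continuous.comp (by fun_prop)

theorem equiv_circle_prod_of_mem_iff {B : Subgroup (Circle × Circle)} {p q : ℤ × ℤ}
    (h : wdet p q = 1) (hB : ∀ x, x ∈ B ↔ chi p x ^ 2 = 1) :
    Nonempty (B ≃ₜ* (Circle × Cyc 2)) := by
  obtain ⟨e⟩ := circlePow_equiv_cyc 2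
  let e' : circlePow 2 ≃ₜ* Cyc 2 := discreteEquiv e
  refine ⟨{ toFun := fun x => (chi q x, e' ⟨chi p x, (hB x).1 x.2⟩)
            invFun := fun t => ⟨(torusCoord p q h).symm (e'.symm t.2, t.1), ?_⟩
            left_inv := ?_
            right_inv := ?_
            map_mul' := ?_
            continuous_toFun := ?_
            continuous_invFun := ?_ }⟩
  · rw [hB, (chi_torusCoord_symm h _).1]
    exact (e'.symm t.2).2
  · rintro ⟨x, hx⟩
    apply Subtype.ext
    simp only [ContinuousMulEquiv.symm_apply_apply]
    exact torusCoord_symm_chi h x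
  · rintro ⟨t, ε⟩
    ext1
    · exact (chi_torusCoord_symm h _).2
    · simp only [(chi_torusCoord_symm h _).1]
      exact e'.apply_symm_apply ε
  · rintro ⟨x, hx⟩ ⟨y, hy⟩
    ext1
    · simp
    · simp only [Prod.mk_mul_mk]
      rw [← map_mul]
      congr 1
      apply Subtype.ext
      simp
  · refine ((continuous_chi q).comp continuous_subtype_val).prodMk (e'.continuous.comp ?_)
    apply Continuous.subtype_mk
    exact (continuous_chi p).comp continuous_subtype_val
  · apply Continuous.subtype_mk
    refine (torusCoord p q h).symm.continuous.comp (Continuous.prodMk ?_ continuous_fst)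
    exact continuous_subtype_val.comp (e'.symm.continuous.comp continuous_snd)

theorem circle_zpow_abs {z : Circle} {n : ℤ} (h : z ^ n = 1) : z ^ n.natAbs = 1 := by
  rcases Int.natAbs_eq n with h' | h'
  · rw [h'] at h; simpa using h
  · rw [h'] at h; simpa using h

/-- Restrict `chi p` to `B`. Its image lies in the `k`-th roots of unity. On its kernel the relation
`hv` becomes a condition on `chi q` alone, with exponent `wdet p v`, so the kernel has at most
`|wdet p v|` elements. -/
theorem card_le_of_two_weights {B : Subgroup (Circle × Circle)} {p q v : ℤ × ℤ} {k : ℕ}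
    (hk : k ≠ 0) (h : wdet p q = 1) (hp : ∀ x ∈ B, chi p x ^ k = 1)
    (hv : ∀ x ∈ B, chi v x = 1) (hn : wdet p v ≠ 0) :
    Finite B ∧ Nat.card B ≤ (wdet p v).natAbs * k := by
  have : NeZero k := ⟨hk⟩
  set n := (wdet p v).natAbs with hn'
  have hn0 : n ≠ 0 := by simpa [hn'] using hn
  have : NeZero n := ⟨hn0⟩
  have : NeZero (n * k) := ⟨mul_ne_zero hn0 hk⟩
  have hdec : ∀ x ∈ B, chi p x ^ wdet v q * chi q x ^ wdet p v = 1 := by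
    intro x hx
    rw [← chi_smul, ← chi_smul, ← chi_add, ← weight_decomp h, hv x hx]
  have hq : ∀ x ∈ B, chi q x ^ (n * k) = 1 := by
    intro x hx
    have h1 := congrArg (fun z => z ^ k) (hdec x hx)
    simp only [mul_pow, one_pow] at h1
    have h2 : (chi p x ^ wdet v q) ^ k = 1 := by
      rw [← zpow_natCast, zpow_comm, zpow_natCast, hp x hx, one_zpow]
    rw [h2, one_mul, ← zpow_natCast, ← zpow_mul] at h1
    have := circle_zpow_abs h1
    rwa [Int.natAbs_mul, Int.natAbs_natCast] at this
  have hinj : ∀ x y : Circle × Circle, chi p x = chi p y → chi q x = chi q y → x = y := by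
    intro x y h1 h2
    apply (torusCoord p q h).injective
    exact Prod.ext h1 h2
  have hfin : Finite B := by
    refine Finite.of_injective (β := circlePow k × circlePow (n * k))
      (fun x => (⟨chi p x, hp x x.2⟩, ⟨chi q x, hq x x.2⟩)) ?_
    intro x y hxy
    simp only [Prod.mk.injEq] at hxy
    exact Subtype.ext (hinj _ _ (congrArg Subtype.val hxy.1) (congrArg Subtype.val hxy.2))
  refine ⟨hfin, ?_⟩
  let f : B →* circlePow k :=
    { toFun := fun x => ⟨chi p x, hp x x.2⟩
      map_one' := by apply Subtype.ext; simp
      map_mul' := fun x y => by apply Subtype.ext; simp }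
  have hker : Nat.card f.ker ≤ n := by
    rw [← card_circlePow n]
    refine Nat.card_le_card_of_injective (fun x : f.ker => (⟨chi q (x : B), ?_⟩ : circlePow n)) ?_
    · have h1 : chi p (x : B) = 1 := congrArg Subtype.val x.2
      have h2 := hdec _ (x : B).2
      rw [h1, one_zpow, one_mul] at h2
      exact circle_zpow_abs h2
    · intro x y hxy
      have h1 : chi p (x : B) = 1 := congrArg Subtype.val x.2
      have h2 : chi p (y : B) = 1 := congrArg Subtype.val y.2
      exact Subtype.ext (Subtype.ext (hinj _ _ (h1.trans h2.symm) (congrArg Subtype.val hxy)))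
  have hrange : Nat.card f.range ≤ k := by
    conv_rhs => rw [← card_circlePow k]
    exact Nat.card_le_card_of_injective _ Subtype.val_injective
  have := f.ker.card_mul_index
  rw [Subgroup.index_ker] at this
  rw [← this]
  exact Nat.mul_le_mul hker hrange

/-! ### Weights of the monomials and the subgroups that they cut out -/

/-- The weight of the doublet `φ_a` under the torus. -/
def wt : Fin 3 → ℤ × ℤ := ![(0, 0), (1, 0), (1, 1)]

/-- The weight of the monomial `(φ_a† φ_b)(φ_c† φ_d)`. -/
def weight4 (a b c d : Fin 3) : ℤ × ℤ := wt b - wt a + (wt d - wt c)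

/-- The weights of the quartic monomials. -/
def quarticWeights : Finset (ℤ × ℤ) :=
  Finset.univ.image fun x : Fin 3 × Fin 3 × Fin 3 × Fin 3 => weight4 x.1 x.2.1 x.2.2.1 x.2.2.2

theorem weight4_mem (a b c d : Fin 3) : weight4 a b c d ∈ quarticWeights :=
  Finset.mem_image.2 ⟨(a, b, c, d), Finset.mem_univ _, rfl⟩

theorem quarticWeights_eq : quarticWeights = {(0,0), (1,0), (-1,0), (0,1), (0,-1), (1,1), (-1,-1),
    (2,0), (-2,0), (0,2), (0,-2), (2,2), (-2,-2), (1,-1), (-1,1), (2,1), (-2,-1), (1,2), (-1,-2)} := by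
  decide +kernel

/-- The arithmetic input of the torus classification. For `v = k • p` the product `|wdet p w| * k`
is the absolute determinant of `v` and `w`, which bounds the order of a finite kernel. When `wdet p
w = 0`, the number `wdet w q` is the multiple of `p` that `w` equals. -/
theorem quarticWeights_basis : ∀ v ∈ quarticWeights, v ≠ 0 →
    ∃ p q : ℤ × ℤ, ∃ k : ℕ, (k = 1 ∨ k = 2) ∧ v = (k : ℤ) • p ∧ wdet p q = 1 ∧
      ∀ w ∈ quarticWeights, (wdet p w).natAbs * k ≤ 4 ∧
        (wdet p w = 0 → (wdet w q).natAbs ≤ 2) := by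
  -- Explicit finite ranges for `p`, `q` and `k` make the search decidable.
  have key : ∀ v ∈ quarticWeights, v ≠ 0 →
    ∃ p ∈ ({(1,0), (-1,0), (0,1), (0,-1), (1,1), (-1,-1),
      (1,-1), (-1,1), (2,1), (-2,-1), (1,2), (-1,-2)} : Finset (ℤ × ℤ)),
      ∃ q ∈ ({(1,0), (-1,0), (0,1), (0,-1)} : Finset (ℤ × ℤ)),
    ∃ k ∈ ({1, 2} : Finset ℕ), v = (k : ℤ) • p ∧ wdet p q = 1 ∧
      ∀ w ∈ quarticWeights, (wdet p w).natAbs * k ≤ 4 ∧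
        (wdet p w = 0 → (wdet w q).natAbs ≤ 2) := by
    rw [quarticWeights_eq]
    decide +kernel
  intro v hv h0
  obtain ⟨p, -, q, -, k, hk, h⟩ := key v hv h0
  exact ⟨p, q, k, by simpa using hk, h⟩

theorem equiv_torus {B : Subgroup (Circle × Circle)} (hB : ∀ x, x ∈ B) :
    Nonempty (B ≃ₜ* (Circle × Circle)) :=
  ⟨{ toFun := fun x => x
     invFun := fun x => ⟨x, hB x⟩
     left_inv := fun _ => rfl
     right_inv := fun _ => rfl
     map_mul' := fun _ _ => rfl
     continuous_toFun := continuous_subtype_val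
     continuous_invFun := continuous_id.subtype_mk _ }⟩

/-- The cases are the ranks 0, 1 and 2 of the span of `W`. In rank 1 all weights are multiples of
one primitive `p`, and the kernel depends only on whether `±p` itself occurs. -/
theorem torus_subgroup_classification (B : Subgroup (Circle × Circle)) (W : Set (ℤ × ℤ))
    (hW : ∀ v ∈ W, v ∈ quarticWeights) (hB : ∀ x, x ∈ B ↔ ∀ v ∈ W, chi v x = 1) :
    (Finite B ∧ Nat.card B ≤ 4) ∨ Nonempty (B ≃ₜ* Circle) ∨
      Nonempty (B ≃ₜ* (Circle × Cyc 2)) ∨ Nonempty (B ≃ₜ* (Circle × Circle)) := by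
  by_cases h0 : ∀ v ∈ W, v = 0
  · right; right; right
    have hB1 : ∀ x, x ∈ B := fun x => (hB x).2 fun v hv => by rw [h0 v hv]; simp [chi_apply]
    exact equiv_torus hB1
  push Not at h0
  obtain ⟨v, hv, hv0⟩ := h0
  obtain ⟨p, q, k, hk, rfl, hpq, hS⟩ := quarticWeights_basis v (hW v hv) hv0
  have hpk : ∀ x ∈ B, chi p x ^ k = 1 := by
    intro x hx
    have := (hB x).1 hx _ hv
    rwa [chi_smul, zpow_natCast] at this
  by_cases h1 : ∀ w ∈ W, wdet p w = 0
  · have hw : ∀ w ∈ W, ∀ x, chi w x = chi p x ^ wdet w q := by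
      intro w hw x
      conv_lhs => rw [weight_decomp hpq w, h1 w hw, zero_smul, add_zero, chi_smul]
    by_cases h2 : ∃ w ∈ W, (wdet w q).natAbs = 1
    · right; left
      refine equiv_circle_of_mem_iff hpq fun x => ⟨fun hx => ?_, fun hx => ?_⟩
      · obtain ⟨w, hwW, hw1⟩ := h2
        have := (hB x).1 hx w hwW
        rw [hw w hwW] at this
        have := circle_zpow_abs this
        rwa [hw1, pow_one] at this
      · rw [hB]
        intro w hwW
        rw [hw w hwW, hx, one_zpow]
    · right; right; left
      push Not at h2
      have hkv : wdet ((k : ℤ) • p) q = k := by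
        have : wdet ((k : ℤ) • p) q = k * wdet p q := by
          simp only [wdet, Prod.smul_fst, Prod.smul_snd, smul_eq_mul]
          ring
        rw [this, hpq, mul_one]
      -- As no weight in `W` is `±p`, the given nonzero weight must be `2 • p`.
      have hk2 : k = 2 := by
        have := h2 _ hv
        rw [hkv] at this
        rcases hk with rfl | rfl
        · simp at this
        · rfl
      subst hk2
      refine equiv_circle_prod_of_mem_iff hpq fun x => ⟨fun hx => hpk x hx, fun hx => ?_⟩
      rw [hB]
      intro w hwW
      rw [hw w hwW]
      have h3 := (hS w (hW w hwW)).2 (h1 w hwW)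
      have h4 := h2 w hwW
      have h5 : wdet w q = 0 ∨ wdet w q = 2 ∨ wdet w q = -2 := by omega
      rcases h5 with h5 | h5 | h5 <;> rw [h5]
      · simp
      · exact_mod_cast hx
      · rw [zpow_neg]
        rw [inv_eq_one]
        exact_mod_cast hx
  · left
    push Not at h1
    obtain ⟨w, hw, hw0⟩ := h1
    have := card_le_of_two_weights (B := B) (v := w) (k := k) (by rcases hk with rfl | rfl <;> simp)
      hpq hpk (fun x hx => (hB x).1 hx w hw) hw0
    exact ⟨this.1, this.2.trans (hS w (hW w hw)).1⟩

theorem finite_group_equiv {A : Type*} [Group A] [TopologicalSpace A] [T1Space A] [Finite A]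
    [Nontrivial A] (h : Nat.card A ≤ 4) :
    Nonempty (A ≃ₜ* Cyc 2) ∨ Nonempty (A ≃ₜ* Cyc 3) ∨ Nonempty (A ≃ₜ* Cyc 4) ∨
      Nonempty (A ≃ₜ* (Cyc 2 × Cyc 2)) := by
  have h1 : 1 < Nat.card A := Finite.one_lt_card
  obtain h2 | h2 | h2 : Nat.card A = 2 ∨ Nat.card A = 3 ∨ Nat.card A = 4 := by omega
  · exact Or.inl ((equiv_of_card_prime Nat.prime_two h2).map discreteEquiv)
  · exact Or.inr (Or.inl ((equiv_of_card_prime Nat.prime_three h2).map discreteEquiv))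
  · rcases equiv_of_card_four h2 with h3 | h3
    · exact Or.inr (Or.inr (Or.inl (h3.map discreteEquiv)))
    · exact Or.inr (Or.inr (Or.inr (h3.map discreteEquiv)))

/-! ### The maximal torus of `PSU(3)` -/

theorem circle_conj_mul (z : Circle) : conj (z : ℂ) * z = 1 :=
  conj_mul_self_eq_one.2 (Circle.norm_coe z)

theorem circle_conj (z : Circle) : conj (z : ℂ) = ((z⁻¹ : Circle) : ℂ) :=
  (Circle.coe_inv_eq_conj z).symm

theorem monoMat_mem_unitary {m : Fin 3 → ℂ} (hm : ∀ a, ‖m a‖ = 1) (σ : Equiv.Perm (Fin 3)) :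
    monoMat m σ ∈ Matrix.unitaryGroup (Fin 3) ℂ := by
  rw [Matrix.mem_unitaryGroup_iff]
  ext a b
  simp only [Matrix.mul_apply, Matrix.star_apply, monoMat, Matrix.of_apply]
  by_cases hab : a = b
  · subst hab
    have := conj_mul_self_eq_one.2 (hm a)
    rw [mul_comm] at this
    simp [this]
  · have h : ∀ i, (if i = σ a then m a else 0) * star (if i = σ b then m b else 0) = 0 := by
      intro i
      by_cases hi : i = σ a
      · have : i ≠ σ b := fun h => hab (σ.injective (hi.symm.trans h))
        simp [this]
      · simp [hi]
    simp only [h, Finset.sum_const_zero, Matrix.one_apply, hab, if_false]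

/-- A monomial unitary matrix. -/
def monoU (m : Fin 3 → Circle) (σ : Equiv.Perm (Fin 3)) : U3 :=
  ⟨monoMat (fun a => (m a : ℂ)) σ, monoMat_mem_unitary (fun _ => Circle.norm_coe _) σ⟩

/-- The diagonal matrix `diag(1, z, z w)`. -/
def torusU : Circle × Circle →* U3 where
  toFun x := monoU (fun a => chi (wt a) x) 1
  map_one' := by
    apply Subtype.ext
    ext a b
    simp [monoU, monoMat, Matrix.one_apply, eq_comm]
  map_mul' x y := by
    apply Subtype.ext
    ext a b
    change _ = (monoMat (fun a => (chi (wt a) x : ℂ)) 1 *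
      monoMat (fun a => (chi (wt a) y : ℂ)) 1 : Matrix (Fin 3) (Fin 3) ℂ) a b
    rw [monoMat_mul_apply]
    simp only [monoU, monoMat, Matrix.of_apply, map_mul, Circle.coe_mul, Equiv.Perm.coe_one, id_eq]
    by_cases hab : b = a <;> simp [hab]

theorem torusU_apply (x : Circle × Circle) (a b : Fin 3) :
    (torusU x : Matrix (Fin 3) (Fin 3) ℂ) a b = if b = a then (chi (wt a) x : ℂ) else 0 := rfl

/-- The parametrization of the maximal torus of `PSU(3)` by its weights. -/
def torusHom : Circle × Circle →* PSU 3 := proj.comp torusU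

theorem torusHom_injective : Function.Injective torusHom := by
  rw [injective_iff_map_eq_one]
  intro x hx
  have : proj 1 = proj (torusU x) := by rw [map_one]; exact hx.symm
  obtain ⟨c, hc⟩ := (proj_eq_iff _ _).1 this
  have h := fun a => congrFun (congrFun hc a) a
  simp only [torusU_apply, Matrix.smul_apply, if_true, smul_eq_mul, Submonoid.coe_one,
    Matrix.one_apply_eq, mul_one] at h
  have h0 := h 0
  have h1 := h 1
  have h2 := h 2
  simp only [wt, chi_apply, Matrix.cons_val_zero, Matrix.cons_val_one, Matrix.cons_val] at h0 h1 h2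
  simp only [zpow_zero, mul_one, zpow_one, Circle.coe_one] at h0 h1 h2
  rw [← h0, Circle.coe_eq_one] at h1
  rw [← h0, Circle.coe_eq_one, h1, one_mul] at h2
  exact Prod.ext h1 h2

theorem unitary_diag_norm {M : Matrix (Fin 3) (Fin 3) ℂ} (hM : M ∈ Matrix.unitaryGroup (Fin 3) ℂ)
    (hd : M.IsDiag) (a : Fin 3) : ‖M a a‖ = 1 := by
  have h := congrFun (congrFun (Matrix.mem_unitaryGroup_iff'.1 hM) a) a
  rw [Matrix.mul_apply, Finset.sum_eq_single a] at h
  · rw [Matrix.star_apply, Matrix.one_apply_eq] at h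
    exact conj_mul_self_eq_one.1 h
  · intro b _ hb
    rw [hd hb, mul_zero]
  · simp

theorem exists_torusU {M : U3} (hd : (M : Matrix (Fin 3) (Fin 3) ℂ).IsDiag) :
    ∃ x, torusHom x = proj M := by
  let A : Matrix (Fin 3) (Fin 3) ℂ := M
  have hn := unitary_diag_norm M.2 hd
  let t : Fin 3 → Circle := fun a => ⟨A a a, mem_sphere_zero_iff_norm.2 (hn a)⟩
  refine ⟨(t 1 / t 0, t 2 / t 1), ?_⟩
  change proj _ = proj _
  rw [proj_eq_iff]
  refine ⟨t 0, ?_⟩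
  ext a b
  rw [Matrix.smul_apply, torusU_apply]
  by_cases hab : b = a
  · subst hab
    rw [if_pos rfl, smul_eq_mul, ← Circle.coe_mul]
    change ((t b : Circle) : ℂ) = _
    congr 1
    fin_cases b <;> simp [wt, chi_apply] <;> rfl
  · rw [if_neg hab, smul_zero]
    exact hd (Ne.symm hab)

theorem torusU_isDiag (x : Circle × Circle) : (torusU x : Matrix (Fin 3) (Fin 3) ℂ).IsDiag := by
  intro a b hab
  rw [torusU_apply, if_neg hab.symm]

theorem torusHom_mem (x : Circle × Circle) : torusHom x ∈ torus 3 := by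
  obtain ⟨c, hc, h⟩ := suRep_spec (torusU x)
  refine ⟨suRep (torusU x), ?_, rfl⟩
  change ((suRep (torusU x) : SU 3) : Matrix (Fin 3) (Fin 3) ℂ).IsDiag
  rw [h]
  exact (torusU_isDiag x).smul c

theorem mem_torus_iff (g : PSU 3) : g ∈ torus 3 ↔ ∃ x, torusHom x = g := by
  constructor
  · rintro ⟨u, hu, rfl⟩
    obtain ⟨x, hx⟩ := exists_torusU (M := suIncl u) hu
    exact ⟨x, hx.trans (proj_suIncl u)⟩
  · rintro ⟨x, rfl⟩
    exact torusHom_mem x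

theorem circle_exists_root {n : ℕ} (hn : n ≠ 0) (z : Circle) : ∃ s : Circle, s ^ n = z := by
  obtain ⟨c, hc, h⟩ := exists_pow_eq_unit hn (Circle.norm_coe z)
  exact ⟨⟨c, mem_sphere_zero_iff_norm.2 hc⟩, Circle.ext h⟩

/-- The diagonal matrices of `SU(3)`. -/
def diagMat (y : Circle × Circle) : SU 3 :=
  ⟨Matrix.diagonal ![(y.1 : ℂ), y.2, ((y.1 * y.2)⁻¹ : Circle)], by
    rw [Matrix.mem_specialUnitaryGroup_iff, Matrix.mem_unitaryGroup_iff']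
    constructor
    · rw [Matrix.star_eq_conjTranspose, Matrix.diagonal_conjTranspose,
        Matrix.diagonal_mul_diagonal, ← Matrix.diagonal_one]
      congr 1
      funext a
      fin_cases a
      · exact circle_conj_mul _
      · exact circle_conj_mul _
      · exact circle_conj_mul _
    · rw [Matrix.det_diagonal, Fin.prod_univ_three]
      simp only [Matrix.cons_val_zero, Matrix.cons_val_one, Matrix.cons_val]
      rw [← Circle.coe_mul, ← Circle.coe_mul, mul_inv_cancel, Circle.coe_one]⟩

theorem continuous_diagMat : Continuous diagMat := by
  apply Continuous.subtype_mk
  apply Continuous.matrix_diagonal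
  refine continuous_pi fun a => ?_
  fin_cases a
  · exact continuous_subtype_val.comp continuous_fst
  · exact continuous_subtype_val.comp continuous_snd
  · exact continuous_subtype_val.comp (f := fun a : Circle × Circle => (a.1 * a.2)⁻¹) (by fun_prop)

/-- The representatives `suRep` are arbitrary choices, so continuity is not visible from the
definition. It is checked after composing with the map `q` that sends a diagonal matrix of SU(3) to
its ratios of entries. This `q` is a continuous surjection from a compact to a Hausdorff space,
hence a quotient map, and the composite is visibly continuous. -/
theorem continuous_torusHom : Continuous torusHom := by
  let q : Circle × Circle → Circle × Circle := fun y => (chi (-1, 1) y, chi (-1, -2) y)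
  have hq : Continuous q := (continuous_chi _).prodMk (continuous_chi _)
  have hs : Function.Surjective q := by
    rintro ⟨z, w⟩
    -- At `(s, z * s)` the first ratio is `z` and the second is `s⁻³ z⁻²`, which has to equal `w`.
    obtain ⟨s, hs⟩ := circle_exists_root (n := 3) (by norm_num) ((w * z ^ 2)⁻¹)
    refine ⟨(s, z * s), ?_⟩
    ext1
    · simp [q, chi_apply]
    · simp only [q, chi_apply]
      have : w = (s ^ 3)⁻¹ * (z ^ 2)⁻¹ := by rw [hs]; simp
      rw [this]
      simp only [zpow_neg, zpow_one, mul_zpow, mul_inv]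
      have e : (z ^ (2 : ℤ)) = z ^ 2 := by norm_cast
      have e' : (s ^ (2 : ℤ)) = s ^ 2 := by norm_cast
      rw [e, e', pow_succ' s 2, mul_inv]
      rw [mul_comm (z ^ 2)⁻¹, mul_assoc]
  have hquot : Topology.IsQuotientMap q :=
    Topology.IsQuotientMap.of_surjective_continuous hs hq
  rw [hquot.continuous_iff]
  have : torusHom ∘ q = fun y => (QuotientGroup.mk (diagMat y) : PSU 3) := by
    funext y
    change proj _ = _
    rw [proj_eq_mk_iff]
    refine ⟨y.1, ?_⟩
    ext a b
    rw [Matrix.smul_apply, torusU_apply]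
    by_cases hab : b = a
    · subst hab
      rw [if_pos rfl, smul_eq_mul, ← Circle.coe_mul]
      simp only [diagMat, Matrix.diagonal_apply_eq]
      fin_cases b
      · simp [wt, chi_apply]
      · simp [wt, chi_apply, q]
      · simp only [Fin.reduceFinMk, Matrix.cons_val, Circle.coe_inj]
        simp only [wt, q, chi_apply, Matrix.cons_val]
        simp only [zpow_one, zpow_neg]
        have e' : (y.2 ^ (2 : ℤ)) = y.2 * y.2 := by rw [← sq]; norm_cast
        rw [e']
        simp only [mul_inv]
        calc _ = (y.1 * y.1⁻¹) * (y.2 * y.2⁻¹) * (y.1⁻¹ * y.2⁻¹) := by simp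
          _ = _ := by ac_rfl
    · rw [if_neg hab, smul_zero]
      simp [diagMat, Matrix.diagonal_apply_ne' _ hab]
  rw [this]
  exact QuotientGroup.continuous_mk.comp continuous_diagMat

/-- Functions on `PSU(3)` that extend the fundamental weights of its maximal torus. -/
def weightFun (a b : Fin 3) : PSU 3 → ℂ :=
  Quotient.lift (fun u : SU 3 => conj ((u : Matrix (Fin 3) (Fin 3) ℂ) a a) *
    (u : Matrix (Fin 3) (Fin 3) ℂ) b b) (by
    intro u v huv
    obtain ⟨c, hc⟩ := (SU_mk_eq_iff u v).1 (Quotient.sound huv)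
    have := conj_mul_self_eq_one.2 (unit_of_smul (M := suIncl u) (N := suIncl v) hc)
    rw [hc]
    simp only [Matrix.smul_apply, smul_eq_mul, map_mul]
    linear_combination (-(conj ((u : Matrix (Fin 3) (Fin 3) ℂ) a a) *
      (u : Matrix (Fin 3) (Fin 3) ℂ) b b)) * this)

theorem continuous_weightFun (a b : Fin 3) : Continuous (weightFun a b) := by
  apply Continuous.quotient_lift
  apply Continuous.mul
  · exact Complex.continuous_conj.comp (continuous_subtype_val.matrix_elem a a)
  · exact continuous_subtype_val.matrix_elem b b

theorem weightFun_torusHom (a b : Fin 3) (x : Circle × Circle) :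
    weightFun a b (torusHom x) = (chi (wt b - wt a) x : ℂ) := by
  obtain ⟨c, hc, h⟩ := suRep_spec (torusU x)
  change conj ((suRep (torusU x) : Matrix (Fin 3) (Fin 3) ℂ) a a) *
    (suRep (torusU x) : Matrix (Fin 3) (Fin 3) ℂ) b b = _
  rw [h]
  simp only [Matrix.smul_apply, torusU_apply, if_true, smul_eq_mul, map_mul]
  rw [sub_eq_add_neg, ← neg_one_smul ℤ (wt a), chi_add, chi_smul, zpow_neg_one, Circle.coe_mul,
    ← circle_conj]
  linear_combination (conj (chi (wt a) x : ℂ) * chi (wt b) x) * conj_mul_self_eq_one.2 hc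

/-- A subgroup of the maximal torus in the coordinates given by the weights, as an abstract
group. -/
def torusSubgroupMulEquiv (A : Subgroup (PSU 3)) (hA : A ≤ torus 3) :
    A.comap torusHom ≃* A :=
  MulEquiv.ofBijective
    ({ toFun := fun x => ⟨torusHom x, x.2⟩
       map_one' := by apply Subtype.ext; simp
       map_mul' := fun x y => by apply Subtype.ext; simp } : A.comap torusHom →* A) (by
    constructor
    · intro x y hxy
      exact Subtype.ext (torusHom_injective (congrArg Subtype.val hxy))
    · rintro ⟨g, hg⟩
      obtain ⟨x, rfl⟩ := (mem_torus_iff g).1 (hA hg)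
      exact ⟨⟨x, hg⟩, rfl⟩)

/-- A subgroup of the maximal torus in the coordinates given by the weights. -/
def torusSubgroupEquiv (A : Subgroup (PSU 3)) (hA : A ≤ torus 3) :
    A.comap torusHom ≃ₜ* A where
  __ := torusSubgroupMulEquiv A hA
  continuous_toFun := by
    apply Continuous.subtype_mk
    exact continuous_torusHom.comp continuous_subtype_val
  continuous_invFun := by
    let e := torusSubgroupMulEquiv A hA
    change Continuous e.symm
    have key : ∀ g : A, torusHom (e.symm g : Circle × Circle) = g := fun g =>
      congrArg Subtype.val (e.apply_symm_apply g)
    rw [continuous_induced_rng]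
    -- Both coordinates of the inverse are restrictions of the continuous phase-independent
    -- functions `weightFun 0 1` and `weightFun 1 2`.
    refine Continuous.prodMk ?_ ?_
    · refine continuous_induced_rng.2 ?_
      refine ((continuous_weightFun 0 1).comp continuous_subtype_val).congr fun g => ?_
      have h := weightFun_torusHom 0 1 (e.symm g : Circle × Circle)
      rw [key] at h
      simp only [Function.comp]
      rw [h]
      simp [wt, chi_apply]
    · refine continuous_induced_rng.2 ?_
      refine ((continuous_weightFun 1 2).comp continuous_subtype_val).congr fun g => ?_
      have h := weightFun_torusHom 1 2 (e.symm g : Circle × Circle)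
      rw [key] at h
      simp only [Function.comp]
      rw [h]
      simp [wt, chi_apply]

/-! ### Realizable subgroups of the maximal torus -/

/-- The weights of the monomials that occur in a potential. -/
def Potential.weights (V : Potential 3) : Set (ℤ × ℤ) :=
  {v | ∃ a b, V.Y a b ≠ 0 ∧ v = weight4 a b a a} ∪
    {v | ∃ a b c d, V.Z a b c d ≠ 0 ∧ v = weight4 a b c d}

theorem conj_chi_mul (a b : Fin 3) (x : Circle × Circle) :
    conj (chi (wt a) x : ℂ) * chi (wt b) x = (chi (wt b - wt a) x : ℂ) := by
  rw [sub_eq_add_neg, ← neg_one_smul ℤ (wt a), chi_add, chi_smul, zpow_neg_one, Circle.coe_mul,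
    ← circle_conj, mul_comm]

/-- Each coefficient is multiplied by the character of its monomial, so it survives only if it
vanishes or the character is 1. -/
theorem inv_torusU_iff (V : Potential 3) (x : Circle × Circle) :
    V.Inv (torusU x) 1 ↔ ∀ v ∈ V.weights, chi v x = 1 := by
  have h := inv_monoMat_iff V (fun a => (chi (wt a) x : ℂ)) 1
  refine h.trans ?_
  simp only [conj_chi_mul, ← Circle.coe_mul, ← chi_add, Equiv.Perm.coe_one, id_eq]
  have key : ∀ (z : Circle) (y : ℂ), (z : ℂ) * y = y ↔ (y ≠ 0 → z = 1) := by
    intro z y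
    by_cases hy : y = 0
    · simp [hy]
    · simp [hy, ← Circle.coe_eq_one]
  simp only [key]
  constructor
  · rintro ⟨h1, h2⟩ v (⟨a, b, h, rfl⟩ | ⟨a, b, c, d, h, rfl⟩)
    · have := h1 a b h
      simpa [weight4] using this
    · exact h2 a b c d h
  · intro h
    refine ⟨fun a b hY => ?_, fun a b c d hZ => h _ (Or.inr ⟨a, b, c, d, hZ, rfl⟩)⟩
    have := h _ (Or.inl ⟨a, b, hY, rfl⟩)
    simpa [weight4] using this

/-- The torus part of the symmetry group in the coordinates given by the weights. -/
def Potential.torusSymm (V : Potential 3) : Subgroup (Circle × Circle) :=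
  V.autUnitary.comap torusHom

theorem mem_torusSymm (V : Potential 3) (x : Circle × Circle) :
    x ∈ V.torusSymm ↔ ∀ v ∈ V.weights, chi v x = 1 :=
  (proj_mem_autUnitary V (torusU x)).trans (inv_torusU_iff V x)

theorem torusSymm_classification (V : Potential 3) :
    (Finite V.torusSymm ∧ Nat.card V.torusSymm ≤ 4) ∨ Nonempty (V.torusSymm ≃ₜ* Circle) ∨
      Nonempty (V.torusSymm ≃ₜ* (Circle × Cyc 2)) ∨
      Nonempty (V.torusSymm ≃ₜ* (Circle × Circle)) := by
  apply torus_subgroup_classification _ V.weights _ (mem_torusSymm V)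
  rintro v (⟨a, b, -, rfl⟩ | ⟨a, b, c, d, -, rfl⟩) <;> exact weight4_mem _ _ _ _

theorem realizable_torus_classification (A : Subgroup (PSU 3)) (hT : A ≤ torus 3)
    (hR : RealizableUnitary A) (hA : A ≠ ⊥) :
    Nonempty (A ≃ₜ* Cyc 2) ∨ Nonempty (A ≃ₜ* Cyc 3) ∨
    Nonempty (A ≃ₜ* Cyc 4) ∨ Nonempty (A ≃ₜ* (Cyc 2 × Cyc 2)) ∨
    Nonempty (A ≃ₜ* Circle) ∨ Nonempty (A ≃ₜ* (Circle × Cyc 2)) ∨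
    Nonempty (A ≃ₜ* (Circle × Circle)) := by
  obtain ⟨V, rfl⟩ := hR
  have e : V.torusSymm ≃ₜ* V.autUnitary := torusSubgroupEquiv _ hT
  have tr : ∀ {H : Type} [Group H] [TopologicalSpace H], Nonempty (V.torusSymm ≃ₜ* H) →
      Nonempty (V.autUnitary ≃ₜ* H) := fun ⟨f⟩ => ⟨e.symm.trans f⟩
  rcases torusSymm_classification V with ⟨hf, hc⟩ | h | h | h
  · have : Nontrivial V.autUnitary := (Subgroup.nontrivial_iff_ne_bot _).2 hA
    have : Nontrivial V.torusSymm := e.toEquiv.nontrivial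
    rcases finite_group_equiv hc with h | h | h | h
    · exact Or.inl (tr h)
    · exact Or.inr (Or.inl (tr h))
    · exact Or.inr (Or.inr (Or.inl (tr h)))
    · exact Or.inr (Or.inr (Or.inr (Or.inl (tr h))))
  · exact Or.inr (Or.inr (Or.inr (Or.inr (Or.inl (tr h)))))
  · exact Or.inr (Or.inr (Or.inr (Or.inr (Or.inr (Or.inl (tr h))))))
  · exact Or.inr (Or.inr (Or.inr (Or.inr (Or.inr (Or.inr (tr h))))))

/-! ### Potentials built from monomials -/

/-- The quadratic part is preserved on its own, which says `M* Y M = Y`; then use unitarity. -/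
theorem inv_commute_Y {V : Potential 3} {M : U3} (h : V.Inv M 1) :
    Matrix.of V.Y * (M : Matrix (Fin 3) (Fin 3) ℂ) = M * Matrix.of V.Y := by
  have h1 : star (M : Matrix (Fin 3) (Fin 3) ℂ) * (Matrix.of V.Y * M) = Matrix.of V.Y := by
    ext i j
    rw [Matrix.of_apply, ← (inv_coeff h).1 i j]
    simp only [Matrix.mul_apply, Potential.pull, Fintype.sum_prod_type, Finset.mul_sum,
      Matrix.star_apply, Matrix.of_apply]
    refine Finset.sum_congr rfl fun a _ => Finset.sum_congr rfl fun b _ => ?_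
    simp only [RCLike.star_def]
    ring
  conv_rhs => rw [← h1, ← Matrix.mul_assoc, Matrix.mem_unitaryGroup_iff.1 M.2, Matrix.one_mul]

/-- The potential with squared masses `1`, `2`, `3` and the given quartic monomials, together with
their Hermitian conjugates. -/
def monoPot (T : Finset (Fin 3 × Fin 3 × Fin 3 × Fin 3)) : Potential 3 where
  Y a b := if a = b then ((a : ℕ) + 1 : ℝ) else 0
  Z a b c d := (((if (a, b, c, d) ∈ T then 1 else 0) + (if (c, d, a, b) ∈ T then 1 else 0) +
    (if (b, a, d, c) ∈ T then 1 else 0) + (if (d, c, b, a) ∈ T then 1 else 0) : ℕ) : ℂ)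
  Y_herm a b := by
    by_cases h : a = b
    · subst h; simp
    · simp [h, Ne.symm h]
  Z_symm a b c d := by
    congr 1; omega
  Z_herm a b c d := by
    rw [Complex.conj_natCast]; congr 1; omega

/-- A matrix that commutes with a diagonal matrix with distinct entries is diagonal. -/
theorem monoPot_isDiag {T : Finset (Fin 3 × Fin 3 × Fin 3 × Fin 3)} {M : U3}
    (h : (monoPot T).Inv M 1) : (M : Matrix (Fin 3) (Fin 3) ℂ).IsDiag := by
  have h1 := inv_commute_Y h
  have hY : Matrix.of (monoPot T).Y =
      Matrix.diagonal fun a : Fin 3 => ((((a : ℕ) + 1 : ℝ)) : ℂ) := by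
    ext a b
    simp [monoPot, Matrix.diagonal_apply]
  rw [hY] at h1
  intro a b hab
  have h2 := congrFun (congrFun h1 a) b
  rw [Matrix.diagonal_mul, Matrix.mul_diagonal] at h2
  have h3 : ((a : ℕ) : ℂ) - ((b : ℕ) : ℂ) ≠ 0 := by
    rw [sub_ne_zero]
    intro h
    exact hab (Fin.ext (Nat.cast_injective h))
  push_cast at h2
  have h4 : (((a : ℕ) : ℂ) - ((b : ℕ) : ℂ)) * (M : Matrix (Fin 3) (Fin 3) ℂ) a b = 0 := by
    linear_combination h2
  exact (mul_eq_zero.1 h4).resolve_left h3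

theorem monoPot_le_torus (T : Finset (Fin 3 × Fin 3 × Fin 3 × Fin 3)) :
    (monoPot T).autUnitary ≤ torus 3 := by
  intro g hg
  obtain ⟨M, rfl⟩ := proj_surjective g
  rw [mem_torus_iff]
  exact exists_torusU (monoPot_isDiag ((proj_mem_autUnitary _ _).1 hg))

theorem chi_neg (v : ℤ × ℤ) (x : Circle × Circle) : chi (-v) x = (chi v x)⁻¹ := by
  rw [← neg_one_smul ℤ v, chi_smul, zpow_neg_one]

/-- The coefficients are sums of natural numbers, so nothing cancels. The monomials added by
symmetrization have the same weight as a member of `T` or the opposite one, and impose nothing new.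
-/
theorem mem_monoPot_torusSymm (T : Finset (Fin 3 × Fin 3 × Fin 3 × Fin 3))
    (x : Circle × Circle) : x ∈ (monoPot T).torusSymm ↔
      ∀ t ∈ T, chi (weight4 t.1 t.2.1 t.2.2.1 t.2.2.2) x = 1 := by
  rw [mem_torusSymm]
  constructor
  · rintro h ⟨a, b, c, d⟩ ht
    refine h _ (Or.inr ⟨a, b, c, d, ?_, rfl⟩)
    simp only [monoPot, ht, if_true]
    norm_cast
    omega
  · rintro h v (⟨a, b, hY, rfl⟩ | ⟨a, b, c, d, hZ, rfl⟩)
    · have hab : a = b := by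
        by_contra hab
        exact hY (by simp [monoPot, hab])
      subst hab
      simp [weight4, chi_apply]
    · by_cases h1 : (a, b, c, d) ∈ T
      · exact h (a, b, c, d) h1
      by_cases h2 : (c, d, a, b) ∈ T
      · have := h (c, d, a, b) h2
        rwa [show weight4 a b c d = weight4 c d a b from add_comm _ _]
      by_cases h3 : (b, a, d, c) ∈ T
      · have h5 : chi (weight4 b a d c) x = 1 := h (b, a, d, c) h3
        rw [show weight4 a b c d = -weight4 b a d c by unfold weight4; abel, chi_neg, h5,
          inv_one]
      by_cases h4 : (d, c, b, a) ∈ T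
      · have h5 : chi (weight4 d c b a) x = 1 := h (d, c, b, a) h4
        rw [show weight4 a b c d = -weight4 d c b a by unfold weight4; abel, chi_neg, h5,
          inv_one]
      exact absurd (by simp [monoPot, h1, h2, h3, h4]) hZ

theorem torusRealizes_of_equiv (T : Finset (Fin 3 × Fin 3 × Fin 3 × Fin 3)) {H : Type} [Group H]
    [TopologicalSpace H] (h : Nonempty ((monoPot T).torusSymm ≃ₜ* H)) : TorusRealizes 3 H :=
  ⟨(monoPot T).autUnitary, monoPot_le_torus T, ⟨_, rfl⟩,
    h.map fun e => (torusSubgroupEquiv _ (monoPot_le_torus T)).symm.trans e⟩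

/-- Solutions of `w ^ n = 1`, `z = w ^ k`. -/
theorem equiv_circlePow {B : Subgroup (Circle × Circle)} (n : ℕ) (k : ℤ)
    (hB : ∀ x, x ∈ B ↔ x.2 ^ n = 1 ∧ x.1 = x.2 ^ k) : Nonempty (B ≃* circlePow n) := by
  refine ⟨{ toFun := fun x => ⟨(x : Circle × Circle).2, ((hB x).1 x.2).1⟩
            invFun := fun w => ⟨((w : Circle) ^ k, (w : Circle)), (hB _).2 ⟨w.2, rfl⟩⟩
            left_inv := ?_
            right_inv := fun w => rfl
            map_mul' := fun x y => rfl }⟩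
  rintro ⟨x, hx⟩
  apply Subtype.ext
  exact Prod.ext ((hB x).1 hx).2.symm rfl

theorem equiv_cyc {B : Subgroup (Circle × Circle)} (n : ℕ) [NeZero n] (k : ℤ)
    (hB : ∀ x, x ∈ B ↔ x.2 ^ n = 1 ∧ x.1 = x.2 ^ k) : Nonempty (B ≃ₜ* Cyc n) := by
  obtain ⟨e⟩ := equiv_circlePow n k hB
  obtain ⟨f⟩ := circlePow_equiv_cyc n
  have : Finite B := Finite.of_equiv _ e.symm.toEquiv
  exact ⟨discreteEquiv (e.trans f)⟩

/-- Solutions of `z ^ 2 = w ^ 2 = 1`. -/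
theorem equiv_cyc_prod {B : Subgroup (Circle × Circle)}
    (hB : ∀ x, x ∈ B ↔ x.1 ^ 2 = 1 ∧ x.2 ^ 2 = 1) : Nonempty (B ≃ₜ* (Cyc 2 × Cyc 2)) := by
  obtain ⟨f⟩ := circlePow_equiv_cyc 2
  let e : B ≃* circlePow 2 × circlePow 2 :=
    { toFun := fun x => (⟨(x : Circle × Circle).1, ((hB x).1 x.2).1⟩,
        ⟨(x : Circle × Circle).2, ((hB x).1 x.2).2⟩)
      invFun := fun w => ⟨((w.1 : Circle), (w.2 : Circle)), (hB _).2 ⟨w.1.2, w.2.2⟩⟩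
      left_inv := fun _ => rfl
      right_inv := fun _ => rfl
      map_mul' := fun _ _ => rfl }
  have : Finite B := Finite.of_equiv _ e.symm.toEquiv
  exact ⟨discreteEquiv (e.trans (f.prodCongr f))⟩

/-- The weights are (1, 0) and (0, 2). -/
theorem mem_torusSymm_Z2 (x : Circle × Circle) :
    x ∈ (monoPot {(0,0,0,1), (1,2,1,2)}).torusSymm ↔ x.2 ^ 2 = 1 ∧ x.1 = x.2 ^ (0 : ℤ) := by
  rw [mem_monoPot_torusSymm]
  simp only [Finset.mem_insert, Finset.mem_singleton, forall_eq_or_imp, forall_eq]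
  simp [weight4, wt, chi_apply, one_add_one_eq_two]
  tauto

/-- The weights are (1, -1) and (2, 1), of determinant 3. -/
theorem mem_torusSymm_Z3 (x : Circle × Circle) :
    x ∈ (monoPot {(0,1,2,1), (0,1,0,2)}).torusSymm ↔ x.2 ^ 3 = 1 ∧ x.1 = x.2 ^ (1 : ℤ) := by
  rw [mem_monoPot_torusSymm]
  simp only [Finset.mem_insert, Finset.mem_singleton, forall_eq_or_imp, forall_eq]
  simp [weight4, wt, chi_apply, one_add_one_eq_two, mul_inv_eq_one]
  constructor
  · rintro ⟨h, h'⟩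
    rw [h] at h'
    exact ⟨by rw [pow_succ]; exact h', h⟩
  · rintro ⟨h, h'⟩
    refine ⟨h', ?_⟩
    rw [h', ← pow_succ]; exact h

/-- The weights are (2, 0) and (1, 2), of determinant 4. The second is primitive, which makes the
kernel cyclic. -/
theorem mem_torusSymm_Z4 (x : Circle × Circle) :
    x ∈ (monoPot {(0,1,0,1), (0,2,1,2)}).torusSymm ↔ x.2 ^ 4 = 1 ∧ x.1 = x.2 ^ (-2 : ℤ) := by
  rw [mem_monoPot_torusSymm]
  simp only [Finset.mem_insert, Finset.mem_singleton, forall_eq_or_imp, forall_eq]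
  simp [weight4, wt, chi_apply, one_add_one_eq_two, mul_eq_one_iff_eq_inv]
  intro h'
  rw [h', inv_pow, inv_eq_one, ← pow_mul]

theorem mem_torusSymm_Z2Z2 (x : Circle × Circle) :
    x ∈ (monoPot {(0,1,0,1), (1,2,1,2)}).torusSymm ↔ x.1 ^ 2 = 1 ∧ x.2 ^ 2 = 1 := by
  rw [mem_monoPot_torusSymm]
  simp only [Finset.mem_insert, Finset.mem_singleton, forall_eq_or_imp, forall_eq]
  simp [weight4, wt, chi_apply, one_add_one_eq_two]

theorem torusRealizes_all :
    TorusRealizes 3 (Cyc 2) ∧ TorusRealizes 3 (Cyc 3) ∧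
    TorusRealizes 3 (Cyc 4) ∧ TorusRealizes 3 (Cyc 2 × Cyc 2) ∧
    TorusRealizes 3 Circle ∧ TorusRealizes 3 (Circle × Cyc 2) ∧
    TorusRealizes 3 (Circle × Circle) := by
  refine ⟨torusRealizes_of_equiv _ (equiv_cyc _ _ mem_torusSymm_Z2),
    torusRealizes_of_equiv _ (equiv_cyc _ _ mem_torusSymm_Z3),
    torusRealizes_of_equiv _ (equiv_cyc _ _ mem_torusSymm_Z4),
    torusRealizes_of_equiv _ (equiv_cyc_prod mem_torusSymm_Z2Z2),
    torusRealizes_of_equiv {(0,0,0,1)} (equiv_circle_of_mem_iff (p := (1,0)) (q := (0,1)) rfl ?_),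
    torusRealizes_of_equiv {(0,1,0,1)}
      (equiv_circle_prod_of_mem_iff (p := (1,0)) (q := (0,1)) rfl ?_),
    torusRealizes_of_equiv ∅ (equiv_torus ?_)⟩
  · intro x
    rw [mem_monoPot_torusSymm]
    simp [weight4, wt, chi_apply]
  · intro x
    rw [mem_monoPot_torusSymm]
    simp [weight4, wt, chi_apply, one_add_one_eq_two]
  · intro x
    rw [mem_monoPot_torusSymm]
    simp

/-! ### Abelian groups with antiunitary elements -/

theorem hasType_congr {A : Subgroup (Repar 3)} {H H' : Type} [Group H] [Group H']
    {p : H →* Cyc 2} {p' : H' →* Cyc 2} (h : HasType A p) (e : H ≃* H')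
    (hp : ∀ x, p' (e x) = p x) : HasType A p' := by
  obtain ⟨f, hf⟩ := h
  exact ⟨f.trans e, fun a => by rw [MulEquiv.trans_apply, hp, hf]⟩

theorem hasType_comm {A : Subgroup (Repar 3)} {H : Type} [CommGroup H] {p : H →* Cyc 2}
    (h : HasType A p) : ∀ a ∈ A, ∀ b ∈ A, a * b = b * a := by
  obtain ⟨f, -⟩ := h
  intro a ha b hb
  have : (⟨a, ha⟩ * ⟨b, hb⟩ : A) = ⟨b, hb⟩ * ⟨a, ha⟩ := by
    apply f.injective
    rw [map_mul, map_mul, mul_comm]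
  exact congrArg Subtype.val this

theorem cyc_two_mul_of_ne {a b : Cyc 2} (ha : a ≠ 1) (hb : b ≠ 1) : a * b = 1 := by
  revert a b; decide

theorem cyc_two_eq_of_ne {a b : Cyc 2} (ha : a ≠ 1) (hb : b ≠ 1) : a = b := by
  revert a b; decide

/-- The unitary elements of a subgroup of `G`. -/
def unitaryPart (A : Subgroup (Repar 3)) : Subgroup A :=
  (SemidirectProduct.rightHom.comp A.subtype).ker

theorem mem_unitaryPart {A : Subgroup (Repar 3)} {a : A} :
    a ∈ unitaryPart A ↔ (a : Repar 3).right = 1 := Iff.rfl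

/-- A group of exponent two is abelian, and the involution `Θ` splits the projection to ℤ₂, so the
group is the product of its unitary part and `⟨Θ⟩`. -/
theorem hasType_snd_of_sq {A : Subgroup (Repar 3)} (hsq : ∀ a ∈ A, a * a = 1)
    {Θ : Repar 3} (hΘ : Θ ∈ A) (hΘa : IsAntiunitary Θ) {H : Type} [Group H]
    (e : unitaryPart A ≃* H) : HasType A (MonoidHom.snd H (Cyc 2)) := by
  have hsq' : ∀ a : A, a * a = 1 := fun a => Subtype.ext (hsq a a.2)
  have hcomm : ∀ a b : A, a * b = b * a := by
    intro a b
    have h := hsq' (a * b)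
    calc a * b = a * (a * b * (a * b)) * b := by rw [h, mul_one]
      _ = (a * a) * (b * a) * (b * b) := by simp only [mul_assoc]
      _ = b * a := by rw [hsq', hsq', one_mul, mul_one]
  let s : Cyc 2 →* A :=
    { toFun := fun ε => if ε = 1 then 1 else ⟨Θ, hΘ⟩
      map_one' := by simp
      map_mul' := fun a b => by
        by_cases ha : a = 1
        · simp [ha]
        · by_cases hb : b = 1
          · simp [hb]
          · simp [ha, hb, cyc_two_mul_of_ne ha hb, hsq'] }
  have hs : ∀ ε, (s ε : Repar 3).right = ε := by
    intro ε
    by_cases h : ε = 1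
    · simp [s, h]
    · simp only [s, MonoidHom.coe_mk, OneHom.coe_mk, h, if_false]
      exact cyc_two_eq_of_ne hΘa h
  let f : H × Cyc 2 →* A := MonoidHom.noncommCoprod
    ((unitaryPart A).subtype.comp e.symm.toMonoidHom) s (fun _ _ => hcomm _ _)
  have hf : ∀ x, f x = (e.symm x.1 : A) * s x.2 := fun x => rfl
  have hfr : ∀ x, (f x : Repar 3).right = x.2 := by
    intro x
    rw [hf, Subgroup.coe_mul, SemidirectProduct.mul_right, hs,
      mem_unitaryPart.1 (e.symm x.1).2, one_mul]
  have hbij : Function.Bijective f := by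
    constructor
    · rw [injective_iff_map_eq_one]
      intro x hx
      have h2 : x.2 = 1 := by rw [← hfr, hx]; rfl
      have h1 : e.symm x.1 = 1 := by
        apply Subtype.ext
        have := hf x
        rw [hx, h2, map_one, mul_one] at this
        exact this.symm
      exact Prod.ext (by simpa using h1) h2
    · intro a
      have hk : a * (s (a : Repar 3).right)⁻¹ ∈ unitaryPart A := by
        rw [mem_unitaryPart, Subgroup.coe_mul, SemidirectProduct.mul_right, Subgroup.coe_inv,
          SemidirectProduct.inv_right, hs, mul_inv_cancel]
      refine ⟨(e ⟨_, hk⟩, (a : Repar 3).right), ?_⟩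
      rw [hf]
      simp
  refine ⟨(MulEquiv.ofBijective f hbij).symm, fun a => ?_⟩
  obtain ⟨x, rfl⟩ := (MulEquiv.ofBijective f hbij).surjective a
  rw [MulEquiv.symm_apply_apply]
  exact (hfr x).symm

/-- Over the field with two elements, `h` says that no three vectors are independent; the dimension
is then at most two. -/
theorem card_le_four_of_sq {K : Type*} [Group K] (hsq : ∀ a : K, a * a = 1)
    (h : ∀ a b c : K, a = 1 ∨ b = 1 ∨ c = 1 ∨ a * b = 1 ∨ a * c = 1 ∨ b * c = 1 ∨ a * b * c = 1) :
    Finite K ∧ Nat.card K ≤ 4 := by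
  classical
  have hinv : ∀ a b : K, a * b = 1 → b = a := fun a b hab =>
    (eq_inv_of_mul_eq_one_right hab).trans (eq_inv_of_mul_eq_one_right (hsq a)).symm
  suffices ∃ s : Finset K, s.card ≤ 4 ∧ ∀ x, x ∈ s by
    obtain ⟨s, hs, hx⟩ := this
    have : Fintype K := ⟨s, hx⟩
    refine ⟨inferInstance, ?_⟩
    rw [Nat.card_eq_fintype_card]
    exact (Finset.card_le_card (fun x _ => hx x)).trans hs
  by_cases h1 : ∃ a b : K, a ≠ 1 ∧ b ≠ 1 ∧ a * b ≠ 1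
  · obtain ⟨a, b, ha, hb, hab⟩ := h1
    refine ⟨{1, a, b, a * b}, Finset.card_le_four, fun c => ?_⟩
    simp only [Finset.mem_insert, Finset.mem_singleton]
    rcases h a b c with h | h | h | h | h | h | h
    · exact absurd h ha
    · exact absurd h hb
    · exact Or.inl h
    · exact absurd h hab
    · exact Or.inr (Or.inl (hinv _ _ h))
    · exact Or.inr (Or.inr (Or.inl (hinv _ _ h)))
    · exact Or.inr (Or.inr (Or.inr (hinv _ _ h)))
  · push Not at h1
    by_cases h2 : ∃ a : K, a ≠ 1
    · obtain ⟨a, ha⟩ := h2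
      refine ⟨{1, a}, Finset.card_le_two.trans (by norm_num), fun c => ?_⟩
      simp only [Finset.mem_insert, Finset.mem_singleton]
      by_cases hc : c = 1
      · exact Or.inl hc
      · exact Or.inr (hinv _ _ (h1 a c ha hc))
    · push Not at h2
      exact ⟨{1}, by simp, fun c => by simp [h2 c]⟩

theorem card_ne_three_of_sq {K : Type*} [Group K] (hsq : ∀ a : K, a * a = 1) :
    Nat.card K ≠ 3 := by
  intro h
  obtain ⟨e⟩ := equiv_of_card_prime Nat.prime_three h
  have h1 := hsq (e.symm (Multiplicative.ofAdd 1))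
  rw [← map_mul, map_eq_one_iff _ e.symm.injective] at h1
  revert h1; decide

theorem hasType_of_sq {A : Subgroup (Repar 3)} (hsq : ∀ a ∈ A, a * a = 1)
    {Θ : Repar 3} (hΘ : Θ ∈ A) (hΘa : IsAntiunitary Θ)
    (h : ∀ a ∈ A, ∀ b ∈ A, ∀ c ∈ A, a.right = 1 → b.right = 1 → c.right = 1 →
      a = 1 ∨ b = 1 ∨ c = 1 ∨ a * b = 1 ∨ a * c = 1 ∨ b * c = 1 ∨ a * b * c = 1) :
    HasType A typeZ2 ∨ HasType A typeZ2Z2 ∨ HasType A typeZ2Z2Z2 := by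
  have hsq' : ∀ a : unitaryPart A, a * a = 1 := fun a => Subtype.ext (Subtype.ext (hsq a a.1.2))
  obtain ⟨hfin, hcard⟩ := card_le_four_of_sq hsq' (fun a b c => by
    have := h a a.1.2 b b.1.2 c c.1.2 a.2 b.2 c.2
    simpa only [Subtype.ext_iff, Subgroup.coe_mul, Subgroup.coe_one] using this)
  have hpos : 0 < Nat.card (unitaryPart A) := Nat.card_pos
  have h3 := card_ne_three_of_sq hsq'
  obtain h1 | h1 | h1 : Nat.card (unitaryPart A) = 1 ∨ Nat.card (unitaryPart A) = 2 ∨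
    Nat.card (unitaryPart A) = 4 := by omega
  · left
    have hsub : Subsingleton (unitaryPart A) := (Nat.card_eq_one_iff_unique.1 h1).1
    have e : unitaryPart A ≃* Unit :=
      { toFun := fun _ => 1
        invFun := fun _ => 1
        left_inv := fun _ => Subsingleton.elim _ _
        right_inv := fun _ => rfl
        map_mul' := fun _ _ => rfl }
    exact hasType_congr (hasType_snd_of_sq hsq hΘ hΘa e) MulEquiv.uniqueProd (fun _ => rfl)
  · right; left
    obtain ⟨e⟩ := equiv_of_card_prime Nat.prime_two h1
    exact hasType_snd_of_sq hsq hΘ hΘa e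
  · right; right
    have := isKleinFour_of_card h1 (fun a => by rw [sq, hsq'])
    obtain ⟨e⟩ := IsKleinFour.nonempty_mulEquiv (G₁ := unitaryPart A) (G₂ := Cyc 2 × Cyc 2)
    exact hasType_congr (hasType_snd_of_sq hsq hΘ hΘa e) MulEquiv.prodAssoc (fun _ => rfl)

/-- The unitary part is `{1, Θ²}` and the antiunitary elements form one coset of it, so `Θ`
generates the group and has order four. -/
theorem hasType_Z4 {A : Subgroup (Repar 3)} {Θ : Repar 3} (hΘ : Θ ∈ A) (hΘa : IsAntiunitary Θ)
    (hΘ2 : Θ * Θ ≠ 1) (h : ∀ g ∈ A, g.right = 1 → g = 1 ∨ g = Θ * Θ) : HasType A typeZ4 := by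
  have hr : (Θ * Θ).right = 1 := cyc_two_mul_of_ne hΘa hΘa
  have hΘ4 : Θ * Θ * (Θ * Θ) = 1 := by
    rcases h _ (A.mul_mem (A.mul_mem hΘ hΘ) (A.mul_mem hΘ hΘ))
      (by rw [SemidirectProduct.mul_right, hr, one_mul]) with h1 | h1
    · exact h1
    · exact absurd (mul_eq_left.1 h1) hΘ2
  let t : A := ⟨Θ, hΘ⟩
  have ht4 : t ^ 4 = 1 := Subtype.ext (by
    rw [Subgroup.coe_pow, Subgroup.coe_one, ← hΘ4]
    change Θ ^ 4 = _
    simp only [pow_succ, pow_zero, one_mul, mul_assoc])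
  have ht2 : t ^ 2 ≠ 1 := fun h0 => hΘ2 (by
    have := congrArg Subtype.val h0
    rw [sq] at this
    exact this)
  have hord : orderOf t = 4 := orderOf_eq_prime_pow (p := 2) (n := 1) (by simpa using ht2)
    (by simpa using ht4)
  have hgen : ∀ a : A, a ∈ Subgroup.zpowers t := by
    intro a
    have unit : ∀ b : A, (b : Repar 3).right = 1 → b ∈ Subgroup.zpowers t := by
      intro b hb
      rcases h b b.2 hb with h1 | h1
      · rw [show b = 1 from Subtype.ext h1]; exact one_mem _
      · rw [show b = t * t from Subtype.ext h1]
        exact mul_mem (Subgroup.mem_zpowers t) (Subgroup.mem_zpowers t)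
    by_cases ha : (a : Repar 3).right = 1
    · exact unit a ha
    · have h1 := unit (t * a) (cyc_two_mul_of_ne hΘa ha)
      have h2 := mul_mem (inv_mem (Subgroup.mem_zpowers t)) h1
      rwa [inv_mul_cancel_left] at h2
  have hcyc : IsCyclic A := ⟨t, hgen⟩
  have hcard : Nat.card A = 4 := by
    rw [← hord]; exact (orderOf_eq_card_of_forall_mem_zpowers hgen).symm
  let e : A ≃* Cyc 4 := mulEquivOfCyclicCardEq (by rw [hcard, card_cyc])
  have het : typeZ4 (e t) ≠ 1 := by
    have h1 : e t ^ 2 ≠ 1 := by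
      rw [← map_pow]
      exact fun h0 => ht2 ((map_eq_one_iff _ e.injective).1 h0)
    have key : ∀ z : Cyc 4, z ^ 2 ≠ 1 → typeZ4 z ≠ 1 := by decide
    exact key _ h1
  refine ⟨e, fun a => ?_⟩
  obtain ⟨k, rfl⟩ := Subgroup.mem_zpowers_iff.1 (hgen a)
  have h1 : typeZ4 (e t) = Θ.right := cyc_two_eq_of_ne het hΘa
  rw [map_zpow, map_zpow, h1]
  exact (map_zpow (SemidirectProduct.rightHom.comp A.subtype) t k).symm

/-! ### Realizations of the elementary abelian types -/

/-- The generator of `ℤ₂`. -/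
abbrev cyc2gen : Cyc 2 := Multiplicative.ofAdd 1

theorem cyc2gen_ne_one : cyc2gen ≠ 1 := by decide

theorem monoMat_one_one : monoMat (fun _ : Fin 3 => (1 : ℂ)) 1 = 1 := by
  ext a b
  simp [monoMat, Matrix.one_apply, eq_comm]

theorem monoPot_inv_conj (T : Finset (Fin 3 × Fin 3 × Fin 3 × Fin 3)) :
    (monoPot T).Inv 1 cyc2gen := by
  rw [← monoMat_one_one, inv_monoMat_conj_iff _ _ _ cyc2gen_ne_one]
  simp only [map_one, one_mul, Equiv.Perm.coe_one, id_eq]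
  constructor
  · intro a b
    by_cases h : a = b
    · subst h; rfl
    · simp [monoPot, h, Ne.symm h]
  · intro a b c d
    simp only [monoPot]
    congr 1; omega

theorem twistU_torusU {ε : Cyc 2} {x : Circle × Circle} (hx : x * x = 1) :
    twistU ε (torusU x) = torusU x := by
  by_cases hε : ε = 1
  · simp [twistU, hε]
  · simp only [twistU, hε, if_false]
    apply Subtype.ext
    ext a b
    change conj ((torusU x : Matrix (Fin 3) (Fin 3) ℂ) a b) = _
    rw [torusU_apply]
    by_cases hab : b = a
    · rw [if_pos hab, circle_conj, ← map_inv, ← eq_inv_of_mul_eq_one_right hx]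
    · rw [if_neg hab, map_zero]

/-- The coefficients are real, so `J` itself is a symmetry. Torus elements of square 1 have real
entries and commute with `J`, which gives a direct product. -/
theorem monoPot_hasType {T : Finset (Fin 3 × Fin 3 × Fin 3 × Fin 3)}
    (hsq : ∀ x ∈ (monoPot T).torusSymm, x * x = 1) :
    HasType (monoPot T).aut (MonoidHom.snd (monoPot T).torusSymm (Cyc 2)) := by
  have hJ : rep 1 cyc2gen ∈ (monoPot T).aut := (rep_mem_aut _ _ _).2 (monoPot_inv_conj T)
  have hmem : ∀ (x : Circle × Circle) (ε : Cyc 2), x ∈ (monoPot T).torusSymm →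
      rep (torusU x) ε ∈ (monoPot T).aut := by
    intro x ε hx
    have h1 : rep (torusU x) 1 ∈ (monoPot T).aut := hx
    rcases cyc_two_cases ε with rfl | rfl
    · exact h1
    · have := mul_mem h1 hJ
      rw [rep_mul] at this
      simpa [twistU] using this
  let f : (monoPot T).torusSymm × Cyc 2 →* (monoPot T).aut :=
    { toFun := fun y => ⟨rep (torusU y.1) y.2, hmem _ _ y.1.2⟩
      map_one' := by
        apply Subtype.ext
        simp [rep_one]
      map_mul' := fun y z => by
        apply Subtype.ext
        simp only [Subgroup.coe_mul, Prod.fst_mul, Prod.snd_mul, map_mul, rep_mul]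
        rw [twistU_torusU (hsq _ z.1.2)] }
  have hbij : Function.Bijective f := by
    constructor
    · intro y z hyz
      have h1 : rep (torusU y.1) y.2 = rep (torusU z.1) z.2 := congrArg Subtype.val hyz
      have h2 : torusHom y.1 = torusHom z.1 := congrArg SemidirectProduct.left h1
      exact Prod.ext (Subtype.ext (torusHom_injective h2)) (congrArg SemidirectProduct.right h1)
    · rintro ⟨g, hg⟩
      obtain ⟨M, hM⟩ := exists_rep g
      have h1 : rep M 1 ∈ (monoPot T).aut := by
        rcases cyc_two_cases g.right with h | h
        · rw [h] at hM
          rwa [hM]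
        · have := mul_mem hg hJ
          rw [← hM, h, rep_mul, twistU_one, mul_one] at this
          exact this
      obtain ⟨x, hx⟩ := exists_torusU (monoPot_isDiag ((rep_mem_aut _ _ _).1 h1))
      have hx' : x ∈ (monoPot T).torusSymm := by
        change torusHom x ∈ (monoPot T).autUnitary
        rw [hx]; exact h1
      refine ⟨(⟨x, hx'⟩, g.right), ?_⟩
      apply Subtype.ext
      change rep (torusU x) g.right = g
      conv_rhs => rw [← hM]
      exact SemidirectProduct.ext hx rfl
  refine ⟨(MulEquiv.ofBijective f hbij).symm, fun a => ?_⟩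
  obtain ⟨x, rfl⟩ := (MulEquiv.ofBijective f hbij).surjective a
  rw [MulEquiv.symm_apply_apply]
  rfl

theorem monoPot_isAbelianRealizableCP {T : Finset (Fin 3 × Fin 3 × Fin 3 × Fin 3)}
    {H : Type} [CommGroup H] {p : H →* Cyc 2} (h : HasType (monoPot T).aut p) :
    IsAbelianRealizableCP (monoPot T).aut :=
  ⟨hasType_comm h, ⟨_, rfl⟩, rep 1 cyc2gen, (rep_mem_aut _ _ _).2 (monoPot_inv_conj T),
    cyc2gen_ne_one⟩

theorem exists_typeZ2 : ∃ A : Subgroup (Repar 3), IsAbelianRealizableCP A ∧ HasType A typeZ2 := by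
  -- The weights (1, 0) and (0, 1) generate the weight lattice, so no torus symmetry remains.
  have hm : ∀ x, x ∈ (monoPot {(0,0,0,1), (1,1,1,2)}).torusSymm ↔ x = 1 := by
    intro x
    rw [mem_monoPot_torusSymm]
    simp only [Finset.mem_insert, Finset.mem_singleton, forall_eq_or_imp, forall_eq]
    simp [weight4, wt, chi_apply, Prod.ext_iff]
  have h1 := monoPot_hasType (T := {(0,0,0,1), (1,1,1,2)})
    (fun x hx => by rw [(hm x).1 hx, one_mul])
  have hsub : Unique (monoPot {(0,0,0,1), (1,1,1,2)}).torusSymm :=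
    { default := 1
      uniq := fun x => Subtype.ext ((hm x).1 x.2) }
  have h2 : HasType (monoPot {(0,0,0,1), (1,1,1,2)}).aut typeZ2 :=
    hasType_congr h1 MulEquiv.uniqueProd (fun _ => rfl)
  exact ⟨_, monoPot_isAbelianRealizableCP h2, h2⟩

theorem exists_typeZ2Z2 :
    ∃ A : Subgroup (Repar 3), IsAbelianRealizableCP A ∧ HasType A typeZ2Z2 := by
  have h1 := monoPot_hasType (T := {(0,0,0,1), (1,2,1,2)}) (fun x hx => by
    obtain ⟨h, h'⟩ := (mem_torusSymm_Z2 x).1 hx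
    exact Prod.ext (by simp [h']) (by rw [Prod.snd_mul, ← sq, h]; rfl))
  obtain ⟨e⟩ := equiv_cyc 2 _ mem_torusSymm_Z2
  have h2 : HasType (monoPot {(0,0,0,1), (1,2,1,2)}).aut typeZ2Z2 :=
    hasType_congr h1 (e.toMulEquiv.prodCongr (MulEquiv.refl _)) (fun _ => rfl)
  exact ⟨_, monoPot_isAbelianRealizableCP h2, h2⟩

theorem exists_typeZ2Z2Z2 :
    ∃ A : Subgroup (Repar 3), IsAbelianRealizableCP A ∧ HasType A typeZ2Z2Z2 := by
  have h1 := monoPot_hasType (T := {(0,1,0,1), (1,2,1,2)}) (fun x hx => by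
    obtain ⟨h, h'⟩ := (mem_torusSymm_Z2Z2 x).1 hx
    exact Prod.ext (by rw [Prod.fst_mul, ← sq, h]; rfl) (by rw [Prod.snd_mul, ← sq, h']; rfl))
  obtain ⟨e⟩ := equiv_cyc_prod mem_torusSymm_Z2Z2
  have h2 : HasType (monoPot {(0,1,0,1), (1,2,1,2)}).aut typeZ2Z2Z2 :=
    hasType_congr h1 ((e.toMulEquiv.prodCongr (MulEquiv.refl _)).trans MulEquiv.prodAssoc)
      (fun _ => rfl)
  exact ⟨_, monoPot_isAbelianRealizableCP h2, h2⟩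

/-! ### Realization of `ℤ₄*` -/

/-- The quartic coefficients of a potential with symmetry group `ℤ₄*`. -/
def quarticZ4 : Fin 3 → Fin 3 → Fin 3 → Fin 3 → ℂ
  | 0, 0, 1, 1 => 2
  | 1, 1, 0, 0 => 2
  | 0, 1, 0, 1 => 1
  | 1, 0, 1, 0 => 1
  | 2, 0, 2, 0 => ⟨1, 2⟩
  | 0, 2, 0, 2 => ⟨1, -2⟩
  | 2, 1, 2, 1 => ⟨1, -2⟩
  | 1, 2, 1, 2 => ⟨1, 2⟩
  | 2, 0, 2, 1 => Complex.I
  | 2, 1, 2, 0 => Complex.I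
  | 0, 2, 1, 2 => -Complex.I
  | 1, 2, 0, 2 => -Complex.I
  | _, _, _, _ => 0

/-- A potential with symmetry group `ℤ₄*`. -/
def potZ4 : Potential 3 where
  Y a b := if a = 2 ∧ b = 2 then 1 else 0
  Z := quarticZ4
  Y_herm a b := by
    by_cases h : a = 2 ∧ b = 2
    · simp [h]
    · have : ¬ (b = 2 ∧ a = 2) := fun h' => h ⟨h'.2, h'.1⟩
      simp [h, this]
  Z_symm a b c d := by
    fin_cases a <;> fin_cases b <;> fin_cases c <;> fin_cases d <;> rfl
  Z_herm a b c d := by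
    fin_cases a <;> fin_cases b <;> fin_cases c <;> fin_cases d <;>
      first
      | exact map_zero _
      | (apply Complex.ext <;> simp [quarticZ4])

/-- The antiunitary generator `φ₁ ↦ -φ₂^*`, `φ₂ ↦ φ₁^*`, `φ₃ ↦ φ₃^*`. -/
def genZ4 : U3 := monoU ![-1, 1, 1] (Equiv.swap 0 1)

theorem potZ4_inv_genZ4 : potZ4.Inv genZ4 cyc2gen := by
  refine (inv_monoMat_conj_iff potZ4 _ _ cyc2gen_ne_one).2 ⟨?_, ?_⟩
  · intro a b
    fin_cases a <;> fin_cases b <;> simp [potZ4, Equiv.swap_apply_def]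
  · intro a b c d
    have s0 : Equiv.swap (0 : Fin 3) 1 0 = 1 := by decide
    have s1 : Equiv.swap (0 : Fin 3) 1 1 = 0 := by decide
    have s2 : Equiv.swap (0 : Fin 3) 1 2 = 2 := by decide
    fin_cases a <;> fin_cases b <;> fin_cases c <;> fin_cases d <;>
      simp [potZ4, quarticZ4, s0, s1, s2]

theorem monoMat_entry_unit {M : U3} {m : Fin 3 → ℂ} {σ : Equiv.Perm (Fin 3)}
    (h : (M : Matrix (Fin 3) (Fin 3) ℂ) = monoMat m σ) (a : Fin 3) : conj (m a) * m a = 1 := by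
  have h1 := congrFun (congrFun (Matrix.mem_unitaryGroup_iff.1 M.2) a) a
  rw [h] at h1
  simp only [Matrix.mul_apply, Matrix.star_apply, monoMat, Matrix.of_apply, Matrix.one_apply_eq] at h1
  simp at h1
  rw [mul_comm]; exact h1

/-- A unitary matrix that is block diagonal and has a vanishing entry in its upper block is
monomial. -/
theorem block_monomial {M : U3} (h02 : (M : Matrix (Fin 3) (Fin 3) ℂ) 0 2 = 0)
    (h12 : (M : Matrix (Fin 3) (Fin 3) ℂ) 1 2 = 0) (h20 : (M : Matrix (Fin 3) (Fin 3) ℂ) 2 0 = 0)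
    (h21 : (M : Matrix (Fin 3) (Fin 3) ℂ) 2 1 = 0)
    (h : (M : Matrix (Fin 3) (Fin 3) ℂ) 0 0 = 0 ∨ (M : Matrix (Fin 3) (Fin 3) ℂ) 1 0 = 0) :
    ∃ m : Fin 3 → ℂ, (M : Matrix (Fin 3) (Fin 3) ℂ) = monoMat m 1 ∨
      (M : Matrix (Fin 3) (Fin 3) ℂ) = monoMat m (Equiv.swap 0 1) := by
  set A : Matrix (Fin 3) (Fin 3) ℂ := M.1 with hA
  have hrow : ∀ i j, ∑ k, A i k * conj (A j k) = if i = j then 1 else 0 := by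
    intro i j
    have := congrFun (congrFun (Matrix.mem_unitaryGroup_iff.1 M.2) i) j
    simpa [Matrix.mul_apply, Matrix.star_apply, Matrix.one_apply] using this
  have hcol : ∀ i j, ∑ k, conj (A k i) * A k j = if i = j then 1 else 0 := by
    intro i j
    have := congrFun (congrFun (Matrix.mem_unitaryGroup_iff'.1 M.2) i) j
    simpa [Matrix.mul_apply, Matrix.star_apply, Matrix.one_apply] using this
  have c01 := hcol 0 1
  have c00 := hcol 0 0
  simp only [Fin.sum_univ_three, h20, h21] at c01 c00
  simp at c01 c00
  have s0 : Equiv.swap (0 : Fin 3) 1 0 = 1 := by decide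
  have s1 : Equiv.swap (0 : Fin 3) 1 1 = 0 := by decide
  have s2 : Equiv.swap (0 : Fin 3) 1 2 = 2 := by decide
  rcases h with h | h
  · rw [h] at c01 c00
    simp at c01 c00
    have h10 : A 1 0 ≠ 0 := by intro h0; simp [h0] at c00
    have h11 : A 1 1 = 0 := c01.resolve_left h10
    refine ⟨![A 0 1, A 1 0, A 2 2], Or.inr ?_⟩
    ext i j
    fin_cases i <;> fin_cases j <;> simp [monoMat, h, h02, h12, h20, h21, h11, s0, s1, s2]
  · rw [h] at c01 c00
    simp at c01 c00
    have h00 : A 0 0 ≠ 0 := by intro h0; simp [h0] at c00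
    have h01 : A 0 1 = 0 := c01.resolve_left h00
    refine ⟨![A 0 0, A 1 1, A 2 2], Or.inl ?_⟩
    ext i j
    fin_cases i <;> fin_cases j <;> simp [monoMat, h, h02, h12, h20, h21, h01]

/-- The mass matrix is the projection to the third doublet, and `M` commutes with it. -/
theorem potZ4_block {M : U3} (h : potZ4.Inv M 1) :
    (M : Matrix (Fin 3) (Fin 3) ℂ) 0 2 = 0 ∧ (M : Matrix (Fin 3) (Fin 3) ℂ) 1 2 = 0 ∧
    (M : Matrix (Fin 3) (Fin 3) ℂ) 2 0 = 0 ∧ (M : Matrix (Fin 3) (Fin 3) ℂ) 2 1 = 0 := by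
  have h1 := fun i j => congrFun (congrFun (inv_commute_Y h) i) j
  simp only [Matrix.mul_apply, Fin.sum_univ_three, Matrix.of_apply, potZ4] at h1
  have e1 := h1 0 2
  have e2 := h1 1 2
  have e3 := h1 2 0
  have e4 := h1 2 1
  simp at e1 e2 e3 e4
  exact ⟨e1.symm, e2.symm, e3, e4⟩

/-- The potential vanishes at the first basis vector. At its image it equals `4|k|² + 2 Re k²`,
where `k` is the product of one entry with the conjugate of the other. This form is positive
definite in `k`, so `k = 0`. -/
theorem potZ4_column {M : U3} (h : potZ4.Inv M 1) :
    (M : Matrix (Fin 3) (Fin 3) ℂ) 0 0 = 0 ∨ (M : Matrix (Fin 3) (Fin 3) ℂ) 1 0 = 0 := by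
  obtain ⟨-, -, h20, -⟩ := potZ4_block h
  set A : Matrix (Fin 3) (Fin 3) ℂ := M.1 with hA
  let φ : Doublets 3 := Matrix.of fun a i => if a = 0 ∧ i = 0 then 1 else 0
  have h1 := h φ
  have hb : ∀ a b, bilin (A * conjPow 1 φ) a b = conj (A a 0) * A b 0 := by
    intro a b
    simp [bilin, conjPow, φ, Matrix.mul_apply, Fin.sum_univ_three]
  have hb' : ∀ a b, bilin φ a b = if a = 0 ∧ b = 0 then 1 else 0 := by
    intro a b
    by_cases ha : a = 0 <;> by_cases hb : b = 0 <;> simp [bilin, φ, ha, hb]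
  simp only [Potential.eval, hb, hb', Fin.sum_univ_three, potZ4, quarticZ4, h20] at h1
  simp at h1
  have h2 : 4 * (conj (A 0 0) * A 1 0 * (conj (A 1 0) * A 0 0)) +
      (conj (A 0 0) * A 1 0) ^ 2 + (conj (A 1 0) * A 0 0) ^ 2 = 0 := by
    linear_combination h1
  set k := conj (A 0 0) * A 1 0 with hk
  have hk' : conj (A 1 0) * A 0 0 = conj k := by rw [hk]; simp [mul_comm]
  rw [hk'] at h2
  have h3 := congrArg Complex.re h2
  simp [sq] at h3
  have hre : k.re = 0 := by nlinarith [sq_nonneg k.re, sq_nonneg k.im]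
  have him : k.im = 0 := by nlinarith [sq_nonneg k.re, sq_nonneg k.im]
  have h4 : k = 0 := Complex.ext hre him
  rw [hk] at h4
  simpa using h4

/-- By the two previous lemmas `M` is diagonal or exchanges the first two doublets. In the diagonal
case, with `p` and `q` the phases relative to the third doublet, the coefficients give `p² = 1` and
`p q = 1`. An exchange is ruled out by the coefficient 1 + 2i. -/
theorem potZ4_unitary {M : U3} (h : potZ4.Inv M 1) :
    ∃ μ p : ℂ, p ^ 2 = 1 ∧ (M : Matrix (Fin 3) (Fin 3) ℂ) = μ • Matrix.diagonal ![p, p, 1] := by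
  obtain ⟨h02, h12, h20, h21⟩ := potZ4_block h
  obtain ⟨m, hm | hm⟩ := block_monomial h02 h12 h20 h21 (potZ4_column h)
  · have hu := monoMat_entry_unit hm
    rw [hm, inv_monoMat_iff] at h
    have e1 := h.2 2 0 2 0
    have e2 := h.2 2 0 2 1
    simp [potZ4, quarticZ4] at e1 e2
    have hα : (⟨1, 2⟩ : ℂ) ≠ 0 := by
      intro h0; simpa using congrArg Complex.re h0
    have e1' := mul_right_cancel₀ hα (e1.trans (one_mul _).symm)
    set p := conj (m 2) * m 0 with hp
    set q := conj (m 2) * m 1 with hq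
    have hp2 : p ^ 2 = 1 := by rw [sq]; exact e1'
    have hpq : q = p := by linear_combination p * e2 - q * hp2
    have h0 : m 0 = m 2 * p := by rw [hp]; linear_combination (-m 0) * hu 2
    have h1 : m 1 = m 2 * p := by rw [← hpq, hq]; linear_combination (-m 1) * hu 2
    refine ⟨m 2, p, hp2, ?_⟩
    rw [hm]
    ext i j
    fin_cases i <;> fin_cases j <;> simp [monoMat, h0, h1]
  · exfalso
    have hu := monoMat_entry_unit hm
    rw [hm, inv_monoMat_iff] at h
    have e1 := h.2 2 0 2 0
    have e2 := h.2 2 0 2 1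
    have e3 := h.2 0 1 0 1
    have s0 : Equiv.swap (0 : Fin 3) 1 0 = 1 := by decide
    have s1 : Equiv.swap (0 : Fin 3) 1 1 = 0 := by decide
    have s2 : Equiv.swap (0 : Fin 3) 1 2 = 2 := by decide
    simp only [s0, s1, s2, potZ4, quarticZ4] at e1 e2 e3
    have e2' : conj (m 2) * m 0 * (conj (m 2) * m 1) = 1 := by
      apply mul_right_cancel₀ Complex.I_ne_zero
      rw [e2, one_mul]
    set p := conj (m 2) * m 0 with hp
    set q := conj (m 2) * m 1 with hq
    have hpp : conj p * p = 1 := by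
      rw [hp]; simp only [map_mul, Complex.conj_conj]
      linear_combination (conj (m 0) * m 0) * hu 2 + hu 0
    have hqp : q = conj p := by linear_combination conj p * e2' - q * hpp
    have h01 : conj (m 0) * m 1 = conj p ^ 2 := by
      rw [sq]
      nth_rewrite 2 [← hqp]
      rw [hp, hq]; simp only [map_mul, Complex.conj_conj]
      linear_combination (-(conj (m 0) * m 1)) * hu 2
    rw [h01, mul_one] at e3
    have hp4 : (p ^ 2) ^ 2 = 1 := by
      have := congrArg conj e3
      simp only [map_mul, map_pow, Complex.conj_conj, map_one] at this
      rw [sq (p ^ 2)]; exact this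
    -- Here `p² = ±1` would have to carry 1 + 2i to its conjugate, which is impossible because
    -- neither its real nor its imaginary part vanishes.
    rcases mul_self_eq_one_iff.1 ((sq _).symm.trans hp4) with h5 | h5
    · rw [← sq, h5] at e1
      have := congrArg Complex.im e1
      norm_num at this
    · rw [← sq, h5] at e1
      have := congrArg Complex.re e1
      norm_num at this

theorem exists_typeZ4 :
    ∃ A : Subgroup (Repar 3), IsAbelianRealizableCP A ∧ HasType A typeZ4 := by
  have hmem : rep genZ4 cyc2gen ∈ potZ4.aut := (rep_mem_aut _ _ _).2 potZ4_inv_genZ4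
  have hsq : rep genZ4 cyc2gen * rep genZ4 cyc2gen = rep (genZ4 * conjU genZ4) 1 := by
    rw [rep_mul, cyc_two_mul_of_ne cyc2gen_ne_one cyc2gen_ne_one]
    simp [twistU]
  have hg : ((genZ4 * conjU genZ4 : U3) : Matrix (Fin 3) (Fin 3) ℂ) =
      Matrix.diagonal ![-1, -1, 1] := by
    have s0 : Equiv.swap (0 : Fin 3) 1 0 = 1 := by decide
    have s1 : Equiv.swap (0 : Fin 3) 1 1 = 0 := by decide
    have s2 : Equiv.swap (0 : Fin 3) 1 2 = 2 := by decide
    ext i j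
    rw [Submonoid.coe_mul]
    change (monoMat _ _ * _ : Matrix (Fin 3) (Fin 3) ℂ) i j = _
    rw [monoMat_mul_apply]
    fin_cases i <;> fin_cases j <;> simp [conjU, genZ4, monoU, monoMat, s0, s1, s2]
  have h2 : HasType potZ4.aut typeZ4 := by
    refine hasType_Z4 hmem cyc2gen_ne_one ?_ ?_
    · rw [hsq, ← rep_one, Ne, rep_eq_iff]
      rintro ⟨-, c, hc⟩
      rw [hg] at hc
      have h0 := congrFun (congrFun hc 0) 0
      have h1 := congrFun (congrFun hc 2) 2
      simp at h0 h1
      rw [← h1] at h0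
      norm_num at h0
    · intro g hgA hr
      obtain ⟨M, hMg⟩ := exists_rep g
      rw [hr] at hMg
      rw [← hMg] at hgA ⊢
      obtain ⟨μ, p, hp, hM⟩ := potZ4_unitary ((rep_mem_aut _ _ _).1 hgA)
      have hμ : μ ≠ 0 := by
        rintro rfl
        have := norm_det_unitary M
        simp [hM] at this
      rcases mul_self_eq_one_iff.1 ((sq _).symm.trans hp) with rfl | rfl
      · left
        rw [← rep_one, rep_eq_iff]
        refine ⟨rfl, μ⁻¹, ?_⟩
        rw [hM, smul_smul, inv_mul_cancel₀ hμ, one_smul]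
        ext i j
        fin_cases i <;> fin_cases j <;> simp
      · right
        rw [hsq, rep_eq_iff]
        refine ⟨rfl, μ⁻¹, ?_⟩
        rw [hM, hg, smul_smul, inv_mul_cancel₀ hμ, one_smul]
  exact ⟨_, ⟨hasType_comm h2, ⟨_, rfl⟩, _, hmem, cyc2gen_ne_one⟩, h2⟩

/-! ### Change of basis -/

theorem rep_inv_one (s : U3) : (rep s 1)⁻¹ = rep s⁻¹ 1 := by
  rw [inv_eq_iff_mul_eq_one, rep_mul]
  simp [twistU, rep_one]

theorem mem_aut_pull (V : Potential 3) (s : U3) (g : Repar 3) :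
    g ∈ (V.pull s).aut ↔ rep s 1 * g * (rep s 1)⁻¹ ∈ V.aut := by
  obtain ⟨M, hM⟩ := exists_rep g
  rw [← hM, rep_inv_one, rep_mul, rep_mul, rep_mem_aut, inv_pull_iff, rep_mem_aut]
  simp [twistU]

theorem pull_comm {V : Potential 3} (h : ∀ a ∈ V.aut, ∀ b ∈ V.aut, a * b = b * a) (s : U3) :
    ∀ a ∈ (V.pull s).aut, ∀ b ∈ (V.pull s).aut, a * b = b * a := by
  intro a ha b hb
  rw [mem_aut_pull] at ha hb
  have h1 := h _ ha _ hb
  have h2 : rep s 1 * (a * b) * (rep s 1)⁻¹ = rep s 1 * (b * a) * (rep s 1)⁻¹ := by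
    simpa [mul_assoc] using h1
  simpa using h2

/-! ### Orders of diagonal symmetries -/

theorem circle_conj_eq_inv (z : Circle) : conj (z : ℂ) = (z : ℂ)⁻¹ := by
  rw [circle_conj, Circle.coe_inv]

theorem exists_circle_conj (z : ℂ) : ∃ u : Circle, (u : ℂ) * z = conj z := by
  by_cases hz : z = 0
  · exact ⟨1, by simp [hz]⟩
  · refine ⟨⟨conj z / z, mem_sphere_zero_iff_norm.2 ?_⟩, ?_⟩
    · rw [norm_div, RCLike.norm_conj, div_self (norm_ne_zero_iff.2 hz)]
    · exact div_mul_cancel₀ _ hz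

/-- The quartic monomials that are neutral under `diag(x, x⁻¹, 1)` for some `x` with `x² ≠ 1`. -/
theorem neutral_monomials : ∀ a b c d : Fin 3,
    (let w : Fin 3 → ℤ := ![1, -1, 0]
     (w b - w a + (w d - w c)).natAbs = 1 ∨ (w b - w a + (w d - w c)).natAbs = 2) ∨
    (a = b ∧ c = d) ∨ (a = d ∧ b = c) ∨
    (a, b, c, d) ∈ ({(0,2,1,2), (1,2,0,2), (2,0,2,1), (2,1,2,0)} :
      Finset (Fin 3 × Fin 3 × Fin 3 × Fin 3)) ∨
    (a, b, c, d) ∈ ({(0,1,2,1), (2,1,0,1), (1,0,1,2), (1,2,1,0)} :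
      Finset (Fin 3 × Fin 3 × Fin 3 × Fin 3)) ∨
    (a, b, c, d) ∈ ({(1,0,2,0), (2,0,1,0), (0,1,0,2), (0,2,0,1)} :
      Finset (Fin 3 × Fin 3 × Fin 3 × Fin 3)) ∨
    (a, b, c, d) ∈ ({(0,1,0,1), (1,0,1,0)} : Finset (Fin 3 × Fin 3 × Fin 3 × Fin 3)) := by
  decide +kernel

theorem circle_pow_of_zpow {x : Circle} {n : ℤ} {k : ℕ} (hn : n.natAbs = k) (h : x ^ n = 1) :
    x ^ k = 1 := hn ▸ circle_zpow_abs h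

/-- The coefficient conditions for the invariance under `φ_a ↦ d_a φ_a^*`. -/
theorem inv_diag_conj_of_coeff {V : Potential 3} {x : Circle} (hx : x ^ 2 ≠ 1)
    (ht : V.Inv (monoU ![x, x⁻¹, 1] 1) 1) (p q : Circle)
    (h1 : (p : ℂ)⁻¹ * (q : ℂ)⁻¹ * V.Z 0 2 1 2 = conj (V.Z 0 2 1 2))
    (h2 : (p : ℂ)⁻¹ * q * q * V.Z 0 1 2 1 = conj (V.Z 0 1 2 1))
    (h3 : (q : ℂ)⁻¹ * p * p * V.Z 1 0 2 0 = conj (V.Z 1 0 2 0))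
    (h4 : (p : ℂ)⁻¹ * q * ((p : ℂ)⁻¹ * q) * V.Z 0 1 0 1 = conj (V.Z 0 1 0 1)) :
    V.Inv (monoU ![p, q, 1] 1) cyc2gen := by
  set d : Fin 3 → Circle := ![p, q, 1] with hdef
  let w : Fin 3 → ℤ := ![1, -1, 0]
  have hx1 : x ^ 1 ≠ 1 := fun h => hx (by rw [pow_one] at h; rw [h, one_pow])
  have hm : ∀ a, (![x, x⁻¹, 1] : Fin 3 → Circle) a = x ^ w a := by
    intro a; fin_cases a <;> simp [w]
  obtain ⟨hY, hZ⟩ := (inv_monoMat_iff V (fun a => ((![x, x⁻¹, 1] : Fin 3 → Circle) a : ℂ)) 1).1 ht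
  simp only [hm, circle_conj, ← Circle.coe_mul, ← zpow_neg, ← zpow_add, Equiv.Perm.coe_one,
    id_eq] at hY hZ
  have key : ∀ (n : ℤ) (y : ℂ), ((x ^ n : Circle) : ℂ) * y = y → y ≠ 0 → x ^ n = 1 := by
    intro n y h hy
    rw [← Circle.coe_eq_one]
    exact mul_right_cancel₀ hy (h.trans (one_mul y).symm)
  have hd : ∀ a, conj (d a : ℂ) * d a = 1 := fun a => circle_conj_mul _
  -- The condition for one monomial. It is stable under exchanging the bilinears and under Hermitian
  -- conjugation, so one representative of each orbit suffices.
  let E : Fin 3 → Fin 3 → Fin 3 → Fin 3 → Prop := fun a b c e =>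
    conj (d a : ℂ) * d b * (conj (d c : ℂ) * d e) * V.Z a b c e = V.Z b a e c
  have Esymm : ∀ {a b c e}, E a b c e → E c e a b := by
    intro a b c e h
    simp only [E] at h ⊢
    rw [V.Z_symm c e, V.Z_symm e c, ← h]
    ring
  have Econj : ∀ {a b c e}, E a b c e → E b a e c := by
    intro a b c e h
    simp only [E] at h ⊢
    have := congrArg conj h
    simp only [map_mul, Complex.conj_conj, V.Z_herm] at this
    rw [← this]
    ring
  refine (inv_monoMat_conj_iff V (fun a => (d a : ℂ)) 1 cyc2gen_ne_one).2 ⟨?_, ?_⟩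
  · intro a b
    simp only [Equiv.Perm.coe_one, id_eq]
    by_cases hab : a = b
    · subst hab; rw [hd, one_mul]
    · have h0 : V.Y a b = 0 := by
        by_contra h0
        have h5 := key _ _ (hY a b) h0
        have h6 : (-w a + w b).natAbs = 1 ∨ (-w a + w b).natAbs = 2 := by
          clear h5 h0
          revert a b; decide
        rcases h6 with h6 | h6
        · exact hx1 (circle_pow_of_zpow h6 h5)
        · exact hx (circle_pow_of_zpow h6 h5)
      rw [← V.Y_herm a b, h0]; simp
  · intro a b c e
    change E a b c e
    have k1 : E 0 2 1 2 := by
      refine Eq.trans ?_ (h1.trans (V.Z_herm _ _ _ _))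
      simp only [hdef, Matrix.cons_val_zero, Matrix.cons_val_one, Matrix.cons_val,
        circle_conj_eq_inv, Circle.coe_one, mul_one]
    have k2 : E 0 1 2 1 := by
      refine Eq.trans ?_ (h2.trans (V.Z_herm _ _ _ _))
      simp only [hdef, Matrix.cons_val_zero, Matrix.cons_val_one, Matrix.cons_val,
        circle_conj_eq_inv, Circle.coe_one, map_one, one_mul]
    have k3 : E 1 0 2 0 := by
      refine Eq.trans ?_ (h3.trans (V.Z_herm _ _ _ _))
      simp only [hdef, Matrix.cons_val_zero, Matrix.cons_val_one, Matrix.cons_val,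
        circle_conj_eq_inv, Circle.coe_one, map_one, one_mul]
    have k4 : E 0 1 0 1 := by
      refine Eq.trans ?_ (h4.trans (V.Z_herm _ _ _ _))
      simp only [hdef, Matrix.cons_val_zero, Matrix.cons_val_one, circle_conj_eq_inv]
    rcases neutral_monomials a b c e with h | ⟨rfl, rfl⟩ | ⟨rfl, rfl⟩ | h | h | h | h
    · have h0 : V.Z a b c e = 0 := by
        by_contra h0
        have h5 := key _ _ (hZ a b c e) h0
        have h6 : (-w a + w b + (-w c + w e)).natAbs = 1 ∨
            (-w a + w b + (-w c + w e)).natAbs = 2 := by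
          have e : -w a + w b + (-w c + w e) = w b - w a + (w e - w c) := by ring
          rw [e]; exact h
        rcases h6 with h6 | h6
        · exact hx1 (circle_pow_of_zpow h6 h5)
        · exact hx (circle_pow_of_zpow h6 h5)
      simp only [E]
      rw [← V.Z_herm a b c e, h0]; simp
    · simp only [E]
      linear_combination (conj (d c : ℂ) * d c * V.Z a a c c) * hd a + V.Z a a c c * hd c
    · simp only [E]
      rw [V.Z_symm b a]
      linear_combination (conj (d b : ℂ) * d b * V.Z a b b a) * hd a + V.Z a b b a * hd b
    · simp only [Finset.mem_insert, Finset.mem_singleton, Prod.mk.injEq] at h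
      rcases h with ⟨rfl, rfl, rfl, rfl⟩ | ⟨rfl, rfl, rfl, rfl⟩ | ⟨rfl, rfl, rfl, rfl⟩ |
        ⟨rfl, rfl, rfl, rfl⟩
      · exact k1
      · exact Esymm k1
      · exact Econj k1
      · exact Econj (Esymm k1)
    · simp only [Finset.mem_insert, Finset.mem_singleton, Prod.mk.injEq] at h
      rcases h with ⟨rfl, rfl, rfl, rfl⟩ | ⟨rfl, rfl, rfl, rfl⟩ | ⟨rfl, rfl, rfl, rfl⟩ |
        ⟨rfl, rfl, rfl, rfl⟩
      · exact k2
      · exact Esymm k2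
      · exact Econj k2
      · exact Econj (Esymm k2)
    · simp only [Finset.mem_insert, Finset.mem_singleton, Prod.mk.injEq] at h
      rcases h with ⟨rfl, rfl, rfl, rfl⟩ | ⟨rfl, rfl, rfl, rfl⟩ | ⟨rfl, rfl, rfl, rfl⟩ |
        ⟨rfl, rfl, rfl, rfl⟩
      · exact k3
      · exact Esymm k3
      · exact Econj k3
      · exact Econj (Esymm k3)
    · simp only [Finset.mem_insert, Finset.mem_singleton, Prod.mk.injEq] at h
      rcases h with ⟨rfl, rfl, rfl, rfl⟩ | ⟨rfl, rfl, rfl, rfl⟩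
      · exact k4
      · exact Econj k4

/-- Under diag(x, x⁻¹, 1) only monomials of charge 0, ±3 and ±4 can survive, and charges 3 and 4 not
both, since `x ≠ 1`. Two free phases `p`, `q` can make the remaining coefficients compatible with
conjugation; when charge 3 survives, the given antiunitary symmetry supplies the missing relation.
-/
theorem exists_diag_conj_symmetry {V : Potential 3} {x a b : Circle} (hx : x ^ 2 ≠ 1)
    (ht : V.Inv (monoU ![x, x⁻¹, 1] 1) 1)
    (hΘ : V.Inv (monoU ![a, b, 1] (Equiv.swap 0 1)) cyc2gen) :
    ∃ p q : Circle, V.Inv (monoU ![p, q, 1] 1) cyc2gen := by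
  have hm : ∀ a, (![x, x⁻¹, 1] : Fin 3 → Circle) a = x ^ (![1, -1, 0] : Fin 3 → ℤ) a := by
    intro a; fin_cases a <;> simp
  have hZ := ((inv_monoMat_iff V
    (fun a => ((![x, x⁻¹, 1] : Fin 3 → Circle) a : ℂ)) 1).1 ht).2
  simp only [hm, circle_conj, ← Circle.coe_mul, ← zpow_neg, ← zpow_add, Equiv.Perm.coe_one,
    id_eq] at hZ
  have key : ∀ (n : ℤ) (y : ℂ), ((x ^ n : Circle) : ℂ) * y = y → x ^ n ≠ 1 → y = 0 := by
    intro n y h hn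
    by_contra hy
    refine hn ?_
    rw [← Circle.coe_eq_one]
    exact mul_right_cancel₀ hy (h.trans (one_mul y).symm)
  have s0 : Equiv.swap (0 : Fin 3) 1 0 = 1 := by decide
  have s1 : Equiv.swap (0 : Fin 3) 1 1 = 0 := by decide
  have s2 : Equiv.swap (0 : Fin 3) 1 2 = 2 := by decide
  obtain ⟨-, hT⟩ := (inv_monoMat_conj_iff V (fun c => ((![a, b, 1] : Fin 3 → Circle) c : ℂ))
    (Equiv.swap 0 1) cyc2gen_ne_one).1 hΘ
  by_cases hx3 : x ^ 3 = 1
  · have hκ : V.Z 0 1 0 1 = 0 := by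
      refine key _ _ (hZ 0 1 0 1) ?_
      intro h
      have h4 : x ^ 4 = 1 := circle_pow_of_zpow (by decide) h
      rw [pow_succ, hx3, one_mul] at h4
      exact hx (by rw [h4, one_pow])
    have t1 : (a : ℂ)⁻¹ * (b : ℂ)⁻¹ * V.Z 0 2 1 2 = conj (V.Z 0 2 1 2) := by
      have := hT 0 2 1 2
      rw [s0, s1, s2, V.Z_symm 2 1 2 0, ← V.Z_herm 0 2 1 2] at this
      rw [← this]
      simp only [Matrix.cons_val_zero, Matrix.cons_val_one, Matrix.cons_val, circle_conj_eq_inv,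
        Circle.coe_one, mul_one]
    have t2 : (a : ℂ)⁻¹ * b * b * V.Z 0 1 2 1 = conj (V.Z 1 0 2 0) := by
      have := hT 0 1 2 1
      rw [s0, s1, s2, ← V.Z_herm 1 0 2 0] at this
      rw [← this]
      simp only [Matrix.cons_val_zero, Matrix.cons_val_one, Matrix.cons_val, circle_conj_eq_inv,
        Circle.coe_one, map_one, one_mul]
    have t3 : (b : ℂ)⁻¹ * a * a * V.Z 1 0 2 0 = conj (V.Z 0 1 2 1) := by
      have := hT 1 0 2 0
      rw [s0, s1, s2, ← V.Z_herm 0 1 2 1] at this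
      rw [← this]
      simp only [Matrix.cons_val_zero, Matrix.cons_val_one, Matrix.cons_val, circle_conj_eq_inv,
        Circle.coe_one, map_one, one_mul]
    have ha := Circle.coe_ne_zero a
    have hb := Circle.coe_ne_zero b
    by_cases h2 : V.Z 0 1 2 1 = 0
    · have h3 : V.Z 1 0 2 0 = 0 := by
        rw [h2, mul_zero] at t2
        exact (map_eq_zero _).1 t2.symm
      refine ⟨a, b, inv_diag_conj_of_coeff hx ht _ _ t1 ?_ ?_ ?_⟩
      · simp [h2]
      · simp [h3]
      · simp [hκ]
    · obtain ⟨u, hu⟩ := exists_circle_conj (V.Z 0 1 2 1)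
      -- Keeping the product `p q = a b` preserves the first condition; the second, `p⁻¹ q² = u`,
      -- then prescribes the cube of `p`.
      obtain ⟨p, hp⟩ := circle_exists_root (n := 3) (by norm_num) ((a * b) ^ 2 / u)
      have hp0 := Circle.coe_ne_zero p
      have hu0 := Circle.coe_ne_zero u
      have hp' : (p : ℂ) ^ 3 * u = (a * b) ^ 2 := by
        have := congrArg (fun z : Circle => (z : ℂ) * u) hp
        simpa using this
      have h3 : V.Z 1 0 2 0 = a * (b : ℂ)⁻¹ * (b : ℂ)⁻¹ * (u * V.Z 0 1 2 1) := by
        have := congrArg conj t2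
        simp only [map_mul, Complex.conj_conj, map_inv₀, circle_conj_eq_inv, inv_inv] at this
        rw [← this, hu]
      -- Applying `t2` and `t3` in succession multiplies a nonzero coefficient by `(a / b)³`.
      have hab : (a : ℂ) ^ 3 = b ^ 3 := by
        rw [h3, ← hu] at t3
        have hne : (u : ℂ) * V.Z 0 1 2 1 ≠ 0 := mul_ne_zero hu0 h2
        have t4 : (b : ℂ)⁻¹ * a * a * (a * (b : ℂ)⁻¹ * (b : ℂ)⁻¹) = 1 :=
          mul_right_cancel₀ hne (by rw [one_mul]; linear_combination t3)
        field_simp at t4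
        exact t4
      refine ⟨p, a * b / p, inv_diag_conj_of_coeff hx ht _ _ ?_ ?_ ?_ ?_⟩
      · rw [← t1, Circle.coe_div, Circle.coe_mul]
        field_simp
      · rw [← hu, Circle.coe_div, Circle.coe_mul]
        have e : (p : ℂ)⁻¹ * (a * b / p) * (a * b / p) = u := by
          field_simp
          linear_combination (-1 : ℂ) * hp'
        rw [e]
      · rw [← t2, h3, Circle.coe_div, Circle.coe_mul]
        have e : ((a : ℂ) * b / p)⁻¹ * p * p * (a * (b : ℂ)⁻¹ * (b : ℂ)⁻¹ * u) =
            (a : ℂ)⁻¹ * b * b := by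
          field_simp
          linear_combination (a : ℂ) * hp' + (b ^ 2 : ℂ) * hab
        linear_combination V.Z 0 1 2 1 * e
      · simp [hκ]
  · have h2 : V.Z 0 1 2 1 = 0 := key _ _ (hZ 0 1 2 1) fun h =>
      hx3 (circle_pow_of_zpow (by decide) h)
    have h3 : V.Z 1 0 2 0 = 0 := key _ _ (hZ 1 0 2 0) fun h =>
      hx3 (circle_pow_of_zpow (by decide) h)
    obtain ⟨u, hu⟩ := exists_circle_conj (V.Z 0 2 1 2)
    obtain ⟨v, hv⟩ := exists_circle_conj (V.Z 0 1 0 1)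
    -- Now the conditions are `(q / p)² = v` and `(p q)⁻¹ = u`; put `q = r p`.
    obtain ⟨r, hr⟩ := circle_exists_root (n := 2) (by norm_num) v
    obtain ⟨p, hp⟩ := circle_exists_root (n := 2) (by norm_num) (r * u)⁻¹
    have hp0 := Circle.coe_ne_zero p
    have hr0 := Circle.coe_ne_zero r
    have hu0 := Circle.coe_ne_zero u
    have hp' : (p : ℂ) ^ 2 * (r * u) = 1 := by
      rw [← Circle.coe_pow, hp, Circle.coe_inv, Circle.coe_mul]
      exact inv_mul_cancel₀ (mul_ne_zero hr0 hu0)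
    have hr' : (r : ℂ) ^ 2 = v := by rw [← Circle.coe_pow, hr]
    refine ⟨p, r * p, inv_diag_conj_of_coeff hx ht _ _ ?_ ?_ ?_ ?_⟩
    · rw [← hu, Circle.coe_mul]
      have e : (p : ℂ)⁻¹ * (r * p : ℂ)⁻¹ = u := by
        field_simp
        linear_combination (-1 : ℂ) * hp'
      rw [e]
    · simp [h2]
    · simp [h3]
    · rw [← hv, ← hr', Circle.coe_mul]
      field_simp

/-- If `x² ≠ 1`, there is a diagonal antiunitary symmetry. Commuting with it forces diag(x, x⁻¹, 1)
to equal its conjugate up to a scalar, and the third entry shows that the scalar is 1. So `x` is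
real, a contradiction. -/
theorem diag_symmetry_sq {V : Potential 3} (hab : ∀ a ∈ V.aut, ∀ b ∈ V.aut, a * b = b * a)
    {x a b : Circle} (ht : rep (monoU ![x, x⁻¹, 1] 1) 1 ∈ V.aut)
    (hΘ : rep (monoU ![a, b, 1] (Equiv.swap 0 1)) cyc2gen ∈ V.aut) : x ^ 2 = 1 := by
  by_contra hx
  obtain ⟨p, q, hd⟩ := exists_diag_conj_symmetry hx ((rep_mem_aut _ _ _).1 ht)
    ((rep_mem_aut _ _ _).1 hΘ)
  have h1 := hab _ ((rep_mem_aut _ _ _).2 hd) _ ht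
  rw [rep_mul, rep_mul, rep_eq_iff] at h1
  obtain ⟨-, c, hc⟩ := h1
  have e0 := congrFun (congrFun hc 0) 0
  have e2 := congrFun (congrFun hc 2) 2
  simp only [Submonoid.coe_mul, Matrix.smul_apply, smul_eq_mul] at e0 e2
  have f : ∀ (m : Fin 3 → Circle) (N : Matrix (Fin 3) (Fin 3) ℂ) (i j : Fin 3),
      ((monoU m 1 : Matrix (Fin 3) (Fin 3) ℂ) * N) i j = m i * N i j := by
    intro m N i j
    exact monoMat_mul_apply _ _ _ _ _
  rw [f, f] at e0 e2
  simp [twistU, conjU, monoU, monoMat] at e0 e2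
  rw [← e2, one_mul] at e0
  have h2 : (x : ℂ) = conj (x : ℂ) := by
    refine mul_right_cancel₀ (Circle.coe_ne_zero p) (e0.trans (mul_comm _ _))
  apply hx
  apply Circle.ext
  have h3 := circle_conj_mul x
  rw [← h2] at h3
  rw [Circle.coe_pow, sq, h3, Circle.coe_one]

/-! ### Unitary `3 × 3` matrices -/

theorem unitary_row (M : U3) (i j : Fin 3) :
    ∑ k, (M : Matrix (Fin 3) (Fin 3) ℂ) i k * conj ((M : Matrix (Fin 3) (Fin 3) ℂ) j k) =
      if i = j then 1 else 0 := by
  have := congrFun (congrFun (Matrix.mem_unitaryGroup_iff.1 M.2) i) j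
  simpa [Matrix.mul_apply, Matrix.star_apply, Matrix.one_apply] using this

theorem unitary_col (M : U3) (i j : Fin 3) :
    ∑ k, conj ((M : Matrix (Fin 3) (Fin 3) ℂ) k i) * (M : Matrix (Fin 3) (Fin 3) ℂ) k j =
      if i = j then 1 else 0 := by
  have := congrFun (congrFun (Matrix.mem_unitaryGroup_iff'.1 M.2) i) j
  simpa [Matrix.mul_apply, Matrix.star_apply, Matrix.one_apply] using this

theorem unitary_adjugate (M : U3) : (M : Matrix (Fin 3) (Fin 3) ℂ).adjugate =
    (M : Matrix (Fin 3) (Fin 3) ℂ).det • star (M : Matrix (Fin 3) (Fin 3) ℂ) := by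
  have h := Matrix.mem_unitaryGroup_iff.1 M.2
  calc (M : Matrix (Fin 3) (Fin 3) ℂ).adjugate
      = (M : Matrix (Fin 3) (Fin 3) ℂ).adjugate *
          ((M : Matrix (Fin 3) (Fin 3) ℂ) * star (M : Matrix (Fin 3) (Fin 3) ℂ)) := by
        rw [h, mul_one]
    _ = _ := by rw [← mul_assoc, Matrix.adjugate_mul, Matrix.smul_mul, one_mul]

theorem add_normSq_eq_zero {z w : ℂ} (h : conj z * z + conj w * w = 0) : z = 0 ∧ w = 0 := by
  rw [← Complex.normSq_eq_conj_mul_self, ← Complex.normSq_eq_conj_mul_self] at h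
  norm_cast at h
  have h1 := Complex.normSq_nonneg z
  have h2 := Complex.normSq_nonneg w
  exact ⟨Complex.normSq_eq_zero.1 (by linarith), Complex.normSq_eq_zero.1 (by linarith)⟩

theorem unitary_block {M : U3} (h : (M : Matrix (Fin 3) (Fin 3) ℂ) 2 2 = 1) :
    (M : Matrix (Fin 3) (Fin 3) ℂ) 2 0 = 0 ∧ (M : Matrix (Fin 3) (Fin 3) ℂ) 2 1 = 0 ∧
    (M : Matrix (Fin 3) (Fin 3) ℂ) 0 2 = 0 ∧ (M : Matrix (Fin 3) (Fin 3) ℂ) 1 2 = 0 := by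
  have h1 := unitary_row M 2 2
  have h2 := unitary_col M 2 2
  rw [Fin.sum_univ_three, h] at h1 h2
  simp only [if_true, map_one, mul_one] at h1 h2
  obtain ⟨a, b⟩ := add_normSq_eq_zero (z := (M : Matrix (Fin 3) (Fin 3) ℂ) 2 0)
    (w := (M : Matrix (Fin 3) (Fin 3) ℂ) 2 1) (by linear_combination h1)
  obtain ⟨c, d⟩ := add_normSq_eq_zero (z := (M : Matrix (Fin 3) (Fin 3) ℂ) 0 2)
    (w := (M : Matrix (Fin 3) (Fin 3) ℂ) 1 2) (by linear_combination h2)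
  exact ⟨a, b, c, d⟩

/-- The element of `SU(2) ⊕ 1` with first row `(p, q, 0)`. -/
def blockU (p q : ℂ) (h : conj p * p + conj q * q = 1) : U3 :=
  ⟨!![p, q, 0; -conj q, conj p, 0; 0, 0, 1], by
    rw [Matrix.mem_unitaryGroup_iff]
    ext i j
    fin_cases i <;> fin_cases j <;>
      simp [Matrix.mul_apply, Fin.sum_univ_three, Matrix.star_apply] <;>
      first | ring1 | linear_combination h⟩

theorem coe_blockU (p q : ℂ) (h : conj p * p + conj q * q = 1) :
    (blockU p q h : Matrix (Fin 3) (Fin 3) ℂ) = !![p, q, 0; -conj q, conj p, 0; 0, 0, 1] := rfl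

theorem coe_monoU_diag (a b c : Circle) :
    (monoU ![a, b, c] 1 : Matrix (Fin 3) (Fin 3) ℂ) = !![(a : ℂ), 0, 0; 0, b, 0; 0, 0, c] := by
  ext i j
  fin_cases i <;> fin_cases j <;> simp [monoU, monoMat]

theorem coe_monoU_swap (a b c : Circle) :
    (monoU ![a, b, c] (Equiv.swap 0 1) : Matrix (Fin 3) (Fin 3) ℂ) =
      !![0, (a : ℂ), 0; b, 0, 0; 0, 0, c] := by
  ext i j
  fin_cases i <;> fin_cases j <;> simp [monoU, monoMat, Equiv.swap_apply_def]

theorem exists_blockU {M : U3} (h : (M : Matrix (Fin 3) (Fin 3) ℂ) 2 2 = 1)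
    (hd : (M : Matrix (Fin 3) (Fin 3) ℂ).det = 1) : ∃ p q h, M = blockU p q h := by
  obtain ⟨h20, h21, h02, h12⟩ := unitary_block h
  have hadj := unitary_adjugate M
  rw [hd, one_smul, Matrix.adjugate_fin_three] at hadj
  have e0 := congrFun (congrFun hadj 0) 0
  have e1 := congrFun (congrFun hadj 1) 0
  have hr := unitary_row M 0 0
  simp only [Fin.sum_univ_three, h02, if_true] at hr
  simp [h, h12, h20, h21, Matrix.star_apply] at e0 e1 hr
  refine ⟨(M : Matrix (Fin 3) (Fin 3) ℂ) 0 0, (M : Matrix (Fin 3) (Fin 3) ℂ) 0 1, ?_, ?_⟩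
  · linear_combination hr
  · apply Subtype.ext
    ext i j
    fin_cases i <;> fin_cases j <;> simp [blockU, h, h20, h21, h02, h12, ← e1, ← e0]

/-- Every element of `SU(2) ⊕ 1` is diagonalized by an element of `SU(2) ⊕ 1`. -/
theorem blockU_diagonalize (p q : ℂ) (h : conj p * p + conj q * q = 1) :
    ∃ (a b : ℂ) (hab : conj a * a + conj b * b = 1) (y : Circle),
      (blockU a b hab)⁻¹ * blockU p q h * blockU a b hab = monoU ![y, y⁻¹, 1] 1 := by
  obtain ⟨y, e0, e1, hne, h0, h1⟩ : ∃ y e0 e1 : ℂ, conj e0 * e0 + conj e1 * e1 ≠ 0 ∧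
      p * e0 + q * e1 = y * e0 ∧ -conj q * e0 + conj p * e1 = y * e1 := by
    by_cases hq : q = 0
    · exact ⟨p, 1, 0, by simp, by simp, by simp [hq]⟩
    -- The vector `(q, y - p)` solves the first eigenvalue equation for every `y`; the second one is
    -- the characteristic equation.
    · obtain ⟨y, hy⟩ := IsAlgClosed.exists_root
        (Polynomial.C 1 * Polynomial.X ^ 2 + Polynomial.C (-(p + conj p)) * Polynomial.X +
          Polynomial.C 1 : Polynomial ℂ) (by
            rw [Polynomial.degree_quadratic one_ne_zero]; norm_num)
      simp [Polynomial.IsRoot] at hy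
      refine ⟨y, q, y - p, fun h' => hq (add_normSq_eq_zero h').1, by ring, ?_⟩
      linear_combination (-1 : ℂ) * hy - h
  obtain ⟨n, hn⟩ : ∃ n : ℝ, (n : ℂ) ^ 2 * (conj e0 * e0 + conj e1 * e1) = 1 := by
    rw [← Complex.normSq_eq_conj_mul_self, ← Complex.normSq_eq_conj_mul_self] at hne ⊢
    norm_cast at hne ⊢
    have hpos : 0 < Complex.normSq e0 + Complex.normSq e1 :=
      lt_of_le_of_ne (add_nonneg (Complex.normSq_nonneg _) (Complex.normSq_nonneg _)) (Ne.symm hne)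
    refine ⟨(Real.sqrt (Complex.normSq e0 + Complex.normSq e1))⁻¹, ?_⟩
    rw [inv_pow, Real.sq_sqrt hpos.le, inv_mul_cancel₀ hne]
  have hy : conj y * y = 1 := by
    have c0 := congrArg conj h0
    have c1 := congrArg conj h1
    simp only [map_add, map_mul, map_neg, Complex.conj_conj] at c0 c1
    have : conj y * y * (conj e0 * e0 + conj e1 * e1) = 1 * (conj e0 * e0 + conj e1 * e1) := by
      calc conj y * y * (conj e0 * e0 + conj e1 * e1)
          = (conj y * conj e0) * (y * e0) + (conj y * conj e1) * (y * e1) := by ring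
        _ = _ := by
          rw [← h0, ← h1, ← c0, ← c1]
          linear_combination (conj e0 * e0 + conj e1 * e1) * h
    exact mul_right_cancel₀ hne this
  have c0 := congrArg conj h0
  have c1 := congrArg conj h1
  simp only [map_add, map_mul, map_neg, Complex.conj_conj] at c0 c1
  have hyi : conj y = y⁻¹ := eq_inv_of_mul_eq_one_left hy
  obtain ⟨z, rfl⟩ : ∃ z : Circle, (z : ℂ) = y :=
    ⟨⟨y, mem_sphere_zero_iff_norm.2 (conj_mul_self_eq_one.1 hy)⟩, rfl⟩
  -- The first column is the normalized eigenvector; the second is orthogonal to it and has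
  -- eigenvalue `conj y`.
  have hcond : conj (n * e0) * (n * e0) + conj (-(n * conj e1)) * -(n * conj e1) = 1 := by
    simp
    linear_combination hn
  refine ⟨n * e0, -(n * conj e1), hcond, z, ?_⟩
  rw [mul_assoc, inv_mul_eq_iff_eq_mul]
  apply Subtype.ext
  rw [Submonoid.coe_mul, Submonoid.coe_mul, coe_monoU_diag, coe_blockU, coe_blockU]
  ext i j
  fin_cases i <;> fin_cases j <;>
    simp [Matrix.mul_apply, Fin.sum_univ_three, ← hyi]
  · linear_combination (n : ℂ) * h0
  · linear_combination -(n : ℂ) * c1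
  · linear_combination (n : ℂ) * h1
  · linear_combination (n : ℂ) * c0

theorem exists_unitary_col {w : Fin 3 → ℂ} (hw : w ≠ 0) (k : Fin 3) :
    ∃ (s : U3) (r : ℝ), r ≠ 0 ∧ ∀ i, (s : Matrix (Fin 3) (Fin 3) ℂ) i k = r * w i := by
  set W : EuclideanSpace ℂ (Fin 3) := WithLp.toLp 2 w with hW
  have hW0 : ‖W‖ ≠ 0 := by
    rw [norm_ne_zero_iff]
    intro h
    exact hw (funext fun i => congrArg (fun v : EuclideanSpace ℂ (Fin 3) => v i) h)
  have ho : Orthonormal ℂ (({k} : Set (Fin 3)).domRestrict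
      (fun _ : Fin 3 => ((‖W‖⁻¹ : ℝ) : ℂ) • W)) := by
    constructor
    · intro i
      simp [Set.domRestrict, norm_smul, hW0]
    · rintro ⟨i, hi⟩ ⟨j, hj⟩ hij
      exact absurd (Subtype.ext ((Set.mem_singleton_iff.1 hi).trans
        (Set.mem_singleton_iff.1 hj).symm)) hij
  obtain ⟨b, hb⟩ := ho.exists_orthonormalBasis_extension_of_card_eq (by simp)
  refine ⟨⟨(EuclideanSpace.basisFun (Fin 3) ℂ).toBasis.toMatrix b,
    OrthonormalBasis.toMatrix_orthonormalBasis_mem_unitary _ _⟩, ‖W‖⁻¹, inv_ne_zero hW0, ?_⟩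
  intro i
  simp only [Module.Basis.toMatrix_apply]
  rw [hb k rfl]
  simp [hW]

/-! ### Normal form of an antiunitary transformation -/

theorem det_one_sub_fin_three {R : Type*} [CommRing R] (A : Matrix (Fin 3) (Fin 3) R) :
    (1 - A).det = 1 - A.trace + A.adjugate.trace - A.det := by
  rw [Matrix.adjugate_fin_three, Matrix.trace_fin_three, Matrix.trace_fin_three, Matrix.det_fin_three,
    Matrix.det_fin_three]
  simp
  ring

theorem coe_conjU (M : U3) : (conjU M : Matrix (Fin 3) (Fin 3) ℂ) =
    (M : Matrix (Fin 3) (Fin 3) ℂ).map (starRingEnd ℂ) := rfl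

theorem conjU_inv (M : U3) : conjU M⁻¹ = (conjU M)⁻¹ := by
  rw [eq_inv_iff_mul_eq_one, ← conjU_mul, inv_mul_cancel]
  apply Subtype.ext
  simp [coe_conjU]

theorem det_mul_conjU (u : U3) : ((u * conjU u : U3) : Matrix (Fin 3) (Fin 3) ℂ).det = 1 := by
  rw [Submonoid.coe_mul, Matrix.det_mul, coe_conjU, ← RingHom.mapMatrix_apply, ← RingHom.map_det,
    mul_comm]
  exact conj_mul_self_eq_one.2 (norm_det_unitary u)

/-- The matrix `A = u ū` has determinant 1 and real trace, and unitarity turns its adjugate into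
`A*`. The characteristic polynomial at 1 is therefore `1 - tr A + tr A - 1 = 0`. Odd dimension
matters here. -/
theorem exists_fixed_by_mul_conjU (u : U3) :
    ∃ v : Fin 3 → ℂ, v ≠ 0 ∧ ((u * conjU u : U3) : Matrix (Fin 3) (Fin 3) ℂ).mulVec v = v := by
  set A : U3 := u * conjU u with hA
  have htr : conj (A : Matrix (Fin 3) (Fin 3) ℂ).trace = (A : Matrix (Fin 3) (Fin 3) ℂ).trace := by
    rw [hA, Submonoid.coe_mul, coe_conjU, Matrix.trace, map_sum]
    simp only [Matrix.diag_apply, Matrix.mul_apply, Matrix.map_apply, map_sum, map_mul,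
      Complex.conj_conj]
    rw [Finset.sum_comm]
    exact Finset.sum_congr rfl fun i _ => Finset.sum_congr rfl fun j _ => mul_comm _ _
  have hdet : (1 - (A : Matrix (Fin 3) (Fin 3) ℂ)).det = 0 := by
    rw [det_one_sub_fin_three, unitary_adjugate, det_mul_conjU, one_smul, Matrix.star_eq_conjTranspose,
      Matrix.trace_conjTranspose]
    rw [show star (A : Matrix (Fin 3) (Fin 3) ℂ).trace = _ from htr]
    ring
  obtain ⟨v, hv, h⟩ := Matrix.exists_mulVec_eq_zero_iff.2 hdet
  refine ⟨v, hv, ?_⟩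
  rw [Matrix.sub_mulVec, Matrix.one_mulVec, sub_eq_zero] at h
  exact h.symm

/-- Let K be the antilinear map `v ↦ u v̄` and choose `v` with `K²v = v`. Then `v + Kv` is fixed by
K. If it vanishes, `Kv = -v` and antilinearity makes `i v` fixed. -/
theorem exists_fixed_by_antiunitary (u : U3) :
    ∃ w : Fin 3 → ℂ, w ≠ 0 ∧ (u : Matrix (Fin 3) (Fin 3) ℂ).mulVec (star w) = w := by
  obtain ⟨v, hv, h⟩ := exists_fixed_by_mul_conjU u
  have hK : (u : Matrix (Fin 3) (Fin 3) ℂ).mulVec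
      (star ((u : Matrix (Fin 3) (Fin 3) ℂ).mulVec (star v))) = v := by
    conv_rhs => rw [← h]
    rw [Submonoid.coe_mul, ← Matrix.mulVec_mulVec]
    congr 1
    ext i
    simp [Matrix.mulVec, dotProduct, coe_conjU]
  set k := (u : Matrix (Fin 3) (Fin 3) ℂ).mulVec (star v) with hk
  by_cases hw : v + k = 0
  · refine ⟨Complex.I • v, smul_ne_zero Complex.I_ne_zero hv, ?_⟩
    rw [star_smul, Matrix.mulVec_smul, ← hk, eq_neg_of_add_eq_zero_right hw]
    simp
  · refine ⟨v + k, hw, ?_⟩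
    rw [star_add, Matrix.mulVec_add, ← hk, hK, add_comm]

theorem exists_conj_fixing_last (u : U3) : ∃ s : U3,
    ((s⁻¹ * u * conjU s : U3) : Matrix (Fin 3) (Fin 3) ℂ) 2 2 = 1 := by
  obtain ⟨w, hw, h⟩ := exists_fixed_by_antiunitary u
  obtain ⟨s, r, hr, hs⟩ := exists_unitary_col hw 2
  refine ⟨s, ?_⟩
  have h1 : ∀ i, ((u * conjU s : U3) : Matrix (Fin 3) (Fin 3) ℂ) i 2 =
      (s : Matrix (Fin 3) (Fin 3) ℂ) i 2 := by
    intro i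
    have h2 := congrFun h i
    rw [hs, ← h2, Submonoid.coe_mul, Matrix.mul_apply]
    simp only [coe_conjU, Matrix.map_apply, hs, map_mul, Complex.conj_ofReal, Matrix.mulVec,
      dotProduct, Finset.mul_sum, Pi.star_apply]
    refine Finset.sum_congr rfl fun j _ => ?_
    rw [show star (w j) = conj (w j) from rfl]
    ring
  have h3 := congrFun (congrFun (Matrix.mem_unitaryGroup_iff'.1 s.2) 2) 2
  rw [mul_assoc, Submonoid.coe_mul, Matrix.mul_apply]
  simp only [h1]
  exact h3

/-- Use a vector fixed by the antiunitary map as the last basis vector. The square then lies in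
SU(2) ⊕ 1 and is diagonalized to diag(y, y⁻¹, 1) without disturbing that vector; `hu` excludes `y =
1`. -/
theorem antiunitary_normal_form {u : U3} (hu : u * conjU u ≠ 1) :
    ∃ (s : U3) (a b : Circle), s⁻¹ * u * conjU s = monoU ![a, b, 1] (Equiv.swap 0 1) := by
  obtain ⟨s, hs⟩ := exists_conj_fixing_last u
  set v := s⁻¹ * u * conjU s with hv
  have hvv : ((v * conjU v : U3) : Matrix (Fin 3) (Fin 3) ℂ) 2 2 = 1 := by
    obtain ⟨h20, h21, -, -⟩ := unitary_block hs
    simp [Submonoid.coe_mul, Matrix.mul_apply, Fin.sum_univ_three, coe_conjU, h20, h21, hs]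
  obtain ⟨p, q, h, hpq⟩ := exists_blockU hvv (det_mul_conjU v)
  obtain ⟨c, d, hcd, y, hy⟩ := blockU_diagonalize p q h
  set s' := blockU c d hcd with hs'
  set w := s'⁻¹ * v * conjU s' with hw
  have hww : w * conjU w = monoU ![y, y⁻¹, 1] 1 := by
    rw [← hy, ← hpq, hw]
    simp only [conjU_mul, conjU_conjU, conjU_inv]
    group
  have hw22 : (w : Matrix (Fin 3) (Fin 3) ℂ) 2 2 = 1 := by
    obtain ⟨h20, h21, h02, h12⟩ := unitary_block hs
    have e : ((s'⁻¹ : U3) : Matrix (Fin 3) (Fin 3) ℂ) = star (s' : Matrix (Fin 3) (Fin 3) ℂ) := rfl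
    rw [hw, Submonoid.coe_mul, Submonoid.coe_mul, e, coe_conjU, hs', coe_blockU]
    simp [Matrix.mul_apply, Fin.sum_univ_three, hs, Matrix.star_apply]
  have hy1 : (y : ℂ) ≠ 1 := by
    intro hy1
    have hy1 : y = 1 := Circle.ext hy1
    apply hu
    have h1 : w * conjU w = 1 := by
      rw [hww, hy1]
      apply Subtype.ext
      rw [inv_one, coe_monoU_diag]
      ext i j
      fin_cases i <;> fin_cases j <;> simp
    have h2 : u = s * s' * w * (conjU (s * s'))⁻¹ := by
      rw [hw, hv, conjU_mul]; group
    rw [h2]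
    simp only [conjU_mul, conjU_conjU, conjU_inv]
    calc _ = s * s' * (w * conjU w) * (s * s')⁻¹ := by group
      _ = 1 := by rw [h1]; group
  -- By unitarity `w w̄ = D` reads `w = D wᵀ`. Since `y ≠ 1`, the first two diagonal entries of `w`
  -- vanish.
  have hwt : (w : Matrix (Fin 3) (Fin 3) ℂ) =
      (monoU ![y, y⁻¹, 1] 1 : Matrix (Fin 3) (Fin 3) ℂ) *
        (w : Matrix (Fin 3) (Fin 3) ℂ).transpose := by
    have h1 : w = monoU ![y, y⁻¹, 1] 1 * (conjU w)⁻¹ := by rw [← hww]; group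
    have h2 : (((conjU w)⁻¹ : U3) : Matrix (Fin 3) (Fin 3) ℂ) =
        (w : Matrix (Fin 3) (Fin 3) ℂ).transpose := by
      change star (conjU w : Matrix (Fin 3) (Fin 3) ℂ) = _
      ext i j
      simp [coe_conjU, Matrix.star_apply]
    conv_lhs => rw [h1]
    rw [Submonoid.coe_mul, h2]
  obtain ⟨h20, h21, h02, h12⟩ := unitary_block hw22
  rw [coe_monoU_diag] at hwt
  have h00 : (w : Matrix (Fin 3) (Fin 3) ℂ) 0 0 = 0 := by
    have e := congrFun (congrFun hwt 0) 0
    simp [Matrix.mul_apply, Fin.sum_univ_three] at e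
    exact (mul_eq_zero.1 (by linear_combination e : (1 - (y : ℂ)) * _ = 0)).resolve_left
      (sub_ne_zero.2 (Ne.symm hy1))
  have h11 : (w : Matrix (Fin 3) (Fin 3) ℂ) 1 1 = 0 := by
    have e := congrFun (congrFun hwt 1) 1
    simp [Matrix.mul_apply, Fin.sum_univ_three] at e
    exact (mul_eq_zero.1 (by linear_combination e : (1 - (y : ℂ)⁻¹) * _ = 0)).resolve_left
      (sub_ne_zero.2 (Ne.symm (inv_eq_one.not.2 hy1)))
  have hn0 : ‖(w : Matrix (Fin 3) (Fin 3) ℂ) 0 1‖ = 1 := by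
    have := unitary_col w 1 1
    simp [Fin.sum_univ_three, h11, h21] at this
    exact conj_mul_self_eq_one.1 (by simpa using this)
  have hn1 : ‖(w : Matrix (Fin 3) (Fin 3) ℂ) 1 0‖ = 1 := by
    have := unitary_col w 0 0
    simp [Fin.sum_univ_three, h00, h20] at this
    exact conj_mul_self_eq_one.1 (by simpa using this)
  obtain ⟨a, ha⟩ : ∃ a : Circle, (a : ℂ) = (w : Matrix (Fin 3) (Fin 3) ℂ) 0 1 :=
    ⟨⟨_, mem_sphere_zero_iff_norm.2 hn0⟩, rfl⟩
  obtain ⟨b, hb⟩ : ∃ b : Circle, (b : ℂ) = (w : Matrix (Fin 3) (Fin 3) ℂ) 1 0 :=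
    ⟨⟨_, mem_sphere_zero_iff_norm.2 hn1⟩, rfl⟩
  refine ⟨s * s', a, b, ?_⟩
  rw [show (s * s')⁻¹ * u * conjU (s * s') = w by rw [hw, hv, conjU_mul]; group]
  apply Subtype.ext
  rw [coe_monoU_swap]
  ext i j
  fin_cases i <;> fin_cases j <;> simp [h00, h11, h20, h21, h02, h12, hw22, ha, hb]

/-! ### Antiunitary symmetries whose square is nontrivial -/

theorem rep_conj (s M : U3) (ε : Cyc 2) :
    rep s 1 * rep M ε * (rep s 1)⁻¹ = rep (s * M * twistU ε s⁻¹) ε := by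
  rw [rep_inv_one, rep_mul, rep_mul, one_mul, mul_one]
  rfl

theorem twistU_cyc2gen (M : U3) : twistU cyc2gen M = conjU M := if_neg cyc2gen_ne_one

theorem twistU_unit (M : U3) : twistU 1 M = M := if_pos rfl

theorem rep_cyc2gen_sq (u : U3) : rep u cyc2gen * rep u cyc2gen = rep (u * conjU u) 1 := by
  rw [rep_mul, twistU_cyc2gen, cyc_two_mul_of_ne cyc2gen_ne_one cyc2gen_ne_one]

theorem monoU_swap_mul_conjU (a b : Circle) :
    monoU ![a, b, 1] (Equiv.swap 0 1) * conjU (monoU ![a, b, 1] (Equiv.swap 0 1)) =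
      monoU ![a / b, (a / b)⁻¹, 1] 1 := by
  apply Subtype.ext
  rw [Submonoid.coe_mul, coe_conjU, coe_monoU_swap, coe_monoU_diag]
  ext i j
  fin_cases i <;> fin_cases j <;>
    simp [Matrix.mul_apply, Fin.sum_univ_three, circle_conj_eq_inv, div_eq_mul_inv]

theorem monoU_diag_one : monoU ![1, 1, 1] 1 = 1 := by
  apply Subtype.ext
  rw [coe_monoU_diag]
  ext i j
  fin_cases i <;> fin_cases j <;> simp

theorem circle_sq_eq_one {x : Circle} (h : x ^ 2 = 1) (h1 : x ≠ 1) : (x : ℂ) = -1 := by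
  have h2 : (x : ℂ) ^ 2 = 1 := by rw [← Circle.coe_pow, h, Circle.coe_one]
  rcases mul_self_eq_one_iff.1 ((sq _).symm.trans h2) with h3 | h3
  · exact absurd (Circle.ext h3) h1
  · exact h3

/-- A unitary transformation that commutes with `diag(-1, -1, 1)` is block diagonal. -/
theorem exists_block_rep {g : Repar 3} (hg : g.right = 1) {x : Circle} (hx : (x : ℂ) = -1)
    (hc : g * rep (monoU ![x, x⁻¹, 1] 1) 1 = rep (monoU ![x, x⁻¹, 1] 1) 1 * g) :
    ∃ M : U3, (M : Matrix (Fin 3) (Fin 3) ℂ) 2 2 = 1 ∧ rep M 1 = g := by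
  obtain ⟨h, hh⟩ := exists_rep g
  rw [hg] at hh
  rw [← hh, rep_mul, rep_mul, rep_eq_iff] at hc
  obtain ⟨-, c, hc⟩ := hc
  have e : ∀ i j, _ := fun i j => congrFun (congrFun hc i) j
  simp only [twistU_unit, Submonoid.coe_mul, coe_monoU_diag, Circle.coe_inv, hx,
    Circle.coe_one] at e
  have e02 := e 0 2
  have e12 := e 1 2
  have e00 := e 0 0
  have e01 := e 0 1
  have e10 := e 1 0
  have e11 := e 1 1
  simp [Matrix.mul_apply, Fin.sum_univ_three] at e02 e12 e00 e01 e10 e11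
  have r02 : (h : Matrix (Fin 3) (Fin 3) ℂ) 0 2 = 0 ∧ (h : Matrix (Fin 3) (Fin 3) ℂ) 1 2 = 0 := by
    by_cases hc1 : c = 1
    · rw [hc1] at e02 e12
      constructor
      · linear_combination (-1 / 2 : ℂ) * e02
      · linear_combination (-1 / 2 : ℂ) * e12
    -- For `c ≠ 1` the upper block vanishes, and the first two rows would be orthonormal vectors on
    -- a single coordinate axis.
    · exfalso
      have hc1 := sub_ne_zero.2 hc1
      have key : ∀ z : ℂ, z = c * z → z = 0 := fun z hz =>
        (mul_eq_zero.1 (by linear_combination (-1 : ℂ) * hz : (c - 1) * z = 0)).resolve_left hc1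
      have z00 := key _ e00
      have z01 := key _ e01
      have z10 := key _ e10
      have z11 := key _ e11
      have r0 := unitary_row h 0 0
      have r1 := unitary_row h 1 1
      have r01 := unitary_row h 0 1
      simp [Fin.sum_univ_three, z00, z01, z10, z11] at r0 r1 r01
      rcases r01 with r01 | r01 <;> simp [r01] at r0 r1
  have hn : ‖(h : Matrix (Fin 3) (Fin 3) ℂ) 2 2‖ = 1 := by
    have := unitary_col h 2 2
    simp [Fin.sum_univ_three, r02] at this
    exact conj_mul_self_eq_one.1 (by simpa using this)
  have h0 : (h : Matrix (Fin 3) (Fin 3) ℂ) 2 2 ≠ 0 := norm_ne_zero_iff.1 (by rw [hn]; norm_num)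
  refine ⟨⟨((h : Matrix (Fin 3) (Fin 3) ℂ) 2 2)⁻¹ • (h : Matrix (Fin 3) (Fin 3) ℂ),
    smul_mem_unitary (by rw [norm_inv, hn, inv_one]) h⟩, ?_, ?_⟩
  · exact inv_mul_cancel₀ h0
  · rw [← hh, rep_eq_iff]
    refine ⟨rfl, (h : Matrix (Fin 3) (Fin 3) ℂ) 2 2, ?_⟩
    rw [smul_smul, mul_inv_cancel₀ h0, one_smul]

/-- The square of the antiunitary element is diag(-1, -1, 1). Commuting with it makes `g` block
diagonal, and commuting with the antiunitary element puts the block into SU(2). After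
diagonalization `diag_symmetry_sq` leaves only ±1, which is central in SU(2), so the change of basis
can be undone. -/
theorem unitary_symmetry_of_sq_ne {V : Potential 3}
    (hab : ∀ a ∈ V.aut, ∀ b ∈ V.aut, a * b = b * a) {a b : Circle}
    (hΘ : rep (monoU ![a, b, 1] (Equiv.swap 0 1)) cyc2gen ∈ V.aut) (hne : a / b ≠ 1)
    {g : Repar 3} (hg : g ∈ V.aut) (hr : g.right = 1) :
    g = 1 ∨ g = rep (monoU ![a / b, (a / b)⁻¹, 1] 1) 1 := by
  set u := monoU ![a, b, 1] (Equiv.swap 0 1) with hu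
  have ht : rep (monoU ![a / b, (a / b)⁻¹, 1] 1) 1 ∈ V.aut := by
    rw [← monoU_swap_mul_conjU, ← rep_cyc2gen_sq]
    exact V.aut.mul_mem hΘ hΘ
  have hx : ((a / b : Circle) : ℂ) = -1 := circle_sq_eq_one (diag_symmetry_sq hab ht hΘ) hne
  have hb0 : (b : ℂ) ≠ 0 := Circle.coe_ne_zero b
  have hab' : (a : ℂ) = -b := by
    rw [Circle.coe_div, div_eq_iff hb0] at hx
    rw [hx]; ring
  obtain ⟨M, hM, rfl⟩ := exists_block_rep hr hx (hab _ hg _ ht)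
  obtain ⟨h20, h21, h02, h12⟩ := unitary_block hM
  have hcomm := hab _ hg _ hΘ
  rw [rep_mul, rep_mul, rep_eq_iff] at hcomm
  obtain ⟨-, c, hc⟩ := hcomm
  simp only [twistU_cyc2gen, twistU_unit, Submonoid.coe_mul, coe_conjU, hu, coe_monoU_swap,
    Circle.coe_one, hab'] at hc
  have e22 := congrFun (congrFun hc 2) 2
  have e01 := congrFun (congrFun hc 0) 1
  have e00 := congrFun (congrFun hc 0) 0
  simp [Matrix.mul_apply, Fin.sum_univ_three, hM] at e22
  simp [Matrix.mul_apply, Fin.sum_univ_three, ← e22] at e00 e01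
  have hrow := unitary_row M 0 0
  simp only [Fin.sum_univ_three, h02, if_true] at hrow
  have hm11 : conj ((M : Matrix (Fin 3) (Fin 3) ℂ) 1 1) = (M : Matrix (Fin 3) (Fin 3) ℂ) 0 0 :=
    mul_left_cancel₀ hb0 (by linear_combination e01)
  have hm10 : conj ((M : Matrix (Fin 3) (Fin 3) ℂ) 1 0) = -(M : Matrix (Fin 3) (Fin 3) ℂ) 0 1 :=
    mul_left_cancel₀ hb0 (by linear_combination (-1 : ℂ) * e00)
  have hm11' := congrArg conj hm11
  have hm10' := congrArg conj hm10
  simp only [Complex.conj_conj, map_neg] at hm11' hm10'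
  obtain ⟨p, q, h, rfl⟩ := exists_blockU hM (by
    rw [Matrix.det_fin_three, hM, h20, h21, h02, h12, hm11', hm10']
    simp only [map_zero, mul_zero] at hrow
    linear_combination hrow)
  obtain ⟨c, d, hcd, y, hy⟩ := blockU_diagonalize p q h
  set s := blockU c d hcd with hs
  have hMs : blockU p q h = s * monoU ![y, y⁻¹, 1] 1 * s⁻¹ := by rw [← hy]; group
  -- Because `a = -b`, the antiunitary map is a quaternionic structure on the first two coordinates.
  -- It commutes with SU(2) ⊕ 1 and keeps its form in the new basis.
  have hus : s * u = u * conjU s := by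
    apply Subtype.ext
    rw [Submonoid.coe_mul, Submonoid.coe_mul, coe_conjU, hs, hu, coe_blockU, coe_monoU_swap, hab']
    ext i j
    fin_cases i <;> fin_cases j <;>
      simp [Matrix.mul_apply, Fin.sum_univ_three, mul_comm]
  have hy2 : y ^ 2 = 1 := by
    refine diag_symmetry_sq (V := V.pull s) (pull_comm hab s) (a := a) (b := b) ?_ ?_
    · rw [mem_aut_pull, rep_conj]
      rw [twistU_unit, ← hMs]
      exact hg
    · rw [mem_aut_pull, rep_conj, twistU_cyc2gen, ← hu, hus, conjU_inv, mul_inv_cancel_right]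
      exact hΘ
  by_cases hy1 : y = 1
  · left
    rw [hMs, hy1, inv_one, monoU_diag_one, mul_one, mul_inv_cancel, rep_one]
  · right
    have hyx : y = a / b := Circle.ext ((circle_sq_eq_one hy2 hy1).trans hx.symm)
    rw [hMs, hyx]
    congr 1
    rw [mul_inv_eq_iff_eq_mul]
    apply Subtype.ext
    rw [Submonoid.coe_mul, Submonoid.coe_mul, hs, coe_blockU, coe_monoU_diag, Circle.coe_inv, hx]
    ext i j
    fin_cases i <;> fin_cases j <;>
      simp [Matrix.mul_apply, Fin.sum_univ_three, mul_comm]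

theorem hasType_of_sq_ne {V : Potential 3}
    (hab : ∀ a ∈ V.aut, ∀ b ∈ V.aut, a * b = b * a) {Θ : Repar 3} (hΘ : Θ ∈ V.aut)
    (hΘa : IsAntiunitary Θ) (hne : Θ * Θ ≠ 1) : HasType V.aut typeZ4 := by
  refine hasType_Z4 hΘ hΘa hne fun g hg hr => ?_
  obtain ⟨u, hu⟩ := exists_rep Θ
  rw [cyc_two_eq_of_ne hΘa cyc2gen_ne_one] at hu
  have hu1 : u * conjU u ≠ 1 := by
    intro h1
    apply hne
    rw [← hu, rep_cyc2gen_sq, h1, rep_one]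
  obtain ⟨s, a, b, hs⟩ := antiunitary_normal_form hu1
  set m := monoU ![a, b, 1] (Equiv.swap 0 1) with hm
  have hconj : rep s 1 * rep m cyc2gen * (rep s 1)⁻¹ = Θ := by
    rw [rep_conj, twistU_cyc2gen, ← hs, ← hu, conjU_inv]
    congr 1
    group
  have hsq : rep s 1 * rep (monoU ![a / b, (a / b)⁻¹, 1] 1) 1 * (rep s 1)⁻¹ = Θ * Θ := by
    rw [← monoU_swap_mul_conjU, ← rep_cyc2gen_sq, ← hconj, ← hm]
    group
  have hne' : a / b ≠ 1 := by
    intro h1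
    apply hne
    rw [← hsq, h1, inv_one, monoU_diag_one, rep_one]
    group
  have h1 : (rep s 1)⁻¹ * g * rep s 1 ∈ (V.pull s).aut := by
    rw [mem_aut_pull]
    convert hg using 1
    group
  have h2 : rep m cyc2gen ∈ (V.pull s).aut := by
    rw [mem_aut_pull, hconj]
    exact hΘ
  have h3 : ((rep s 1)⁻¹ * g * rep s 1).right = 1 := by
    rw [rep_inv_one]
    simp [SemidirectProduct.mul_right, hr]
  have e : g = rep s 1 * ((rep s 1)⁻¹ * g * rep s 1) * (rep s 1)⁻¹ := by group
  rcases unitary_symmetry_of_sq_ne (pull_comm hab s) h2 hne' h1 h3 with h | h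
  · left
    rw [e, h]
    group
  · right
    rw [e, h, hsq]

/-! ### Groups of commuting involutions -/

/-- The Cayley–Hamilton identity with one factor `A` removed. -/
theorem adjugate_eq_sq_fin_three {R : Type*} [CommRing R] (A : Matrix (Fin 3) (Fin 3) R) :
    A * A - A.trace • A + A.adjugate.trace • 1 = A.adjugate := by
  rw [Matrix.adjugate_fin_three, Matrix.trace_fin_three, Matrix.trace_fin_three]
  ext i j
  fin_cases i <;> fin_cases j <;> simp [Matrix.mul_apply, Fin.sum_univ_three] <;>
    ring

/-- A reflection of determinant one has trace `-1`. -/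
theorem trace_involution {h : U3} (h2 : h * h = 1) (hd : (h : Matrix (Fin 3) (Fin 3) ℂ).det = 1)
    (h1 : h ≠ 1) : (h : Matrix (Fin 3) (Fin 3) ℂ).trace = -1 := by
  have hh : (h : Matrix (Fin 3) (Fin 3) ℂ) * (h : Matrix (Fin 3) (Fin 3) ℂ) = 1 :=
    congrArg Subtype.val h2
  have hs : star (h : Matrix (Fin 3) (Fin 3) ℂ) = h :=
    congrArg Subtype.val (inv_eq_of_mul_eq_one_left h2)
  have e := adjugate_eq_sq_fin_three (h : Matrix (Fin 3) (Fin 3) ℂ)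
  rw [unitary_adjugate, hd, one_smul, hs, hh] at e
  by_contra ht
  apply h1
  apply Subtype.ext
  have h0 : 1 + (h : Matrix (Fin 3) (Fin 3) ℂ).trace ≠ 0 := fun h0 =>
    ht (by linear_combination h0)
  have : (1 + (h : Matrix (Fin 3) (Fin 3) ℂ).trace) •
      ((1 : Matrix (Fin 3) (Fin 3) ℂ) - (h : Matrix (Fin 3) (Fin 3) ℂ)) = 0 := by
    rw [add_smul, one_smul, smul_sub]
    refine Eq.trans ?_ (sub_eq_zero.2 e)
    abel
  exact (sub_eq_zero.1 ((smul_eq_zero.1 this).resolve_left h0)).symm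

/-- Otherwise all seven products have trace -1, and `P = (1 + a)(1 + b)(1 + c)` has trace 3 - 7 =
-4. But `P` is Hermitian with `P² = 8P`, so its trace cannot be negative. -/
theorem commuting_involutions {a b c : U3} (ha : a * a = 1) (hb : b * b = 1) (hc : c * c = 1)
    (hab : a * b = b * a) (hac : a * c = c * a) (hbc : b * c = c * b)
    (da : (a : Matrix (Fin 3) (Fin 3) ℂ).det = 1) (db : (b : Matrix (Fin 3) (Fin 3) ℂ).det = 1)
    (dc : (c : Matrix (Fin 3) (Fin 3) ℂ).det = 1) :
    a = 1 ∨ b = 1 ∨ c = 1 ∨ a * b = 1 ∨ a * c = 1 ∨ b * c = 1 ∨ a * b * c = 1 := by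
  by_contra! hne
  obtain ⟨na, nb, nc, nab, nac, nbc, nabc⟩ := hne
  have sq_mul : ∀ {x y : U3}, x * x = 1 → y * y = 1 → x * y = y * x → x * y * (x * y) = 1 := by
    intro x y hx hy hxy
    rw [← mul_assoc, mul_assoc x y x, ← hxy, ← mul_assoc, hx, one_mul, hy]
  have det_mul : ∀ {x y : U3}, (x : Matrix (Fin 3) (Fin 3) ℂ).det = 1 →
      (y : Matrix (Fin 3) (Fin 3) ℂ).det = 1 →
      ((x * y : U3) : Matrix (Fin 3) (Fin 3) ℂ).det = 1 := by
    intro x y hx hy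
    rw [Submonoid.coe_mul, Matrix.det_mul, hx, hy, one_mul]
  have habc : a * b * c = c * (a * b) := by
    rw [mul_assoc, hbc, ← mul_assoc, hac, mul_assoc]
  have ta := trace_involution ha da na
  have tb := trace_involution hb db nb
  have tc := trace_involution hc dc nc
  have tab := trace_involution (sq_mul ha hb hab) (det_mul da db) nab
  have tac := trace_involution (sq_mul ha hc hac) (det_mul da dc) nac
  have tbc := trace_involution (sq_mul hb hc hbc) (det_mul db dc) nbc
  have tabc := trace_involution (sq_mul (sq_mul ha hb hab) hc habc)
    (det_mul (det_mul da db) dc) nabc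
  have star_eq : ∀ {x : U3}, x * x = 1 → star (x : Matrix (Fin 3) (Fin 3) ℂ) = x := fun hx =>
    congrArg Subtype.val (inv_eq_of_mul_eq_one_left hx)
  have sa := star_eq ha
  have sb := star_eq hb
  have sc := star_eq hc
  replace ha := congrArg Subtype.val ha
  replace hb := congrArg Subtype.val hb
  replace hc := congrArg Subtype.val hc
  replace hab := congrArg Subtype.val hab
  replace hac := congrArg Subtype.val hac
  replace hbc := congrArg Subtype.val hbc
  simp only [Submonoid.coe_mul, Submonoid.coe_one] at *
  generalize (a : Matrix (Fin 3) (Fin 3) ℂ) = A at *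
  generalize (b : Matrix (Fin 3) (Fin 3) ℂ) = B at *
  generalize (c : Matrix (Fin 3) (Fin 3) ℂ) = C at *
  have cAB : Commute (1 + A) (1 + B) := (Commute.one_left _).add_left
    ((Commute.one_right _).add_right hab)
  have cAC : Commute (1 + A) (1 + C) := (Commute.one_left _).add_left
    ((Commute.one_right _).add_right hac)
  have cBC : Commute (1 + B) (1 + C) := (Commute.one_left _).add_left
    ((Commute.one_right _).add_right hbc)
  have sq : ∀ X : Matrix (Fin 3) (Fin 3) ℂ, X * X = 1 → (1 + X) * (1 + X) = (2 : ℂ) • (1 + X) := by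
    intro X hX
    rw [mul_add, add_mul, add_mul, hX, two_smul]
    simp only [one_mul, mul_one]
    abel
  set P := (1 + A) * (1 + B) * (1 + C) with hP
  have hPstar : star P = P := by
    rw [hP, star_mul, star_mul, star_add, star_add, star_add, star_one, sa, sb, sc, ← cAB.eq]
    exact (cAC.mul_left cBC).eq.symm
  have hPP : P * star P = (8 : ℂ) • P := by
    have e1 : P * P = ((1 + A) * (1 + A)) * ((1 + B) * (1 + B)) * ((1 + C) * (1 + C)) := by
      rw [hP, Commute.mul_mul_mul_comm (cAC.mul_left cBC).symm,
        Commute.mul_mul_mul_comm cAB.symm]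
    rw [hPstar, e1, sq A ha, sq B hb, sq C hc]
    simp only [Matrix.smul_mul, Matrix.mul_smul, smul_smul]
    rw [← hP]
    congr 1
    norm_num
  have htr : P.trace = -4 := by
    have e : P = 1 + A + B + C + A * B + A * C + B * C + A * B * C := by
      rw [hP]; noncomm_ring
    rw [e]
    simp only [Matrix.trace_add, ta, tb, tc, tab, tac, tbc, tabc, Matrix.trace_one,
      Fintype.card_fin]
    norm_num
  have hnn : 0 ≤ (P * star P).trace.re := by
    rw [Matrix.trace, Complex.re_sum]
    refine Finset.sum_nonneg fun i _ => ?_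
    rw [Matrix.diag_apply, Matrix.mul_apply, Complex.re_sum]
    refine Finset.sum_nonneg fun j _ => ?_
    rw [Matrix.star_apply, show star (P i j) = conj (P i j) from rfl, Complex.mul_conj]
    exact Complex.normSq_nonneg _
  rw [hPP, Matrix.trace_smul, htr] at hnn
  norm_num at hnn

/-- A lift `u` in SU(3) has `u² = c` with `c³ = 1`, by determinants. Then `c u` has square `c³ = 1`
and determinant 1. -/
theorem exists_involution_lift {g : Repar 3} (hr : g.right = 1) (h2 : g * g = 1) :
    ∃ h : U3, rep h 1 = g ∧ h * h = 1 ∧ (h : Matrix (Fin 3) (Fin 3) ℂ).det = 1 := by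
  obtain ⟨u, hu⟩ : ∃ u : SU 3, QuotientGroup.mk u = g.left := QuotientGroup.mk_surjective g.left
  have hdet : (suIncl u : Matrix (Fin 3) (Fin 3) ℂ).det = 1 :=
    (Matrix.mem_specialUnitaryGroup_iff.1 u.2).2
  have hg : rep (suIncl u) 1 = g := SemidirectProduct.ext ((proj_suIncl u).trans hu) hr.symm
  rw [← hg, rep_mul, ← rep_one, eq_comm, rep_eq_iff, one_mul, twistU_unit] at h2
  obtain ⟨-, c, hc⟩ := h2
  rw [Submonoid.coe_mul, Submonoid.coe_one] at hc
  have hc3 : c ^ 3 = 1 := by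
    have := congrArg Matrix.det hc
    rw [Matrix.det_mul, hdet, Matrix.det_smul, Matrix.det_one] at this
    simpa using this.symm
  have hcn : ‖c‖ = 1 := by
    have : ‖c‖ ^ 3 = 1 := by rw [← norm_pow, hc3, norm_one]
    exact (pow_eq_one_iff_of_nonneg (norm_nonneg c) (by norm_num)).1 this
  refine ⟨⟨c • (suIncl u : Matrix (Fin 3) (Fin 3) ℂ), smul_mem_unitary hcn _⟩, ?_, ?_, ?_⟩
  · rw [← hg, eq_comm, rep_eq_iff]
    exact ⟨rfl, c, rfl⟩
  · apply Subtype.ext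
    change (c • (suIncl u : Matrix (Fin 3) (Fin 3) ℂ)) * (c • (suIncl u : Matrix (Fin 3) (Fin 3) ℂ))
      = 1
    rw [Matrix.smul_mul, Matrix.mul_smul, hc, smul_smul, smul_smul,
      show c * c * c = 1 by rw [← hc3]; ring, one_smul]
  · change (c • (suIncl u : Matrix (Fin 3) (Fin 3) ℂ)).det = 1
    rw [Matrix.det_smul, hdet, Fintype.card_fin, hc3, one_mul]

/-- The commutator is a scalar `c`. Determinants give `c³ = 1` and the involution `b` gives `c² =
1`. -/
theorem involution_lifts_commute {a b : U3} (hb : b * b = 1)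
    (h : rep a 1 * rep b 1 = rep b 1 * rep a 1) : a * b = b * a := by
  rw [rep_mul, rep_mul, rep_eq_iff, twistU_unit, twistU_unit] at h
  obtain ⟨-, c, hc⟩ := h
  have hcn := unit_of_smul hc
  have h3 : c ^ 3 = 1 := by
    have := congrArg Matrix.det hc
    rw [Submonoid.coe_mul, Submonoid.coe_mul, Matrix.det_smul, Matrix.det_mul, Matrix.det_mul,
      Fintype.card_fin] at this
    have ha0 : (a : Matrix (Fin 3) (Fin 3) ℂ).det ≠ 0 :=
      norm_ne_zero_iff.1 (by rw [norm_det_unitary]; norm_num)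
    have hb0 : (b : Matrix (Fin 3) (Fin 3) ℂ).det ≠ 0 :=
      norm_ne_zero_iff.1 (by rw [norm_det_unitary]; norm_num)
    exact mul_right_cancel₀ (mul_ne_zero ha0 hb0) (by linear_combination (-1 : ℂ) * this)
  have h2 : c ^ 2 = 1 := by
    have e1 : (a : Matrix (Fin 3) (Fin 3) ℂ) = (c ^ 2) • (a : Matrix (Fin 3) (Fin 3) ℂ) := by
      have hbm : (b : Matrix (Fin 3) (Fin 3) ℂ) * b = 1 := congrArg Subtype.val hb
      rw [Submonoid.coe_mul, Submonoid.coe_mul] at hc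
      calc (a : Matrix (Fin 3) (Fin 3) ℂ) = b * (b * a) := by rw [← mul_assoc, hbm, one_mul]
        _ = c • (b * (a * b)) := by rw [hc, Matrix.mul_smul]
        _ = c • ((b * a) * b) := by rw [mul_assoc]
        _ = (c ^ 2) • (a * (b * b)) := by
          rw [hc, Matrix.smul_mul, smul_smul, mul_assoc, sq]
        _ = _ := by rw [hbm, mul_one]
    have e2 := congrArg Matrix.det e1
    have e3 := unit_of_smul (M := a) (N := a) e1
    have ha : (a : Matrix (Fin 3) (Fin 3) ℂ) ≠ 0 := by
      intro h0
      have := norm_det_unitary a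
      rw [h0] at this
      simp at this
    have : (c ^ 2 - 1) • (a : Matrix (Fin 3) (Fin 3) ℂ) = 0 := by
      rw [sub_smul, one_smul, ← e1, sub_self]
    exact sub_eq_zero.1 ((smul_eq_zero.1 this).resolve_right ha)
  have h1 : c = 1 := by
    calc c = c ^ 3 := by rw [pow_succ, h2, one_mul]
      _ = 1 := h3
  apply Subtype.ext
  rw [hc, h1, one_smul]

theorem abelian_antiunitary_classification {A : Subgroup (Repar 3)} (hA : IsAbelianRealizableCP A) :
    HasType A typeZ2 ∨ HasType A typeZ2Z2 ∨ HasType A typeZ2Z2Z2 ∨ HasType A typeZ4 := by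
  obtain ⟨hab, ⟨V, rfl⟩, Θ, hΘ, hΘa⟩ := hA
  by_cases hsq : ∃ Θ' ∈ V.aut, IsAntiunitary Θ' ∧ Θ' * Θ' ≠ 1
  · obtain ⟨Θ', h1, h2, h3⟩ := hsq
    exact Or.inr (Or.inr (Or.inr (hasType_of_sq_ne hab h1 h2 h3)))
  · push Not at hsq
    have hall : ∀ a ∈ V.aut, a * a = 1 := by
      intro a ha
      by_cases har : a.right = 1
      · have h1 := hsq _ (V.aut.mul_mem hΘ ha) (by
          change (Θ * a).right ≠ 1
          rw [SemidirectProduct.mul_right, har, mul_one]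
          exact hΘa)
        have h2 := hsq Θ hΘ hΘa
        calc a * a = (Θ * Θ) * (a * a) := by rw [h2, one_mul]
          _ = Θ * (Θ * a) * a := by group
          _ = Θ * (a * Θ) * a := by rw [hab _ hΘ _ ha]
          _ = Θ * a * (Θ * a) := by group
          _ = 1 := h1
      · exact hsq a ha har
    have := hasType_of_sq hall hΘ hΘa (by
      intro a ha b hb c hc har hbr hcr
      obtain ⟨x, rfl, x2, xd⟩ := exists_involution_lift har (hall a ha)
      obtain ⟨y, rfl, y2, yd⟩ := exists_involution_lift hbr (hall b hb)
      obtain ⟨z, rfl, z2, zd⟩ := exists_involution_lift hcr (hall c hc)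
      have key := commuting_involutions x2 y2 z2
        (involution_lifts_commute y2 (hab _ ha _ hb))
        (involution_lifts_commute z2 (hab _ ha _ hc))
        (involution_lifts_commute z2 (hab _ hb _ hc)) xd yd zd
      simp only [rep_mul, twistU_unit, mul_one]
      rcases key with h | h | h | h | h | h | h <;> simp [h, rep_one])
    tauto

/-! ### Simultaneous diagonalization -/

open Module.End in
theorem exists_orthonormalBasis_joint_eigenvectors {ι : Type*}
    (T : ι → EuclideanSpace ℂ (Fin 3) →ₗ[ℂ] EuclideanSpace ℂ (Fin 3))
    (hT : ∀ i, (T i).IsSymmetric) (hC : ∀ i j, Commute (T i) (T j)) :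
    ∃ b : OrthonormalBasis (Fin 3) ℂ (EuclideanSpace ℂ (Fin 3)),
      ∀ k i, ∃ c : ℂ, T i (b k) = c • b k := by
  classical
  have hI := LinearMap.IsSymmetric.directSum_isInternal_of_pairwise_commute hT
    (fun i j _ => hC i j)
  have hO := LinearMap.IsSymmetric.orthogonalFamily_iInf_eigenspaces hT
  set W := fun γ : ι → ℂ => (⨅ j, eigenspace (T j) (γ j) :
    Submodule ℂ (EuclideanSpace ℂ (Fin 3))) with hW
  have hfin : {γ | W γ ≠ ⊥}.Finite :=
    WellFoundedGT.finite_ne_bot_of_iSupIndep hI.submodule_iSupIndep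
  have : Fintype {γ // W γ ≠ ⊥} := hfin.fintype
  have hI' := DirectSum.isInternal_ne_bot_iff.2 hI
  have hO' := hO.comp (Subtype.val_injective (p := fun γ => W γ ≠ ⊥))
  refine ⟨hI'.subordinateOrthonormalBasis (n := 3) (by simp) hO', fun k i => ?_⟩
  have hk := hI'.subordinateOrthonormalBasis_subordinate (n := 3) (by simp) k hO'
  exact ⟨_, mem_eigenspace_iff.1 ((Submodule.mem_iInf _).1 hk i)⟩

/-- The Hermitian matrices `z u + z̄ u*` all commute, so they have a joint orthonormal eigenbasis;
its vectors are eigenvectors of every `u` too. -/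
theorem exists_diagonalizing_unitary {ι : Type*} (u : ι → U3)
    (hu : ∀ i j, u i * u j = u j * u i) :
    ∃ s : U3, ∀ i, ((s⁻¹ * u i * s : U3) : Matrix (Fin 3) (Fin 3) ℂ).IsDiag := by
  let H : ι × ℂ → Matrix (Fin 3) (Fin 3) ℂ := fun x =>
    x.2 • (u x.1 : Matrix (Fin 3) (Fin 3) ℂ) + star x.2 • star (u x.1 : Matrix (Fin 3) (Fin 3) ℂ)
  have hH : ∀ x, (H x).IsHermitian := by
    intro x
    change star (H x) = H x
    simp only [H, star_add, star_smul, star_star]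
    exact add_comm _ _
  have hcm : ∀ v w : U3, v * w = w * v →
      Commute (v : Matrix (Fin 3) (Fin 3) ℂ) (w : Matrix (Fin 3) (Fin 3) ℂ) :=
    fun v w h => congrArg Subtype.val h
  have hHC : ∀ x y, Commute (H x) (H y) := by
    intro x y
    have h : Commute (u x.1) (u y.1) := hu x.1 y.1
    have c1 := hcm _ _ h
    have c2 := hcm _ _ (h.inv_left : Commute (u x.1)⁻¹ (u y.1))
    have c3 := hcm _ _ (h.inv_right : Commute (u x.1) (u y.1)⁻¹)
    have c4 := hcm _ _ (h.inv_inv : Commute (u x.1)⁻¹ (u y.1)⁻¹)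
    exact (((c1.smul_right _).smul_left _).add_right ((c3.smul_right _).smul_left _)).add_left
      (((c2.smul_right _).smul_left _).add_right ((c4.smul_right _).smul_left _))
  obtain ⟨b, hb⟩ := exists_orthonormalBasis_joint_eigenvectors
    (fun x => Matrix.toEuclideanLin (H x))
    (fun x => Matrix.isSymmetric_toEuclideanLin_iff.2 (hH x))
    (fun x y => by
      change _ * _ = _ * _
      apply LinearMap.ext
      intro v
      simp only [Module.End.mul_apply, Matrix.toLpLin_apply, Matrix.mulVec_mulVec, (hHC x y).eq])
  refine ⟨⟨(EuclideanSpace.basisFun (Fin 3) ℂ).toBasis.toMatrix b,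
    OrthonormalBasis.toMatrix_orthonormalBasis_mem_unitary _ _⟩, fun i => ?_⟩
  set S : Matrix (Fin 3) (Fin 3) ℂ := (EuclideanSpace.basisFun (Fin 3) ℂ).toBasis.toMatrix b
    with hS
  have hSa : ∀ j k, S j k = b k j := by
    intro j k
    rw [hS, Module.Basis.toMatrix_apply]
    simp
  have hSu : star S * S = 1 := Matrix.mem_unitaryGroup_iff'.1
    (OrthonormalBasis.toMatrix_orthonormalBasis_mem_unitary _ _)
  have key : ∀ k, ∃ c : ℂ, ∀ j, ((u i : Matrix (Fin 3) (Fin 3) ℂ) * S) j k = c * S j k := by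
    intro k
    obtain ⟨c, hc⟩ := hb k (i, 1)
    obtain ⟨d, hd⟩ := hb k (i, Complex.I)
    -- The values `z = 1` and `z = i` recover `u` as `(H₁ - i Hᵢ) / 2`.
    refine ⟨(c - Complex.I * d) / 2, fun j => ?_⟩
    have hc' := congrArg (fun v : EuclideanSpace ℂ (Fin 3) => v j) hc
    have hd' := congrArg (fun v : EuclideanSpace ℂ (Fin 3) => v j) hd
    simp [Matrix.toLpLin_apply, H] at hc' hd'
    rw [Matrix.mul_apply]
    simp only [hSa]
    change (u i : Matrix (Fin 3) (Fin 3) ℂ).mulVec (b k).ofLp j = _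
    linear_combination (1 / 2 : ℂ) * hc' - (Complex.I / 2) * hd' +
      ((1 / 2 : ℂ) * (u i : Matrix (Fin 3) (Fin 3) ℂ).mulVec (b k).ofLp j - (1 / 2 : ℂ) *
        (star (u i : Matrix (Fin 3) (Fin 3) ℂ)).mulVec (b k).ofLp j) * Complex.I_sq
  intro j k hjk
  obtain ⟨c, hc⟩ := key k
  change (star S * (u i : Matrix (Fin 3) (Fin 3) ℂ) * S) j k = 0
  rw [mul_assoc, Matrix.mul_apply]
  simp only [hc]
  have := congrFun (congrFun hSu j) k
  rw [Matrix.mul_apply, Matrix.one_apply_ne hjk] at this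
  calc _ = c * ∑ l, star S j l * S l k := by
        rw [Finset.mul_sum]; exact Finset.sum_congr rfl fun l _ => by ring
    _ = 0 := by rw [this, mul_zero]

/-! ### The group `ℤ₃ × ℤ₃` -/

theorem proj_mem_autUnitary_pull (V : Potential 3) (s M : U3) :
    proj M ∈ (V.pull s).autUnitary ↔ proj (s * M * s⁻¹) ∈ V.autUnitary := by
  rw [proj_mem_autUnitary, inv_pull_iff, twistU_unit, proj_mem_autUnitary]

/-- A symmetry group of exponent three whose lifts to `U(3)` commute has at most four elements. -/
theorem card_le_four_of_lifts_commute {V : Potential 3} (h3 : ∀ g ∈ V.autUnitary, g ^ 3 = 1)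
    (hc : ∀ M N : U3, proj M ∈ V.autUnitary → proj N ∈ V.autUnitary → M * N = N * M) :
    Nat.card V.autUnitary ≤ 4 := by
  obtain ⟨s, hs⟩ := exists_diagonalizing_unitary
    (fun M : {M : U3 // proj M ∈ V.autUnitary} => M.1) (fun M N => hc _ _ M.2 N.2)
  have hexp : ∀ x : (V.pull s).torusSymm, x ^ 3 = 1 := by
    rintro ⟨x, hx⟩
    have hx' : proj (s * torusU x * s⁻¹) ∈ V.autUnitary := (proj_mem_autUnitary_pull _ _ _).1 hx
    have e := h3 _ hx'
    rw [← map_pow, conj_pow, map_mul, map_mul, map_inv, mul_inv_eq_one, mul_eq_left, ← map_pow] at e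
    exact Subtype.ext (torusHom_injective (e.trans (map_one _).symm))
  have hfin : Finite (V.pull s).torusSymm ∧ Nat.card (V.pull s).torusSymm ≤ 4 := by
    -- Each infinite type has a circle factor, and the element -1 in it violates exponent three.
    have hneg : ((-1 : Circle)) ^ 3 ≠ 1 := by
      intro h
      have := congrArg (fun z : Circle => (z : ℂ)) h
      norm_num at this
    rcases torusSymm_classification (V.pull s) with h | ⟨⟨e⟩⟩ | ⟨⟨e⟩⟩ | ⟨⟨e⟩⟩
    · exact h
    · exact absurd (by rw [← e.apply_symm_apply (-1), ← map_pow, hexp, map_one]) hneg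
    · have : ((-1, 1) : Circle × Cyc 2) ^ 3 = 1 := by
        rw [← e.apply_symm_apply (-1, 1), ← map_pow, hexp, map_one]
      exact absurd (congrArg Prod.fst this) hneg
    · have : ((-1, 1) : Circle × Circle) ^ 3 = 1 := by
        rw [← e.apply_symm_apply (-1, 1), ← map_pow, hexp, map_one]
      exact absurd (congrArg Prod.fst this) hneg
  obtain ⟨_, hcard⟩ := hfin
  have key : ∀ g : V.autUnitary, ∃ x : (V.pull s).torusSymm,
      proj s * torusHom x * (proj s)⁻¹ = g := by
    rintro ⟨g, hg⟩
    obtain ⟨M, rfl⟩ := proj_surjective g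
    obtain ⟨x, hx⟩ := exists_torusU (hs ⟨M, hg⟩)
    have e : proj s * torusHom x * (proj s)⁻¹ = proj M := by
      rw [hx]
      simp only [map_mul, map_inv]
      group
    refine ⟨⟨x, ?_⟩, e⟩
    change torusHom x ∈ (V.pull s).autUnitary
    rw [hx, proj_mem_autUnitary_pull]
    convert hg using 2
    group
  choose f hf using key
  refine (Nat.card_le_card_of_injective f fun a b hab => ?_).trans hcard
  exact Subtype.ext (by rw [← hf a, ← hf b, hab])

/-- A potential that is invariant under the clock and shift matrices is invariant under the
permutation matrix of `x ↦ -x`. -/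
theorem inv_neg_of_clock_shift {V : Potential 3} {c : Circle} (hc : c ≠ 1) (hc3 : c ^ 3 = 1)
    (hclock : V.Inv (monoU (fun a => c ^ (a : ℕ)) 1) 1)
    (hshift : V.Inv (monoU (fun _ => 1) (Equiv.subRight 1)) 1) :
    V.Inv (monoU (fun _ => 1) (Equiv.neg (Fin 3))) 1 := by
  obtain ⟨cY, cZ⟩ := (inv_monoMat_iff _ _ _).1 hclock
  obtain ⟨sY, sZ⟩ := (inv_monoMat_iff _ _ _).1 hshift
  simp only [Circle.coe_one, map_one, one_mul, Equiv.subRight_apply] at sY sZ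
  simp only [Equiv.Perm.coe_one, id] at cY cZ
  have hord : orderOf c = 3 := orderOf_eq_prime hc3 hc
  have hmod : ∀ m n : ℕ, (c : ℂ) ^ m = (c : ℂ) ^ n → m % 3 = n % 3 := by
    intro m n h
    rw [← hord]
    exact pow_inj_mod.1 (Circle.ext (by rw [Circle.coe_pow, Circle.coe_pow, h]))
  have hinv : ∀ n : ℕ, conj ((c ^ n : Circle) : ℂ) * (c : ℂ) ^ n = 1 := by
    intro n
    rw [← Circle.coe_pow]
    exact circle_conj_mul _
  have hY : ∀ a b, V.Y a b ≠ 0 → a = b := by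
    intro a b h
    have e := mul_right_cancel₀ h ((cY a b).trans (one_mul _).symm)
    have e' : (c : ℂ) ^ (b : ℕ) = c ^ (a : ℕ) := by
      rw [Circle.coe_pow c (b : ℕ)] at e
      linear_combination (c : ℂ) ^ (a : ℕ) * e - (c : ℂ) ^ (b : ℕ) * hinv a
    have := hmod _ _ e'
    exact Fin.ext (by omega)
  -- The clock matrix leaves only monomials that conserve the index sum modulo 3; `Fin 3` addition
  -- is modular.
  have hZ : ∀ a b a' b', V.Z a b a' b' ≠ 0 → a + a' = b + b' := by
    intro a b a' b' h
    have e := mul_right_cancel₀ h ((cZ a b a' b').trans (one_mul _).symm)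
    have e' : (c : ℂ) ^ ((b : ℕ) + b') = c ^ ((a : ℕ) + a') := by
      rw [Circle.coe_pow c (b : ℕ), Circle.coe_pow c (b' : ℕ)] at e
      rw [pow_add, pow_add]
      linear_combination (c : ℂ) ^ (a : ℕ) * (c : ℂ) ^ (a' : ℕ) * e -
        (c : ℂ) ^ (b : ℕ) * (c : ℂ) ^ (b' : ℕ) * hinv a * (conj ((c ^ (a' : ℕ) : Circle) : ℂ) *
          (c : ℂ) ^ (a' : ℕ)) - (c : ℂ) ^ (b : ℕ) * (c : ℂ) ^ (b' : ℕ) * hinv a'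
    have := hmod _ _ e'
    exact Fin.ext (by rw [Fin.val_add, Fin.val_add]; omega)
  have two : ∀ a : Fin 3, a - 1 - 1 = a - 2 := by decide
  have tY : ∀ k a b, V.Y a b = V.Y (a - k) (b - k) := by
    intro k a b
    fin_cases k
    · simp
    · exact sY a b
    · rw [sY, sY, two, two]; rfl
  have tZ : ∀ k a b a' b', V.Z a b a' b' = V.Z (a - k) (b - k) (a' - k) (b' - k) := by
    intro k a b a' b'
    fin_cases k
    · simp
    · exact sZ a b a' b'
    · rw [sZ, sZ, two, two, two, two]; rfl
  have key : ∀ z w : ℂ, (z ≠ 0 → z = w) → (w ≠ 0 → z = w) → z = w := by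
    intro z w h1 h2
    by_cases hz : z = 0
    · by_cases hw : w = 0
      · rw [hz, hw]
      · exact h2 hw
    · exact h1 hz
  refine (inv_monoMat_iff _ _ _).2 ⟨fun a b => ?_, fun a b a' b' => ?_⟩ <;>
    simp only [Circle.coe_one, map_one, one_mul, Equiv.neg_apply]
  · have main : a = b → V.Y a b = V.Y (-a) (-b) := by
      rintro rfl
      rw [tY (a + a) a a, sub_add_cancel_left]
    exact key _ _ (fun h => main (hY _ _ h)) fun h => main (neg_injective (hY _ _ h))
  -- Exchange the two bilinears and translate all indices by the common sum: `a' - (a + a') = -a`,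
  -- and likewise for the others.
  · have main : a + a' = b + b' → V.Z a b a' b' = V.Z (-a) (-b) (-a') (-b') := by
      intro h
      rw [V.Z_symm a b a' b', tZ (a + a') a' b' a b, sub_add_cancel_left, sub_add_cancel_right, h,
        sub_add_cancel_left, sub_add_cancel_right]
    exact key _ _ (fun h => main (hZ _ _ _ _ h)) fun h => main (by
      have := hZ _ _ _ _ h
      rw [← neg_add, ← neg_add] at this
      exact neg_injective this)

/-- Take an eigenvector `v` of `a`. The relation makes `v`, `b v`, `b² v` eigenvectors whose
eigenvalues differ by distinct powers of `c`, so they are orthogonal. In this basis `a` is the clock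
up to a phase and `b` is the shift. -/
theorem exists_clock_shift_basis {a b : U3} {c : Circle} (hc : c ≠ 1) (hc3 : c ^ 3 = 1)
    (hab : ((a * b : U3) : Matrix (Fin 3) (Fin 3) ℂ) = (c : ℂ) • ((b * a : U3) : Matrix _ _ ℂ))
    (hb : b ^ 3 = 1) :
    ∃ s : U3, proj (s⁻¹ * a * s) = proj (monoU (fun i => c ^ (i : ℕ)) 1) ∧
      s⁻¹ * b * s = monoU (fun _ => 1) (Equiv.subRight 1) := by
  obtain ⟨r, hr⟩ := exists_diagonalizing_unitary (fun _ : Unit => a) (fun _ _ => rfl)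
  set D : U3 := r⁻¹ * a * r with hD
  set B : U3 := r⁻¹ * b * r with hB
  have hdiag : (D : Matrix (Fin 3) (Fin 3) ℂ).IsDiag := hr ()
  have hnorm := unitary_diag_norm D.2 hdiag
  have hDapp : ∀ (N : Matrix (Fin 3) (Fin 3) ℂ) i j,
      ((D : Matrix (Fin 3) (Fin 3) ℂ) * N) i j = (D : Matrix (Fin 3) (Fin 3) ℂ) i i * N i j := by
    intro N i j
    rw [Matrix.mul_apply, Finset.sum_eq_single i]
    · intro k _ hk
      rw [hdiag hk.symm, zero_mul]
    · simp
  have hDapp' : ∀ (N : Matrix (Fin 3) (Fin 3) ℂ) i j,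
      (N * (D : Matrix (Fin 3) (Fin 3) ℂ)) i j = N i j * (D : Matrix (Fin 3) (Fin 3) ℂ) j j := by
    intro N i j
    rw [Matrix.mul_apply, Finset.sum_eq_single j]
    · intro k _ hk
      rw [hdiag hk, mul_zero]
    · simp
  have hB3 : B ^ 3 = 1 := by
    have : B = r⁻¹ * b * r⁻¹⁻¹ := by rw [inv_inv]
    rw [this, conj_pow, hb]
    group
  have hDB : (D : Matrix (Fin 3) (Fin 3) ℂ) * B = (c : ℂ) • ((B : Matrix (Fin 3) (Fin 3) ℂ) * D) := by
    have e1 : D * B = r⁻¹ * (a * b) * r := by rw [hD, hB]; group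
    have e2 : B * D = r⁻¹ * (b * a) * r := by rw [hD, hB]; group
    calc (D : Matrix (Fin 3) (Fin 3) ℂ) * B
        = (r⁻¹ : U3) * ((a * b : U3) : Matrix (Fin 3) (Fin 3) ℂ) * r := congrArg Subtype.val e1
      _ = (c : ℂ) • (((r⁻¹ : U3) : Matrix (Fin 3) (Fin 3) ℂ) *
            ((b * a : U3) : Matrix (Fin 3) (Fin 3) ℂ) * r) := by
          rw [hab, Matrix.mul_smul, Matrix.smul_mul]
      _ = _ := congrArg (fun u : U3 => (c : ℂ) • (u : Matrix (Fin 3) (Fin 3) ℂ)) e2.symm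
  have hDBk : ∀ k : ℕ, (D : Matrix (Fin 3) (Fin 3) ℂ) * (B : Matrix (Fin 3) (Fin 3) ℂ) ^ k =
      (c : ℂ) ^ k • ((B : Matrix (Fin 3) (Fin 3) ℂ) ^ k * D) := by
    intro k
    induction k with
    | zero => simp
    | succ k ih =>
      rw [pow_succ, ← mul_assoc, ih, Matrix.smul_mul, mul_assoc, hDB, Matrix.mul_smul, smul_smul,
        ← mul_assoc, pow_succ]
  let S : Matrix (Fin 3) (Fin 3) ℂ :=
    Matrix.of fun i k => ((B : Matrix (Fin 3) (Fin 3) ℂ) ^ (k : ℕ)) i 0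
  have hS : ∀ i k, (D : Matrix (Fin 3) (Fin 3) ℂ) i i * S i k =
      (c : ℂ) ^ (k : ℕ) * (D : Matrix (Fin 3) (Fin 3) ℂ) 0 0 * S i k := by
    intro i k
    have := congrFun (congrFun (hDBk k) i) 0
    rw [hDapp, Matrix.smul_apply, hDapp', smul_eq_mul] at this
    simp only [S, Matrix.of_apply]
    linear_combination this
  have hSu : S ∈ Matrix.unitaryGroup (Fin 3) ℂ := by
    rw [Matrix.mem_unitaryGroup_iff']
    ext j k
    rw [Matrix.mul_apply]
    simp only [Matrix.star_apply]
    by_cases hjk : j = k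
    · subst hjk
      rw [Matrix.one_apply_eq]
      have := unitary_col (B ^ (j : ℕ)) 0 0
      rw [if_pos rfl, SubmonoidClass.coe_pow] at this
      exact this
    · rw [Matrix.one_apply_ne hjk]
      -- Inserting the eigenvalue equations multiplies this inner product by `c ^ (k - j)`, which is
      -- not 1.
      set t := ∑ x, star (S x j) * S x k with ht
      have e : t = conj ((c ^ (j : ℕ) : Circle) : ℂ) * (c ^ (k : ℕ) : Circle) * t := by
        rw [ht, Finset.mul_sum]
        refine Finset.sum_congr rfl fun x _ => ?_
        have e1 := congrArg conj (hS x j)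
        have e2 := hS x k
        have n1 := conj_mul_self_eq_one.2 (hnorm x)
        have n0 := conj_mul_self_eq_one.2 (hnorm 0)
        simp only [map_mul, map_pow] at e1
        simp only [Circle.coe_pow, map_pow]
        change conj (S x j) * S x k = _ * (conj (S x j) * S x k)
        calc conj (S x j) * S x k
            = (conj ((D : Matrix (Fin 3) (Fin 3) ℂ) x x) * conj (S x j)) *
              ((D : Matrix (Fin 3) (Fin 3) ℂ) x x * S x k) := by
                linear_combination (-(conj (S x j) * S x k)) * n1
          _ = _ := by
                rw [e1, e2]
                linear_combination (conj (c : ℂ) ^ (j : ℕ) * (c : ℂ) ^ (k : ℕ) *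
                  (conj (S x j) * S x k)) * n0
      by_contra h0
      have e1 : conj ((c ^ (j : ℕ) : Circle) : ℂ) * (c ^ (k : ℕ) : Circle) = 1 :=
        mul_right_cancel₀ h0 (by rw [← e, one_mul])
      rw [circle_conj_eq_inv, inv_mul_eq_one₀ (Circle.coe_ne_zero _)] at e1
      have e2 := pow_inj_mod.1 (Circle.ext e1)
      rw [orderOf_eq_prime hc3 hc] at e2
      exact hjk (Fin.ext (by omega))
  refine ⟨r * ⟨S, hSu⟩, ?_, ?_⟩
  · rw [show (r * ⟨S, hSu⟩)⁻¹ * a * (r * ⟨S, hSu⟩) = (⟨S, hSu⟩ : U3)⁻¹ * D * ⟨S, hSu⟩ by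
      rw [hD]; group, eq_comm, proj_eq_iff]
    refine ⟨(D : Matrix (Fin 3) (Fin 3) ℂ) 0 0, ?_⟩
    have e : (D : Matrix (Fin 3) (Fin 3) ℂ) * S = (D : Matrix (Fin 3) (Fin 3) ℂ) 0 0 •
        (S * (monoU (fun i => c ^ (i : ℕ)) 1 : Matrix (Fin 3) (Fin 3) ℂ)) := by
      ext i k
      rw [hDapp, hS, Matrix.smul_apply, Matrix.mul_apply, Finset.sum_eq_single k]
      · simp [monoU, monoMat]
        ring
      · intro l _ hl
        simp [monoU, monoMat, hl.symm]
      · simp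
    rw [Submonoid.coe_mul, Submonoid.coe_mul, mul_assoc]
    change star S * ((D : Matrix (Fin 3) (Fin 3) ℂ) * S) = _
    rw [e, Matrix.mul_smul, ← mul_assoc, Matrix.mem_unitaryGroup_iff'.1 hSu, one_mul]
  · rw [show (r * ⟨S, hSu⟩)⁻¹ * b * (r * ⟨S, hSu⟩) = (⟨S, hSu⟩ : U3)⁻¹ * (B * ⟨S, hSu⟩) by
      rw [hB]; group, inv_mul_eq_iff_eq_mul]
    apply Subtype.ext
    have hB3' : (B : Matrix (Fin 3) (Fin 3) ℂ) ^ 3 = 1 := congrArg Subtype.val hB3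
    change (B : Matrix (Fin 3) (Fin 3) ℂ) * S =
      S * (monoU (fun _ => 1) (Equiv.subRight 1) : Matrix (Fin 3) (Fin 3) ℂ)
    ext i k
    have h1 : (S * (monoU (fun _ => 1) (Equiv.subRight 1) : Matrix (Fin 3) (Fin 3) ℂ)) i k =
        S i (k + 1) := by
      rw [Matrix.mul_apply, Finset.sum_eq_single (k + 1)]
      · simp [monoU, monoMat]
      · intro l _ hl
        simp only [monoU, monoMat, Matrix.of_apply, Equiv.subRight_apply]
        rw [if_neg, mul_zero]
        intro h
        exact hl (eq_sub_iff_add_eq.1 h).symm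
      · simp
    rw [h1]
    have h2 : ((B : Matrix (Fin 3) (Fin 3) ℂ) * S) i k =
        ((B : Matrix (Fin 3) (Fin 3) ℂ) ^ ((k : ℕ) + 1)) i 0 := by
      rw [pow_succ', Matrix.mul_apply, Matrix.mul_apply]
      rfl
    rw [h2]
    fin_cases k
    · rfl
    · rfl
    · change ((B : Matrix (Fin 3) (Fin 3) ℂ) ^ 3) i 0 = ((B : Matrix (Fin 3) (Fin 3) ℂ) ^ 0) i 0
      rw [hB3', pow_zero]

/-- An abelian unitary symmetry group of exponent three has at most four elements. -/
theorem card_le_four_of_exponent_three {V : Potential 3} (h3 : ∀ g ∈ V.autUnitary, g ^ 3 = 1)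
    (hcomm : ∀ g ∈ V.autUnitary, ∀ h ∈ V.autUnitary, g * h = h * g) :
    Nat.card V.autUnitary ≤ 4 := by
  refine card_le_four_of_lifts_commute h3 fun M N hM hN => ?_
  -- Noncommuting lifts have a nontrivial cube root of unity as commutator and hence give a clock
  -- and shift pair.
  by_contra hne
  have h1 := hcomm _ hM _ hN
  rw [← map_mul, ← map_mul, proj_eq_iff] at h1
  obtain ⟨c', hc'⟩ := h1
  obtain ⟨c, rfl⟩ : ∃ c : Circle, (c : ℂ) = c' :=
    ⟨⟨c', mem_sphere_zero_iff_norm.2 (unit_of_smul hc')⟩, rfl⟩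
  have hc : c ≠ 1 := by
    rintro rfl
    rw [Circle.coe_one, one_smul] at hc'
    exact hne (Subtype.ext hc').symm
  have hdet0 : ∀ u : U3, (u : Matrix (Fin 3) (Fin 3) ℂ).det ≠ 0 := fun u =>
    norm_ne_zero_iff.1 (by rw [norm_det_unitary]; norm_num)
  have hc3 : c ^ 3 = 1 := by
    have := congrArg Matrix.det hc'
    rw [Submonoid.coe_mul, Submonoid.coe_mul, Matrix.det_smul, Matrix.det_mul, Matrix.det_mul,
      Fintype.card_fin] at this
    apply Circle.ext
    rw [Circle.coe_pow, Circle.coe_one]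
    exact mul_right_cancel₀ (mul_ne_zero (hdet0 M) (hdet0 N))
      (by linear_combination (-1 : ℂ) * this)
  obtain ⟨k, hk⟩ : ∃ k : ℂ, ((M ^ 3 : U3) : Matrix (Fin 3) (Fin 3) ℂ) =
      k • ((1 : U3) : Matrix (Fin 3) (Fin 3) ℂ) := by
    rw [← proj_eq_iff, map_one, map_pow, h3 _ hM]
  have hkn := unit_of_smul hk
  -- The cube of `M` is a scalar `k`; this phase rescales `M` to a matrix of cube exactly 1.
  obtain ⟨m, hm, hmk⟩ := exists_pow_eq_unit (n := 3) (by norm_num)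
    (show ‖k⁻¹‖ = 1 by rw [norm_inv, hkn, inv_one])
  set b : U3 := ⟨m • (M : Matrix (Fin 3) (Fin 3) ℂ), smul_mem_unitary hm M⟩ with hb
  have hbM : proj b = proj M := ((proj_eq_iff _ _).2 ⟨m, rfl⟩).symm
  have hb3 : b ^ 3 = 1 := by
    apply Subtype.ext
    rw [SubmonoidClass.coe_pow] at hk ⊢
    change (m • (M : Matrix (Fin 3) (Fin 3) ℂ)) ^ 3 = 1
    have hk0 : k ≠ 0 := norm_ne_zero_iff.1 (by rw [hkn]; norm_num)
    rw [smul_pow, hk, smul_smul, hmk, inv_mul_cancel₀ hk0, one_smul]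
    rfl
  obtain ⟨s, hs1, hs2⟩ := exists_clock_shift_basis (a := N) (b := b) hc hc3 (by
    change (N : Matrix (Fin 3) (Fin 3) ℂ) * (m • (M : Matrix (Fin 3) (Fin 3) ℂ)) =
      (c : ℂ) • ((m • (M : Matrix (Fin 3) (Fin 3) ℂ)) * (N : Matrix (Fin 3) (Fin 3) ℂ))
    rw [Submonoid.coe_mul, Submonoid.coe_mul] at hc'
    rw [Matrix.mul_smul, Matrix.smul_mul, hc', smul_comm]) hb3
  have hneg := inv_neg_of_clock_shift (V := V.pull s) hc hc3
    ((proj_mem_autUnitary _ _).1 (by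
      rw [← hs1, proj_mem_autUnitary_pull]
      convert hN using 2
      group))
    ((proj_mem_autUnitary _ _).1 (by
      rw [← hs2, proj_mem_autUnitary_pull, show s * (s⁻¹ * b * s) * s⁻¹ = b by group, hbM]
      exact hM))
  set n := monoU (fun _ => 1) (Equiv.neg (Fin 3)) with hn
  rw [← proj_mem_autUnitary, proj_mem_autUnitary_pull] at hneg
  have e := h3 _ hneg
  rw [← map_pow, conj_pow, map_mul, map_mul, map_inv, mul_inv_eq_one, mul_eq_left] at e
  -- With cube 1 in PSU(3), this involution would be scalar, but its entry at (1, 2) is nonzero.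
  have hn2 : n * n = 1 := by
    apply Subtype.ext
    ext i j
    rw [Submonoid.coe_mul]
    refine (monoMat_mul_apply _ _ _ _ _).trans ?_
    fin_cases i <;> fin_cases j <;> simp [hn, monoU, monoMat]
  rw [pow_succ, sq, hn2, one_mul, ← map_one proj, eq_comm, proj_eq_iff] at e
  obtain ⟨d, hd⟩ := e
  have := congrFun (congrFun hd 1) 2
  simp [hn, monoU, monoMat] at this
  exact this (by decide)

theorem not_realizable_Z3Z3 (A : Subgroup (PSU 3)) (hA : Nonempty (A ≃* (Cyc 3 × Cyc 3))) :
    ¬ RealizableUnitary A := by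
  rintro ⟨V, rfl⟩
  obtain ⟨e⟩ := hA
  have h3 : ∀ x : Cyc 3 × Cyc 3, x ^ 3 = 1 := by decide
  have := card_le_four_of_exponent_three (V := V)
    (fun g hg => congrArg Subtype.val (show (⟨g, hg⟩ : V.autUnitary) ^ 3 = 1 from
      e.injective (by rw [map_pow, h3, map_one])))
    (fun g hg h hh => congrArg Subtype.val (show (⟨g, hg⟩ : V.autUnitary) * ⟨h, hh⟩ =
      ⟨h, hh⟩ * ⟨g, hg⟩ from e.injective (by rw [map_mul, map_mul, mul_comm])))
  rw [Nat.card_congr e.toEquiv, Nat.card_prod, card_cyc] at this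
  norm_num at this

/-- A group of exponent three maps trivially to ℤ₂, so it is unitary and the previous case applies.
-/
theorem not_realizable_antiunitary_Z3Z3 (A : Subgroup (Repar 3))
    (hA : Nonempty (A ≃* (Cyc 3 × Cyc 3))) : ¬ Realizable A := by
  rintro ⟨V, rfl⟩
  obtain ⟨e⟩ := hA
  have h3 : ∀ x : Cyc 3 × Cyc 3, x ^ 3 = 1 := by decide
  have hr : ∀ g : V.aut, (g : Repar 3).right = 1 := by
    intro g
    have h1 : g ^ 3 = 1 := e.injective (by rw [map_pow, h3, map_one])
    have h2 := congrArg (fun x : V.aut => SemidirectProduct.rightHom (x : Repar 3)) h1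
    simp only [Subgroup.coe_pow, map_pow, Subgroup.coe_one, map_one] at h2
    have key : ∀ ε : Cyc 2, ε ^ 3 = 1 → ε = 1 := by decide
    exact key _ h2
  let f : V.autUnitary ≃* V.aut :=
    MulEquiv.ofBijective (SemidirectProduct.inl.subgroupComap V.aut) ⟨by
      intro x y hxy
      exact Subtype.ext (SemidirectProduct.inl_injective (congrArg Subtype.val hxy)), by
      intro g
      have hg : SemidirectProduct.inl (g : Repar 3).left = (g : Repar 3) :=
        SemidirectProduct.ext rfl (hr g).symm
      refine ⟨⟨(g : Repar 3).left, ?_⟩, Subtype.ext hg⟩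
      change SemidirectProduct.inl (g : Repar 3).left ∈ V.aut
      rw [hg]
      exact g.2⟩
  exact not_realizable_Z3Z3 _ ⟨f.trans e⟩ ⟨V, rfl⟩

end NHDM

end

theorem mainTheorem6 :
    -- the nontrivial realizable subgroups of the maximal torus, up to isomorphism
    ((∀ A : Subgroup (NHDM.PSU 3), A ≤ NHDM.torus 3 → NHDM.RealizableUnitary A → A ≠ ⊥ →
        Nonempty (A ≃ₜ* NHDM.Cyc 2) ∨ Nonempty (A ≃ₜ* NHDM.Cyc 3) ∨
        Nonempty (A ≃ₜ* NHDM.Cyc 4) ∨ Nonempty (A ≃ₜ* (NHDM.Cyc 2 × NHDM.Cyc 2)) ∨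
        Nonempty (A ≃ₜ* Circle) ∨ Nonempty (A ≃ₜ* (Circle × NHDM.Cyc 2)) ∨
        Nonempty (A ≃ₜ* (Circle × Circle))) ∧
      NHDM.TorusRealizes 3 (NHDM.Cyc 2) ∧ NHDM.TorusRealizes 3 (NHDM.Cyc 3) ∧
      NHDM.TorusRealizes 3 (NHDM.Cyc 4) ∧ NHDM.TorusRealizes 3 (NHDM.Cyc 2 × NHDM.Cyc 2) ∧
      NHDM.TorusRealizes 3 Circle ∧ NHDM.TorusRealizes 3 (Circle × NHDM.Cyc 2) ∧
      NHDM.TorusRealizes 3 (Circle × Circle)) ∧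
    -- the realizable abelian groups with antiunitary elements, up to isomorphism
    ((∀ A : Subgroup (NHDM.Repar 3), NHDM.IsAbelianRealizableCP A →
        NHDM.HasType A NHDM.typeZ2 ∨ NHDM.HasType A NHDM.typeZ2Z2 ∨
        NHDM.HasType A NHDM.typeZ2Z2Z2 ∨ NHDM.HasType A NHDM.typeZ4) ∧
      (∃ A : Subgroup (NHDM.Repar 3),
        NHDM.IsAbelianRealizableCP A ∧ NHDM.HasType A NHDM.typeZ2) ∧
      (∃ A : Subgroup (NHDM.Repar 3),
        NHDM.IsAbelianRealizableCP A ∧ NHDM.HasType A NHDM.typeZ2Z2) ∧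
      (∃ A : Subgroup (NHDM.Repar 3),
        NHDM.IsAbelianRealizableCP A ∧ NHDM.HasType A NHDM.typeZ2Z2Z2) ∧
      (∃ A : Subgroup (NHDM.Repar 3),
        NHDM.IsAbelianRealizableCP A ∧ NHDM.HasType A NHDM.typeZ4)) ∧
    -- no realizable group, in `PSU(3)` or in `PSU(3) ⋊ ℤ₂`, is isomorphic to `ℤ₃ × ℤ₃`
    ((∀ A : Subgroup (NHDM.PSU 3),
        Nonempty (A ≃* (NHDM.Cyc 3 × NHDM.Cyc 3)) → ¬ NHDM.RealizableUnitary A) ∧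
      (∀ A : Subgroup (NHDM.Repar 3),
        Nonempty (A ≃* (NHDM.Cyc 3 × NHDM.Cyc 3)) → ¬ NHDM.Realizable A)) := by
  exact ⟨⟨NHDM.realizable_torus_classification, NHDM.torusRealizes_all⟩,
    ⟨fun _ => NHDM.abelian_antiunitary_classification, NHDM.exists_typeZ2, NHDM.exists_typeZ2Z2,
      NHDM.exists_typeZ2Z2Z2, NHDM.exists_typeZ4⟩,
    NHDM.not_realizable_Z3Z3, NHDM.not_realizable_antiunitary_Z3Z3⟩
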